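/- Let $k$ be a field containing a primitive cube root of unity $\zeta_3$ (so $\operatorname{char} k\neq 3$), and let $n\ge 2$. For $i=1,\dots,n$ let $E_{3,i}$ be the elliptic curve over $k$ with affine equation $y_i^2+y_i=x_i^3$, i.e. the projective plane cubic $Y^2Z+YZ^2=X^3$, and let $\tau_3$ be its automorphism $(x,y)\mapsto(\zeta_3x,y)$. Let $$G_1=\langle(\tau_3,1,\dots,1,\tau_3),\,(1,\tau_3,1,\dots,1,\tau_3),\,\dots,\,(1,\dots,1,\tau_3,\tau_3)\rangle\subset\operatorname{Aut}_k(E_{3,1}\times\dots\times E_{3,n})$$ be the group generated by these $n-1$ automorphisms. Then $G_1\cong(\mathbb Z/3\mathbb Z)^{n-1}$, and the product $E_{3,1}\times\dots\times E_{3,n}$ is integral and has a quotient $\pi\colon E_{3,1}\times\dots\times E_{3,n}\to Y_n$ by $G_1$ in the category of $k$-schemes (the underlying space of $Y_n$ is the orbit space with the quotient topology, and $\mathcal O_{Y_n}=(\pi_*\mathcal O)^{G_1}$). The quotient $Y_n$ is integral and rational: it is birational over $k$ to the affine space $\mathbb A^n_k$. More precisely, regarded as a subfield of the function field $k(E_{3,1}\times\dots\times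 E_{3,n})$ through $\pi^*$, the function field of $Y_n$ is $$k(Y_n)=k(y_1,\dots,y_{n-2},z,\alpha),\qquad z=\frac{x_1x_2\cdots x_{n-1}}{x_n},\quad \alpha=\frac{y_n}{y_{n-1}},$$ and the $n$ elements $y_1,\dots,y_{n-2},z,\alpha$ are algebraically independent over $k$. -/

import Mathlib

open CategoryTheory CategoryTheory.Limits AlgebraicGeometry

universe u

noncomputable section

namespace CubicQuotient

/-! ### Grading on the quotient of a graded algebra by a homogeneous element -/

section GradedQuotient

variable {k A : Type*} [CommRing k] [CommRing A] [Algebra k A]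

/-- The grading induced on `A ⧸ (F)`: the degree `i` part is the image of the degree `i` part
of `A`. -/
def quotGrading (𝒜 : ℕ → Submodule k A) (F : A) (i : ℕ) : Submodule k (A ⧸ Ideal.span {F}) :=
  (𝒜 i).map (Ideal.Quotient.mkₐ k (Ideal.span {F})).toLinearMap

theorem mk_mem_quotGrading (𝒜 : ℕ → Submodule k A) (F : A) {i : ℕ} {a : A} (ha : a ∈ 𝒜 i) :
    Ideal.Quotient.mk (Ideal.span {F}) a ∈ quotGrading 𝒜 F i :=
  ⟨a, ha, rfl⟩

instance quotGrading_gradedMonoid (𝒜 : ℕ → Submodule k A) [GradedAlgebra 𝒜] (F : A) :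
    SetLike.GradedMonoid (quotGrading 𝒜 F) where
  one_mem := ⟨1, SetLike.GradedOne.one_mem, by simp⟩
  mul_mem := by
    rintro i j _ _ ⟨a, ha, rfl⟩ ⟨b, hb, rfl⟩
    exact ⟨a * b, SetLike.GradedMul.mul_mem ha hb, by simp⟩

/-- The reduction map `Aᵢ → (A ⧸ (F))ᵢ`. -/
def quotGradingMap (𝒜 : ℕ → Submodule k A) (F : A) (i : ℕ) : 𝒜 i →ₗ[k] quotGrading 𝒜 F i where
  toFun a := ⟨Ideal.Quotient.mk (Ideal.span {F}) a, mk_mem_quotGrading 𝒜 F a.2⟩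
  map_add' _ _ := Subtype.ext (map_add _ _ _)
  map_smul' _ _ := Subtype.ext rfl

/-- The map `A → ⨁ᵢ (A ⧸ (F))ᵢ` taking a homogeneous element to its class. -/
def toQuotDirectSum (𝒜 : ℕ → Submodule k A) [GradedAlgebra 𝒜] (F : A) :
    A →ₐ[k] DirectSum ℕ (fun i => quotGrading 𝒜 F i) :=
  (DirectSum.toAlgebra k (fun i => 𝒜 i)
    (fun i => (DirectSum.lof k ℕ (fun i => quotGrading 𝒜 F i) i).comp (quotGradingMap 𝒜 F i))
    (by rfl)
    (by
      intro i j a b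
      simp only [LinearMap.comp_apply, DirectSum.lof_eq_of]
      rw [DirectSum.of_mul_of]
      congr 1)).comp
    (DirectSum.decomposeAlgEquiv 𝒜).toAlgHom

theorem toQuotDirectSum_of_mem (𝒜 : ℕ → Submodule k A) [GradedAlgebra 𝒜] (F : A) {i : ℕ} {a : A}
    (ha : a ∈ 𝒜 i) :
    toQuotDirectSum 𝒜 F a =
      DirectSum.of (fun i => quotGrading 𝒜 F i) i ⟨_, mk_mem_quotGrading 𝒜 F ha⟩ := by
  change DirectSum.toAddMonoid (fun i => ((DirectSum.lof k ℕ (fun i => quotGrading 𝒜 F i) i).comp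
    (quotGradingMap 𝒜 F i)).toAddMonoidHom) (DirectSum.decompose 𝒜 a) = _
  rw [DirectSum.decompose_of_mem 𝒜 ha]
  exact DirectSum.toAddMonoid_of _ _ _

/-- The quotient of a graded algebra by the ideal of a homogeneous element is graded. -/
@[reducible]
def quotGradedAlgebra (𝒜 : ℕ → Submodule k A) [GradedAlgebra 𝒜] (F : A) {d : ℕ}
    (hF : F ∈ 𝒜 d) : GradedAlgebra (quotGrading 𝒜 F) :=
  GradedAlgebra.ofAlgHom _
    (Ideal.Quotient.liftₐ (Ideal.span {F}) (toQuotDirectSum 𝒜 F) (by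
      intro a ha
      obtain ⟨b, rfl⟩ := Ideal.mem_span_singleton.mp ha
      rw [map_mul, toQuotDirectSum_of_mem 𝒜 F hF]
      have : (⟨_, mk_mem_quotGrading 𝒜 F hF⟩ : quotGrading 𝒜 F d) = 0 :=
        Subtype.ext (Ideal.Quotient.eq_zero_iff_mem.mpr (Ideal.mem_span_singleton_self F))
      rw [this, map_zero, zero_mul]))
    (by
      apply Ideal.Quotient.algHom_ext
      ext a
      simp only [AlgHom.comp_apply, AlgHom.id_apply, Ideal.Quotient.mkₐ_eq_mk,
        Ideal.Quotient.liftₐ_apply]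
      change DirectSum.coeAlgHom (quotGrading 𝒜 F) (toQuotDirectSum 𝒜 F a) =
        Ideal.Quotient.mk _ a
      induction a using DirectSum.Decomposition.inductionOn 𝒜 with
      | zero => simp
      | homogeneous a =>
        rw [toQuotDirectSum_of_mem 𝒜 F a.2]
        exact DirectSum.coeAlgHom_of _ _ _
      | add a b ha hb => simp only [map_add, ha, hb])
    (by
      rintro i ⟨_, a, ha, rfl⟩
      exact toQuotDirectSum_of_mem 𝒜 F ha)

end GradedQuotient

/-! ### The plane cubic `y² + y = x³` as a projective scheme -/

section Curve

attribute [local instance] MvPolynomial.gradedAlgebra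

variable (k : Type u) [Field k]

/-- The Weierstrass curve `y² + y = x³`. -/
def cubic : WeierstrassCurve k := ⟨0, 0, 1, 0, 0⟩

/-- Its homogeneous equation `Y²Z + YZ² - X³`, in the variables `X = X 0`, `Y = X 1`, `Z = X 2`. -/
def cubicForm : MvPolynomial (Fin 3) k := (cubic k).toProjective.polynomial

theorem cubicForm_eq : cubicForm k =
    MvPolynomial.X 1 ^ 2 * MvPolynomial.X 2 + MvPolynomial.X 1 * MvPolynomial.X 2 ^ 2
      - MvPolynomial.X 0 ^ 3 := by
  simp [cubicForm, cubic, WeierstrassCurve.Projective.polynomial]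

theorem cubicForm_mem : cubicForm k ∈ MvPolynomial.homogeneousSubmodule (Fin 3) k 3 := by
  rw [cubicForm_eq, MvPolynomial.mem_homogeneousSubmodule]
  have hX (i : Fin 3) := MvPolynomial.isHomogeneous_X k i
  exact ((((hX 1).pow 2).mul (hX 2)).add ((hX 1).mul ((hX 2).pow 2))).sub ((hX 0).pow 3)

/-- The homogeneous coordinate ring `k[X, Y, Z] / (Y²Z + YZ² - X³)`. -/
abbrev HomCoordRing : Type u := MvPolynomial (Fin 3) k ⧸ Ideal.span {cubicForm k}

/-- The grading of the homogeneous coordinate ring by degree. -/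
abbrev homGrading : ℕ → Submodule k (HomCoordRing k) :=
  quotGrading (MvPolynomial.homogeneousSubmodule (Fin 3) k) (cubicForm k)

instance homGrading_gradedAlgebra : GradedAlgebra (homGrading k) :=
  quotGradedAlgebra _ _ (cubicForm_mem k)

/-- The homogeneous coordinates `X`, `Y`, `Z` on the curve, for `i = 0, 1, 2`. -/
def homCoord (i : Fin 3) : HomCoordRing k :=
  Ideal.Quotient.mk (Ideal.span {cubicForm k}) (MvPolynomial.X i)

theorem homCoord_mem (i : Fin 3) : homCoord k i ∈ homGrading k 1 :=
  mk_mem_quotGrading _ _ (MvPolynomial.isHomogeneous_X k i)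

/-- The structure morphism `Proj k[X, Y, Z] / (Y²Z + YZ² - X³) ⟶ Spec k`. -/
def structE : Proj (homGrading k) ⟶ Spec (.of k) :=
  Proj.toSpecZero (homGrading k) ≫ Spec.map (CommRingCat.ofHom (algebraMap k (homGrading k 0)))

/-- The elliptic curve `E₃ : y² + y = x³` over `k`, as the `k`-scheme
`Proj k[X, Y, Z] / (Y²Z + YZ² - X³)`. -/
def curveE : Over (Spec (.of k)) := Over.mk (structE k)

/-- The affine chart `Z ≠ 0` of the curve. -/
def chartE : (curveE k).left.Opens := Proj.basicOpen (homGrading k) (homCoord k 2)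

/-- The affine coordinate function `X / Z` (for `i = 0`) or `Y / Z` (for `i = 1`) on the
chart `Z ≠ 0`. -/
def affCoord (i : Fin 3) : Γ((curveE k).left, chartE k) :=
  (Proj.awayToSection (homGrading k) (homCoord k 2)).hom
    (HomogeneousLocalization.Away.mk (homGrading k) (homCoord_mem k 2) 1 (homCoord k i)
      (homCoord_mem k i))

variable {k}

/-- The substitution `X ↦ ζX`, `Y ↦ Y`, `Z ↦ Z` on polynomials. -/
def scalePoly (ζ : k) : MvPolynomial (Fin 3) k →ₐ[k] MvPolynomial (Fin 3) k :=
  MvPolynomial.aeval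
    ![MvPolynomial.C ζ * MvPolynomial.X 0, MvPolynomial.X 1, MvPolynomial.X 2]

theorem scalePoly_cubicForm (ζ : k) (hζ : ζ ^ 3 = 1) :
    scalePoly ζ (cubicForm k) = cubicForm k := by
  simp only [cubicForm_eq, scalePoly, map_sub, map_add, map_mul, map_pow, MvPolynomial.aeval_X,
    Matrix.cons_val_zero, Matrix.cons_val_one, Matrix.cons_val, mul_pow]
  rw [← map_pow, hζ, map_one, one_mul]

/-- The substitution `X ↦ ζX`, `Y ↦ Y`, `Z ↦ Z` on the homogeneous coordinate ring, `ζ³ = 1`. -/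
def scaleRing (ζ : k) (hζ : ζ ^ 3 = 1) : HomCoordRing k →ₐ[k] HomCoordRing k :=
  Ideal.quotientMapₐ _ (scalePoly ζ) (by
    rw [Ideal.span_singleton_le_iff_mem, Ideal.mem_comap]
    change scalePoly ζ (cubicForm k) ∈ _
    rw [scalePoly_cubicForm ζ hζ]
    exact Ideal.mem_span_singleton_self _)

theorem scaleRing_mk (ζ : k) (hζ : ζ ^ 3 = 1) (p : MvPolynomial (Fin 3) k) :
    scaleRing ζ hζ (Ideal.Quotient.mk _ p) = Ideal.Quotient.mk _ (scalePoly ζ p) := rfl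

theorem scaleRing_comp (ζ ξ : k) (hζ : ζ ^ 3 = 1) (hξ : ξ ^ 3 = 1) (h : ζ * ξ = 1)
    (a : HomCoordRing k) : scaleRing ζ hζ (scaleRing ξ hξ a) = a := by
  obtain ⟨p, rfl⟩ := Ideal.Quotient.mk_surjective a
  rw [scaleRing_mk, scaleRing_mk]
  congr 1
  change ((scalePoly ζ).comp (scalePoly ξ)) p = AlgHom.id k _ p
  congr 1
  ext i : 1
  fin_cases i
  · simp only [scalePoly, AlgHom.comp_apply, MvPolynomial.aeval_X, Fin.zero_eta,
      Matrix.cons_val_zero, map_mul, MvPolynomial.aeval_C, AlgHom.id_apply]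
    rw [← mul_assoc, MvPolynomial.algebraMap_eq, ← map_mul, mul_comm ξ, h, map_one, one_mul]
  · simp [scalePoly]
  · simp [scalePoly]

/-- `scaleRing` as a homomorphism of graded rings. -/
def scaleGraded (ζ : k) (hζ : ζ ^ 3 = 1) : homGrading k →+*ᵍ homGrading k where
  toRingHom := (scaleRing ζ hζ).toRingHom
  map_mem := by
    rintro i _ ⟨p, hp, rfl⟩
    refine mk_mem_quotGrading _ _ (a := scalePoly ζ p) ?_
    have hX (i : Fin 3) := MvPolynomial.isHomogeneous_X k i
    have h : ∀ j, (![MvPolynomial.C ζ * MvPolynomial.X 0, MvPolynomial.X 1,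
        MvPolynomial.X 2] j : MvPolynomial (Fin 3) k).IsHomogeneous 1 := by
      rw [Fin.forall_fin_succ, Fin.forall_fin_two]
      exact ⟨(hX 0).C_mul ζ, hX 1, hX 2⟩
    have := MvPolynomial.IsHomogeneous.aeval hp _ h
    rw [one_mul] at this
    exact this

theorem scaleGraded_comp (ζ ξ : k) (hζ : ζ ^ 3 = 1) (hξ : ξ ^ 3 = 1) (h : ζ * ξ = 1) :
    (scaleGraded ζ hζ).comp (scaleGraded ξ hξ) = GradedRingHom.id (homGrading k) := by
  ext a
  exact scaleRing_comp ζ ξ hζ hξ h a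

theorem irrelevant_le_map_scaleGraded (ζ : k) (hζ : ζ ^ 3 = 1) :
    HomogeneousIdeal.irrelevant (homGrading k) ≤
      (HomogeneousIdeal.irrelevant (homGrading k)).map (scaleGraded ζ hζ) := by
  have hξ : (ζ ^ 2) ^ 3 = 1 := by rw [← pow_mul, mul_comm, pow_mul, hζ, one_pow]
  have h := scaleGraded_comp ζ (ζ ^ 2) hζ hξ (by rw [← pow_succ', hζ])
  have h1 : HomogeneousIdeal.irrelevant (homGrading k) =
      ((HomogeneousIdeal.irrelevant (homGrading k)).map (scaleGraded (ζ ^ 2) hξ)).map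
        (scaleGraded ζ hζ) := by
    rw [← HomogeneousIdeal.map_comp, h, HomogeneousIdeal.map_id]
  conv_lhs => rw [h1]
  apply HomogeneousIdeal.map_mono
  rw [HomogeneousIdeal.map_le_iff_le_comap, HomogeneousIdeal.irrelevant_le]
  intro i hi x hx
  exact HomogeneousIdeal.mem_irrelevant_of_mem _ hi ((scaleGraded (ζ ^ 2) hξ).map_mem hx)

/-- The morphism `[X : Y : Z] ↦ [ζX : Y : Z]` of the curve. -/
def scaleHom (ζ : k) (hζ : ζ ^ 3 = 1) : Proj (homGrading k) ⟶ Proj (homGrading k) :=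
  Proj.map (scaleGraded ζ hζ) (irrelevant_le_map_scaleGraded ζ hζ)

theorem scaleHom_comp (ζ ξ : k) (hζ : ζ ^ 3 = 1) (hξ : ξ ^ 3 = 1) (h : ζ * ξ = 1) :
    scaleHom ζ hζ ≫ scaleHom ξ hξ = 𝟙 _ := by
  rw [scaleHom, scaleHom, ← Proj.map_comp, ← Proj.map_id]
  congr 1
  exact scaleGraded_comp ζ ξ hζ hξ h

theorem awayι_scaleHom_structE (ζ : k) (hζ : ζ ^ 3 = 1) {i : ℕ} (hi : 0 < i) (a : HomCoordRing k)
    (ha : a ∈ homGrading k i) :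
    Proj.awayι (homGrading k) (scaleGraded ζ hζ a) ((scaleGraded ζ hζ).2 ha) hi ≫
      scaleHom ζ hζ ≫ structE k =
    Proj.awayι (homGrading k) (scaleGraded ζ hζ a) ((scaleGraded ζ hζ).2 ha) hi ≫ structE k := by
  rw [scaleHom, Proj.awayι_comp_map_assoc _ _ hi _ ha, structE, Proj.awayι_toSpecZero_assoc,
    Proj.awayι_toSpecZero_assoc, ← Spec.map_comp, ← Spec.map_comp, ← Spec.map_comp]
  congr 1
  ext c
  have h : HomogeneousLocalization.Away.map (scaleGraded ζ hζ) a
      (HomogeneousLocalization.fromZeroRingHom (homGrading k) (Submonoid.powers a)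
        (algebraMap k (homGrading k 0) c)) =
      HomogeneousLocalization.fromZeroRingHom (homGrading k)
        (Submonoid.powers (scaleGraded ζ hζ a)) (algebraMap k (homGrading k 0) c) := by
    rw [HomogeneousLocalization.Away.map]
    refine (HomogeneousLocalization.map_mk _ _ _).trans ?_
    apply HomogeneousLocalization.val_injective
    refine (HomogeneousLocalization.val_mk _).trans
      (Eq.trans ?_ (HomogeneousLocalization.val_mk _).symm)
    congr 1
    · exact (scaleRing ζ hζ).commutes c
    · exact Subtype.ext (map_one (scaleRing ζ hζ))
  exact congrArg HomogeneousLocalization.val h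

theorem scaleHom_over (ζ : k) (hζ : ζ ^ 3 = 1) : scaleHom ζ hζ ≫ structE k = structE k :=
  (Proj.mapAffineOpenCover (scaleGraded ζ hζ)
    (irrelevant_le_map_scaleGraded ζ hζ)).openCover.hom_ext _ _ fun s ↦
      awayι_scaleHom_structE ζ hζ s.1.2 s.2 s.2.2

/-- The automorphism `τ₃ : (x, y) ↦ (ζx, y)` of the curve over `k`, where `ζ³ = 1`. -/
def tau (ζ : k) (hζ : ζ ^ 3 = 1) : Aut (curveE k) :=
  Over.isoMk
    { hom := scaleHom ζ hζ
      inv := scaleHom (ζ ^ 2) (by rw [← pow_mul, mul_comm, pow_mul, hζ, one_pow])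
      hom_inv_id := scaleHom_comp _ _ _ _ (by rw [← pow_succ', hζ])
      inv_hom_id := scaleHom_comp _ _ _ _ (by rw [← pow_succ, hζ]) }
    (scaleHom_over ζ hζ)

end Curve

/-! ### The product `E₃ⁿ` and the groups acting on it -/

section Product

variable (k : Type u) [Field k]

/-- The `n`-fold product `E₃ × ⋯ × E₃` over `Spec k`. -/
def powE (n : ℕ) : Over (Spec (.of k)) := ∏ᶜ fun _ : Fin n => curveE k

/-- The projection of `E₃ⁿ` to its `i`-th factor. -/
def projE (n : ℕ) (i : Fin n) : powE k n ⟶ curveE k := Pi.π (fun _ : Fin n => curveE k) i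

variable {k}

/-- The automorphism `(σ₁, …, σₙ)` of `E₃ⁿ`. -/
def powAut {n : ℕ} (σ : Fin n → Aut (curveE k)) : Aut (powE k n) :=
  Pi.mapIso (f := fun _ : Fin n => curveE k) (g := fun _ : Fin n => curveE k) σ

/-- The group `Gᵢ = ⟨(τ, 1, …, 1, τⁱ), (1, τ, 1, …, 1, τⁱ), …, (1, …, 1, τ, τⁱ)⟩` of automorphisms
of `E₃ⁿ`, where `n = m + 1` and there are `m` generators. -/
def groupG (ζ : k) (hζ : ζ ^ 3 = 1) (m i : ℕ) : Subgroup (Aut (powE k (m + 1))) :=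
  Subgroup.closure (Set.range fun j : Fin m =>
    powAut (Fin.snoc (α := fun _ => Aut (curveE k)) (Pi.mulSingle j (tau ζ hζ)) (tau ζ hζ ^ i)))

end Product

/-! ### Quotients by groups of automorphisms -/

/-- `π : X ⟶ Y` is the quotient of the `S`-scheme `X` by a group `G` of `S`-automorphisms: `π` is
`G`-invariant, the underlying space of `Y` is the orbit space of `X` with the quotient topology,
and the structure sheaf of `Y` is the sheaf of `G`-invariants `(π_* 𝒪_X)ᴳ`. -/
structure IsQuotient {S : Scheme.{u}} {X Y : Over S} (G : Subgroup (Aut X)) (π : X ⟶ Y) :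
    Prop where
  invariant : ∀ g ∈ G, g.hom ≫ π = π
  isQuotientMap : Topology.IsQuotientMap π.left
  orbit : ∀ x x' : X.left, π.left x = π.left x' → ∃ g ∈ G, g.hom.left x = x'
  injective : ∀ U : Y.left.Opens, Function.Injective (π.left.app U)
  mem_range : ∀ (U : Y.left.Opens) (s : Γ(X.left, π.left ⁻¹ᵁ U)),
    (∀ g ∈ G, ∀ h : π.left ⁻¹ᵁ U ≤ g.hom.left ⁻¹ᵁ π.left ⁻¹ᵁ U,
      g.hom.left.appLE (π.left ⁻¹ᵁ U) (π.left ⁻¹ᵁ U) h s = s) →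
    s ∈ Set.range (π.left.app U)

/-! ### Rational functions on `E₃ⁿ` -/

section RationalFunctions

variable {k : Type u} [Field k]

/-- The homomorphism from `k` to the stalk of a `k`-scheme at a point. -/
def constants (X : Over (Spec (.of k))) (x : X.left) : k →+* X.left.presheaf.stalk x :=
  ((Scheme.ΓSpecIso (.of k)).inv ≫ Scheme.Hom.appTop (Y := Spec (.of k)) X.hom ≫
    X.left.presheaf.germ ⊤ x trivial).hom

/-- The rational function `xᵢ` (for `j = 0`) or `yᵢ` (for `j = 1`) on `E₃ⁿ`: the pullback along the
`i`-th projection of the affine coordinate function on the chart `Z ≠ 0` of the curve. -/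
def ratCoord {n : ℕ} [IrreducibleSpace (powE k n).left] (i : Fin n) (j : Fin 3)
    (h : genericPoint (powE k n).left ∈ (projE k n i).left ⁻¹ᵁ chartE k) :
    (powE k n).left.functionField :=
  (powE k n).left.presheaf.germ ((projE k n i).left ⁻¹ᵁ chartE k) _ h
    ((projE k n i).left.app (chartE k) (affCoord k j))

/-- For `n = m + 2` and elements `x₁, …, xₙ, y₁, …, yₙ` of a field, the family consisting of
`y₁, …, yₙ₋₂`, `z = x₁ ⋯ xₙ₋₁ / xₙ` and `α = yₙ / yₙ₋₁`. -/
def generators {K : Type*} [Field K] {m : ℕ} (x y : Fin (m + 2) → K) : Fin m ⊕ Fin 2 → K :=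
  Sum.elim (fun i => y i.castSucc.castSucc)
    ![(∏ i : Fin (m + 1), x i.castSucc) / x (Fin.last (m + 1)),
      y (Fin.last (m + 1)) / y (Fin.last m).castSucc]

/-- The subring `L` of `K` is the subfield `k(g)` generated over `k` (embedded in `K` through `φ`)
by the family `g`, and `g` is algebraically independent over `k`. -/
def IsPurelyTranscendentalOn {K : Type*} [Field K] (φ : k →+* K) (L : Subring K) {ι : Type*}
    (g : ι → K) : Prop :=
  letI := φ.toAlgebra
  AlgebraicIndependent k g ∧ (L : Set K) = (IntermediateField.adjoin k (Set.range g) : Set K)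

end RationalFunctions

end CubicQuotient

end

open CubicQuotient

noncomputable section

namespace CubicQuotient

/-! ### Stable open subsets and invariant sections -/

section Stable

variable {S : Scheme.{u}} {X : Over S} (G : Subgroup (Aut X))

/-! The function field statement is elementary once everything is placed inside the function field
`K` of the product. On the chart where all `Zᵢ` are nonzero the ring is generated by `xᵢ, yᵢ` with
`xᵢ³ = yᵢ² + yᵢ`. The `j`-th generator of `G₁` multiplies `xⱼ` and `xₙ` by `ζ` and fixes the other
coordinates. As `|G₁|` is a power of 3 and 3 is invertible in `k`, averaging shows that the
invariants are spanned by the invariant monomials (`map_mem_of_forall_smul_eq`), those for which 3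
divides `dⱼ + dₙ` for every `j < n`, where `dᵢ` is the exponent of `xᵢ`. The `x`-part of such a
monomial is a product of powers of the `xⱼ³ = yⱼ² + yⱼ` divided by a power of `z` (`monomial_mem`),
so `z` and the `yᵢ` generate all invariant fractions.

The last two `y`'s are redundant given `α`. Cubing `z` gives `z³ (yₙ² + yₙ) = P (yₙ₋₁² + yₙ₋₁)` with
`P` a polynomial in `y₁, …, yₙ₋₂`; substituting `yₙ = α yₙ₋₁` and cancelling `yₙ₋₁` leaves a linear
equation for `yₙ₋₁` (`y_mem`). Hence `K` is algebraic over the field generated by the `n` given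
elements, while the `yᵢ` show that its transcendence degree is at least `n`; so these elements are
independent (`generators_algebraicIndependent`).

On the side of schemes, each product of charts `Y ≠ 0` or `Z ≠ 0` is affine and stable. Over a
stable affine open subset the quotient is the spectrum of the invariants, because a finite group
permutes transitively the primes above a given one. Invariants commute with localization at an
invariant (`isLocalization_invSections`), so these spectra glue (`exists_isQuotient`). For an
arbitrary quotient, the function field consists of the fractions of invariants over any nonempty
stable affine open subset (`IsQuotient.mem_range_stalkMap_iff`). Affine charts of the quotient are
of finite type by Artin–Tate, and two domains of finite type with the same fractions share a
localization, which gives birationality (`birationalOver_Spec`).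

Integrality of the product comes from building its charts one factor at a time: `R ↦ R[u, v] / (u³ -
v² - v)` preserves domains by Eisenstein (`cubicRing_isDomain`), and all charts have a common point
(`irreducibleSpace_powE`). -/

/-- An open subset is stable under `G` if every element of `G` maps it to itself. -/
def IsStable (U : X.left.Opens) : Prop := ∀ g ∈ G, U ≤ g.hom.left ⁻¹ᵁ U

/-- The subring of sections over `U` fixed by every element of `G`. -/
def invSections (U : X.left.Opens) : Subring Γ(X.left, U) where
  carrier := {s | ∀ g ∈ G, ∀ h : U ≤ g.hom.left ⁻¹ᵁ U, g.hom.left.appLE U U h s = s}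
  mul_mem' ha hb g hg h := by rw [map_mul, ha g hg h, hb g hg h]
  one_mem' g hg h := map_one _
  add_mem' ha hb g hg h := by rw [map_add, ha g hg h, hb g hg h]
  zero_mem' g hg h := map_zero _
  neg_mem' ha g hg h := by rw [map_neg, ha g hg h]

variable {G}

/-- The action of `G` on the sections over a stable open subset. -/
@[reducible]
def IsStable.action {U : X.left.Opens} (hU : IsStable G U) :
    MulSemiringAction G Γ(X.left, U) where
  -- Pullback is contravariant, so the inverse is needed to get a left action.
  smul g s := (g⁻¹).1.hom.left.appLE U U (hU _ (g⁻¹).2) s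
  one_smul s := by
    change ((1 : G)⁻¹).1.hom.left.appLE U U _ s = s
    have : ∀ (f : X.left ⟶ X.left) (_ : f = 𝟙 _) (h : U ≤ f ⁻¹ᵁ U), f.appLE U U h s = s := by
      rintro _ rfl h
      exact congrArg (fun f ↦ f.hom s) (X.left.presheaf.map_id _)
    exact this _ (by simp only [inv_one]; rfl) _
  mul_smul g h s := by
    change ((g * h)⁻¹).1.hom.left.appLE U U _ s =
      (g⁻¹).1.hom.left.appLE U U _ ((h⁻¹).1.hom.left.appLE U U _ s)
    rw [← CommRingCat.comp_apply, Scheme.Hom.appLE_comp_appLE]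
    rfl
  smul_zero g := map_zero _
  smul_add g := map_add _
  smul_one g := map_one _
  smul_mul g := map_mul _

theorem IsStable.smul_def {U : X.left.Opens} (hU : IsStable G U) (g : G) (s : Γ(X.left, U)) :
    letI := hU.action
    g⁻¹ • s = g.1.hom.left.appLE U U (hU _ g.2) s := by
  change ((g⁻¹)⁻¹).1.hom.left.appLE U U _ s = _
  simp only [inv_inv]

theorem IsStable.mem_invSections_iff {U : X.left.Opens} (hU : IsStable G U) {s : Γ(X.left, U)} :
    letI := hU.action
    s ∈ invSections G U ↔ ∀ g : G, g • s = s := by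
  let := hU.action
  refine ⟨fun h g ↦ ?_, fun h g hg hg' ↦ ?_⟩
  · rw [← inv_inv g, hU.smul_def]
    exact h _ (g⁻¹).2 _
  · rw [← hU.smul_def ⟨g, hg⟩]
    exact h _

theorem IsStable.isInvariant {U : X.left.Opens} (hU : IsStable G U) :
    letI := hU.action
    Algebra.IsInvariant (invSections G U) Γ(X.left, U) G :=
  letI := hU.action
  ⟨fun b hb ↦ ⟨⟨b, hU.mem_invSections_iff.mpr hb⟩, rfl⟩⟩

theorem IsStable.smulCommClass {U : X.left.Opens} (hU : IsStable G U) :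
    letI := hU.action
    SMulCommClass G (invSections G U) Γ(X.left, U) :=
  letI := hU.action
  ⟨fun g s t ↦ by
    change g • (s.1 * t) = s.1 * g • t
    rw [smul_mul', hU.mem_invSections_iff.mp s.2]⟩

/-- A section `s` is a root of the monic polynomial `∏ (T - g • s)`, whose coefficients are
invariant. -/
theorem IsStable.isIntegral [Finite G] {U : X.left.Opens} (hU : IsStable G U) :
    Algebra.IsIntegral (invSections G U) Γ(X.left, U) :=
  letI := hU.action
  haveI := hU.isInvariant
  Algebra.IsInvariant.isIntegral _ _ G

theorem IsStable.apply_mem_iff {U : X.left.Opens} (hU : IsStable G U) {g : Aut X} (hg : g ∈ G)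
    (x : X.left) : g.hom.left x ∈ U ↔ x ∈ U := by
  refine ⟨fun h ↦ ?_, fun h ↦ hU g hg h⟩
  have h1 := hU _ (inv_mem hg) h
  change (g⁻¹).hom.left (g.hom.left x) ∈ U at h1
  have h2 : g.hom.left ≫ (g⁻¹).hom.left = 𝟙 _ := by
    rw [← Over.comp_left]
    exact congrArg CommaMorphism.left g.hom_inv_id
  rwa [← Scheme.Hom.comp_apply, h2] at h1

/-- Invariant sections restrict to invariant sections. -/
theorem map_mem_invSections {U V : X.left.Opens} (hV : IsStable G V)
    (i : U ≤ V) {s : Γ(X.left, V)} (hs : s ∈ invSections G V) :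
    X.left.presheaf.map (homOfLE i).op s ∈ invSections G U := by
  intro g hg h
  have := congrArg (X.left.presheaf.map (homOfLE i).op) (hs g hg (hV g hg))
  rw [← CommRingCat.comp_apply, Scheme.Hom.appLE_map] at this
  rw [← CommRingCat.comp_apply, Scheme.Hom.map_appLE, this]

/-- Restriction of invariant sections. -/
def resInv {U V : X.left.Opens} (hV : IsStable G V) (i : U ≤ V) :
    invSections G V →+* invSections G U :=
  (X.left.presheaf.map (homOfLE i).op).hom.restrict _ _ fun _ hs ↦ map_mem_invSections hV i hs

theorem isStable_basicOpen {V : X.left.Opens} (hV : IsStable G V) {s : Γ(X.left, V)}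
    (hs : s ∈ invSections G V) : IsStable G (X.left.basicOpen s) := by
  intro g hg
  conv_lhs => rw [← hs g hg (hV g hg)]
  rw [Scheme.Hom.appLE, CommRingCat.comp_apply, Scheme.basicOpen_res, Scheme.preimage_basicOpen]
  exact inf_le_right

theorem apply_mem_basicOpen_iff {V : X.left.Opens} {g : Aut X}
    (h : V ≤ g.hom.left ⁻¹ᵁ V) {x : X.left} (hx : x ∈ V) (s : Γ(X.left, V)) :
    x ∈ X.left.basicOpen (g.hom.left.appLE V V h s) ↔ g.hom.left x ∈ X.left.basicOpen s := by
  rw [Scheme.Hom.appLE, CommRingCat.comp_apply, Scheme.basicOpen_res, ← Scheme.preimage_basicOpen]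
  exact ⟨fun h ↦ h.2, fun h ↦ ⟨hx, h⟩⟩

/-- The morphism from a stable open subset to the spectrum of its ring of invariant sections. -/
def toInv (G : Subgroup (Aut X)) (U : X.left.Opens) :
    U.toScheme ⟶ Spec (.of (invSections G U)) :=
  U.toSpecΓ ≫ Spec.map (CommRingCat.ofHom (invSections G U).subtype)

theorem toInv_mem_basicOpen (U : X.left.Opens) (x : U) (s : invSections G U) :
    toInv G U x ∈ PrimeSpectrum.basicOpen s ↔ x.1 ∈ X.left.basicOpen s.1 := by
  have := Scheme.Opens.toSpecΓ_preimage_basicOpen U s.1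
  have h2 : U.toSpecΓ x ∈ PrimeSpectrum.basicOpen s.1 ↔ x.1 ∈ X.left.basicOpen s.1 := by
    have h3 : x ∈ U.toSpecΓ ⁻¹ᵁ PrimeSpectrum.basicOpen s.1 ↔
      x ∈ U.ι ⁻¹ᵁ X.left.basicOpen s.1 := by rw [this]
    exact h3
  rw [← h2]
  rfl

/-- An integral ring extension induces a closed map on spectra. -/
theorem isClosedMap_toInv [Finite G] {U : X.left.Opens} (hU : IsStable G U)
    (hU' : IsAffineOpen U) : IsClosedMap (toInv G U) := by
  have := hU.isIntegral
  have h : toInv G U = hU'.isoSpec.hom ≫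
    Spec.map (CommRingCat.ofHom (invSections G U).subtype) := rfl
  rw [h]
  have h1 : IsClosedMap (Spec.map (CommRingCat.ofHom (invSections G U).subtype)) :=
    PrimeSpectrum.isClosedMap_comap_of_isIntegral _
      (algebraMap_isIntegral_iff.mpr hU.isIntegral)
  exact h1.comp hU'.isoSpec.hom.homeomorph.isClosedMap

/-- Lying over for the integral extension of the invariants by all sections. -/
theorem surjective_toInv [Finite G] {U : X.left.Opens} (hU : IsStable G U)
    (hU' : IsAffineOpen U) : Function.Surjective (toInv G U) := by
  have := hU.isIntegral
  have h : toInv G U = hU'.isoSpec.hom ≫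
    Spec.map (CommRingCat.ofHom (invSections G U).subtype) := rfl
  rw [h]
  have h1 : Function.Surjective (Spec.map (CommRingCat.ofHom (invSections G U).subtype)) := by
    have := hU.isIntegral
    exact Algebra.IsIntegral.comap_surjective (invSections G U) Γ(X.left, U)
  exact h1.comp hU'.isoSpec.hom.homeomorph.surjective

theorem isQuotientMap_toInv [Finite G] {U : X.left.Opens} (hU : IsStable G U)
    (hUa : IsAffineOpen U) : Topology.IsQuotientMap (toInv G U) :=
  (isClosedMap_toInv hU hUa).isQuotientMap (toInv G U).continuous (surjective_toInv hU hUa)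

/-- Points of an affine open subset are separated by the basic open sets. -/
theorem eq_of_forall_mem_basicOpen {Z : Scheme.{u}} {U : Z.Opens} (hU : IsAffineOpen U) {x y : Z}
    (hx : x ∈ U) (hy : y ∈ U) (h : ∀ s : Γ(Z, U), x ∈ Z.basicOpen s ↔ y ∈ Z.basicOpen s) :
    x = y := by
  apply Inseparable.eq
  rw [inseparable_iff_forall_isOpen]
  intro W hW
  constructor
  · intro hxW
    obtain ⟨f, hf, hxf⟩ := hU.exists_basicOpen_le ⟨x, (show x ∈ (⟨W, hW⟩ : Z.Opens) from hxW)⟩ hx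
    exact hf ((h f).mp hxf)
  · intro hyW
    obtain ⟨f, hf, hxf⟩ := hU.exists_basicOpen_le ⟨y, (show y ∈ (⟨W, hW⟩ : Z.Opens) from hyW)⟩ hy
    exact hf ((h f).mpr hxf)

/-- A finite group acts transitively on the primes over a given prime of the ring of invariants.
Equality of points of `X` is then recovered from the basic open sets containing them. -/
theorem exists_apply_eq_of_toInv_eq [Finite G] {U : X.left.Opens} (hU : IsStable G U)
    (hU' : IsAffineOpen U) {x y : U} (h : toInv G U x = toInv G U y) :
    ∃ g ∈ G, g.hom.left x.1 = y.1 := by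
  let := hU.action
  have := hU.isInvariant
  have := hU.smulCommClass
  let P : PrimeSpectrum Γ(X.left, U) := U.toSpecΓ x
  let Q : PrimeSpectrum Γ(X.left, U) := U.toSpecΓ y
  obtain ⟨g, hg⟩ := Algebra.IsInvariant.exists_smul_of_under_eq (invSections G U) Γ(X.left, U) G
    P.asIdeal Q.asIdeal (congrArg PrimeSpectrum.asIdeal h)
  have hmem (z : U) (s : Γ(X.left, U)) :
      s ∈ (U.toSpecΓ z : PrimeSpectrum Γ(X.left, U)).asIdeal ↔ z.1 ∉ X.left.basicOpen s := by
    have h3 : z ∈ U.toSpecΓ ⁻¹ᵁ PrimeSpectrum.basicOpen s ↔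
      z ∈ U.ι ⁻¹ᵁ X.left.basicOpen s := by rw [Scheme.Opens.toSpecΓ_preimage_basicOpen U s]
    rw [← not_iff_not, not_not]
    exact h3
  refine ⟨g.1, g.2, eq_of_forall_mem_basicOpen hU' (hU _ g.2 x.2) y.2 fun s ↦ ?_⟩
  rw [← apply_mem_basicOpen_iff (hU _ g.2) x.2, ← not_iff_not, ← hmem, ← hmem, ← hU.smul_def]
  have : s ∈ Q.asIdeal ↔ g⁻¹ • s ∈ P.asIdeal := by
    rw [hg]
    exact Ideal.mem_pointwise_smul_iff_inv_smul_mem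
  exact this.symm

/-- A stable neighbourhood inside a stable affine open subset contains a neighbourhood on which an
invariant section does not vanish. -/
theorem exists_inv_basicOpen_le [Finite G] {U W : X.left.Opens} (hU : IsStable G U)
    (hU' : IsAffineOpen U) (hW : IsStable G W) {x : X.left} (hxU : x ∈ U) (hxW : x ∈ W) :
    ∃ s ∈ invSections G U, x ∈ X.left.basicOpen s ∧ X.left.basicOpen s ≤ W := by
  -- The image of the complement of `W` is closed. It misses the image of `x`, because fibres are
  -- orbits and `W` is stable; a basic open set of the spectrum separates the two.
  let C : Set U := {y | y.1 ∉ W}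
  have hC : IsClosed C := ⟨by
    have : Cᶜ = U.ι ⁻¹ᵁ W := by
      ext y
      exact not_not
    rw [this]
    exact (U.ι ⁻¹ᵁ W).2⟩
  have hC' := isClosedMap_toInv hU hU' C hC
  have hx : toInv G U ⟨x, hxU⟩ ∈ (toInv G U '' C)ᶜ := by
    rintro ⟨y, hy, hyx⟩
    obtain ⟨g, hg, h⟩ := exists_apply_eq_of_toInv_eq hU hU' hyx
    exact hy ((hW.apply_mem_iff hg _).mp (by rw [h]; exact hxW))
  obtain ⟨_, ⟨_, ⟨s, rfl⟩, rfl⟩, hs, hs'⟩ :=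
    PrimeSpectrum.isBasis_basic_opens.exists_subset_of_mem_open hx hC'.isOpen_compl
  refine ⟨s.1, s.2, (toInv_mem_basicOpen U ⟨x, hxU⟩ s).mp hs, fun y hy ↦ ?_⟩
  by_contra hyW
  have hyU := X.left.basicOpen_le _ hy
  exact hs' ((toInv_mem_basicOpen U ⟨y, hyU⟩ s).mpr hy) ⟨⟨y, hyU⟩, hyW, rfl⟩

/-- Taking invariants commutes with inverting an invariant: an invariant fraction `a / sⁿ` has an
invariant numerator after multiplication by a further power of `s`. This is what makes the local
quotients glue. -/
theorem isLocalization_invSections [Finite G] {U V : X.left.Opens} (hV : IsStable G V)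
    (hV' : IsAffineOpen V) (s : invSections G V) (i : U ≤ V) (e : U = X.left.basicOpen s.1) :
    @IsLocalization.Away _ _ s (invSections G U) _ (resInv hV i).toAlgebra := by
  have hU : IsStable G U := e ▸ isStable_basicOpen hV s.2
  let : Algebra Γ(X.left, V) Γ(X.left, U) := (X.left.presheaf.map (homOfLE i).op).hom.toAlgebra
  have hloc : IsLocalization.Away s.1 Γ(X.left, U) :=
    hV'.isLocalization_of_eq_basicOpen s.1 (homOfLE i) e
  let := (resInv hV i).toAlgebra
  have hcomp (g : G) (a : Γ(X.left, V)) :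
      g.1.hom.left.appLE U U (hU _ g.2) (algebraMap Γ(X.left, V) Γ(X.left, U) a) =
        algebraMap Γ(X.left, V) Γ(X.left, U) (g.1.hom.left.appLE V V (hV _ g.2) a) := by
    change (X.left.presheaf.map (homOfLE i).op ≫ g.1.hom.left.appLE U U (hU _ g.2)) a =
      (g.1.hom.left.appLE V V (hV _ g.2) ≫ X.left.presheaf.map (homOfLE i).op) a
    rw [Scheme.Hom.appLE_map, Scheme.Hom.map_appLE]
  refine ⟨?_, ?_, ?_⟩
  · rintro ⟨_, n, rfl⟩
    obtain ⟨t, ht⟩ := isUnit_iff_exists_inv.mp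
      (IsLocalization.map_units Γ(X.left, U) (⟨s.1 ^ n, n, rfl⟩ : Submonoid.powers s.1))
    have ht' : t ∈ invSections G U := by
      intro g hg h
      have h1 := congrArg (g.hom.left.appLE U U h) ht
      rw [map_mul, map_one, hcomp ⟨g, hg⟩, map_pow, s.2 g hg] at h1
      exact left_inv_eq_right_inv ((mul_comm _ _).trans h1) ht
    exact isUnit_iff_exists_inv.mpr ⟨⟨t, ht'⟩, Subtype.ext ht⟩
  · intro t
    obtain ⟨⟨a, _, n, rfl⟩, ha⟩ := IsLocalization.surj (Submonoid.powers s.1) t.1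
    dsimp only at ha
    have h1 (g : G) : ∃ m : ℕ,
        s.1 ^ m * g.1.hom.left.appLE V V (hV _ g.2) a = s.1 ^ m * a := by
      have h2 : algebraMap Γ(X.left, V) Γ(X.left, U) (g.1.hom.left.appLE V V (hV _ g.2) a) =
          algebraMap Γ(X.left, V) Γ(X.left, U) a := by
        rw [← hcomp, ← ha, map_mul, t.2 _ g.2, hcomp, map_pow, s.2 _ g.2]
      obtain ⟨⟨_, m, rfl⟩, hm⟩ := IsLocalization.exists_of_eq (M := Submonoid.powers s.1) h2
      exact ⟨m, hm⟩
    choose m hm using h1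
    cases nonempty_fintype G
    -- A single exponent that works for all of the finite group: `s ^ N` kills every difference `g a
    -- - a`.
    let N := ∑ g, m g
    have hN (g : G) : s.1 ^ N * g.1.hom.left.appLE V V (hV _ g.2) a = s.1 ^ N * a := by
      obtain ⟨c, hc⟩ := Nat.exists_eq_add_of_le
        (Finset.single_le_sum (fun g _ ↦ Nat.zero_le (m g)) (Finset.mem_univ g))
      change N = _ at hc
      rw [hc, pow_add, mul_right_comm, hm, mul_right_comm]
    have hinv : s.1 ^ N * a ∈ invSections G V := by
      intro g hg h
      rw [map_mul, map_pow, s.2 g hg]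
      exact hN ⟨g, hg⟩
    refine ⟨⟨⟨_, hinv⟩, s ^ (N + n), N + n, rfl⟩, Subtype.ext ?_⟩
    change t.1 * algebraMap Γ(X.left, V) Γ(X.left, U) (s.1 ^ (N + n)) =
      algebraMap Γ(X.left, V) Γ(X.left, U) (s.1 ^ N * a)
    rw [pow_add, map_mul, map_mul, ← ha]
    ring
  · intro a b h
    have h1 : algebraMap Γ(X.left, V) Γ(X.left, U) a.1 =
      algebraMap Γ(X.left, V) Γ(X.left, U) b.1 := congrArg Subtype.val h
    obtain ⟨⟨_, m, rfl⟩, hm⟩ := IsLocalization.exists_of_eq (M := Submonoid.powers s.1) h1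
    exact ⟨⟨_, m, rfl⟩, Subtype.ext hm⟩

end Stable

end CubicQuotient

end

noncomputable section

namespace CubicQuotient

/-! ### Existence of the quotient by a finite group -/

section StableAffine

variable {S : Scheme.{u}} {X : Over S} {G : Subgroup (Aut X)}

theorem toInv_naturality {U V : X.left.Opens} (hV : IsStable G V) (i : U ≤ V) :
    toInv G U ≫ Spec.map (CommRingCat.ofHom (resInv hV i)) = X.left.homOfLE i ≫ toInv G V := by
  have := Scheme.Opens.toSpecΓ_SpecMap_presheaf_map U V i
  rw [toInv, toInv, Category.assoc, ← Spec.map_comp, ← reassoc_of% this, ← Spec.map_comp]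
  rfl

theorem toInv_naturality_apply {U V : X.left.Opens} (hV : IsStable G V) (i : U ≤ V) {x : X.left}
    (hx : x ∈ U) : Spec.map (CommRingCat.ofHom (resInv hV i)) (toInv G U ⟨x, hx⟩) =
      toInv G V ⟨x, i hx⟩ := by
  refine (Scheme.Hom.comp_apply (toInv G U) _ _).symm.trans ?_
  rw [toInv_naturality]
  refine (Scheme.Hom.comp_apply (X.left.homOfLE i) _ _).trans ?_
  rw [Scheme.homOfLE_apply']

theorem toInv_apply {U : X.left.Opens} (hU : IsStable G U) {g : Aut X} (hg : g ∈ G)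
    {x : X.left} (hx : x ∈ U) : toInv G U ⟨g.hom.left x, hU g hg hx⟩ = toInv G U ⟨x, hx⟩ := by
  apply PrimeSpectrum.ext
  ext s
  have h (z : U) : s ∈ (toInv G U z : PrimeSpectrum (invSections G U)).asIdeal ↔
      z.1 ∉ X.left.basicOpen s.1 := by
    rw [← not_iff_not, not_not]
    exact toInv_mem_basicOpen U z s
  refine (h _).trans (Iff.trans ?_ (h _).symm)
  rw [← apply_mem_basicOpen_iff (hU g hg) hx, s.2 g hg]

variable (G)

/-- The stable affine open subsets. -/
structure StableAffine where
  /-- The underlying open subset. -/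
  opens : X.left.Opens
  isStable : IsStable G opens
  isAffineOpen : IsAffineOpen opens

variable {G}

namespace StableAffine

/-- The locus in a stable affine open subset where an invariant section does not vanish. -/
def basicOpen (V : StableAffine G) {s : Γ(X.left, V.opens)} (hs : s ∈ invSections G V.opens) :
    StableAffine G :=
  ⟨X.left.basicOpen s, isStable_basicOpen V.isStable hs, V.isAffineOpen.basicOpen s⟩

/-- Stable affine open subsets are ordered by the relation of being a basic open subset defined by
an invariant section. -/
instance [Finite G] : Preorder (StableAffine G) where
  le U V := ∃ s ∈ invSections G V.opens, U.opens = X.left.basicOpen s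
  le_refl U := ⟨1, one_mem _, by simp⟩
  le_trans U V W := by
    rintro ⟨s, hs, hU⟩ ⟨t, ht, hV⟩
    have i : V.opens ≤ W.opens := hV ▸ X.left.basicOpen_le t
    let := (resInv W.isStable i).toAlgebra
    have := isLocalization_invSections W.isStable W.isAffineOpen ⟨t, ht⟩ i hV
    -- With `V = D(t)` in `W` and `U = D(s)` in `V`, write `s tⁿ` as the restriction of an invariant
    -- `a` on `W`; then `U = D(t a)`.
    obtain ⟨n, a, ha⟩ := IsLocalization.Away.surj (⟨t, ht⟩ : invSections G W.opens)
      (⟨s, hs⟩ : invSections G V.opens)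
    refine ⟨t * a.1, mul_mem ht a.2, ?_⟩
    have h1 := congrArg (fun b ↦ X.left.basicOpen (Subtype.val b)) ha
    have h2 : X.left.basicOpen ((X.left.presheaf.map (homOfLE i).op) t) = V.opens := by
      rw [Scheme.basicOpen_res, ← hV, inf_idem]
    have h3 : X.left.basicOpen (s * (X.left.presheaf.map (homOfLE i).op t) ^ n) =
        X.left.basicOpen (X.left.presheaf.map (homOfLE i).op a.1) := h1
    rw [Scheme.basicOpen_mul, Scheme.basicOpen_res] at h3
    have h4 : X.left.basicOpen s ≤
        X.left.basicOpen ((X.left.presheaf.map (homOfLE i).op t) ^ n) := by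
      rcases Nat.eq_zero_or_pos n with rfl | hn
      · rw [pow_zero, Scheme.basicOpen_one]
        exact X.left.basicOpen_le _
      · rw [Scheme.basicOpen_pow _ _ hn, h2]
        exact X.left.basicOpen_le _
    rw [inf_eq_left.mpr h4] at h3
    rw [hU, h3, Scheme.basicOpen_mul, ← hV]

theorem opens_le [Finite G] {U V : StableAffine G} (h : U ≤ V) : U.opens ≤ V.opens := by
  obtain ⟨s, -, hs⟩ := h
  exact hs ▸ X.left.basicOpen_le s

theorem basicOpen_le [Finite G] (V : StableAffine G) {s : Γ(X.left, V.opens)}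
    (hs : s ∈ invSections G V.opens) : V.basicOpen hs ≤ V := ⟨s, hs, rfl⟩

/-- Inside a stable affine open subset, basic open subsets defined by invariant sections
intersect in such a subset. -/
theorem exists_le_inf [Finite G] {U V W : StableAffine G} (hU : U ≤ W) (hV : V ≤ W) :
    ∃ L : StableAffine G, L ≤ U ∧ L ≤ V ∧ L.opens = U.opens ⊓ V.opens := by
  obtain ⟨s, hs, hs'⟩ := id hU
  obtain ⟨t, ht, ht'⟩ := id hV
  refine ⟨W.basicOpen (mul_mem hs ht), ⟨_, map_mem_invSections W.isStable (opens_le hU) ht, ?_⟩,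
    ⟨_, map_mem_invSections W.isStable (opens_le hV) hs, ?_⟩, ?_⟩
  · rw [Scheme.basicOpen_res, hs']
    exact Scheme.basicOpen_mul _ _ _
  · rw [Scheme.basicOpen_res, ht', inf_comm]
    exact Scheme.basicOpen_mul _ _ _
  · rw [hs', ht']
    exact Scheme.basicOpen_mul _ _ _

/-- Two stable affine neighbourhoods of a point contain a common basic open neighbourhood. -/
theorem exists_mem_le [Finite G] (U : StableAffine G) {W : X.left.Opens} (hW : IsStable G W)
    {x : X.left} (hxU : x ∈ U.opens) (hxW : x ∈ W) :
    ∃ L : StableAffine G, L ≤ U ∧ x ∈ L.opens ∧ L.opens ≤ W := by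
  obtain ⟨s, hs, hx, h⟩ := exists_inv_basicOpen_le U.isStable U.isAffineOpen hW hxU hxW
  exact ⟨U.basicOpen hs, U.basicOpen_le hs, hx, h⟩

/-- The order is finer than inclusion, so shrinking happens twice: `L` is principal in `U` and
contained in `V`, then `M` is principal in `V` and contained in `L`. The invariant cutting `M` out
of `V` also cuts it out of `L`, hence `M` is principal in `U` too. -/
theorem exists_mem_le_le [Finite G] (U V : StableAffine G) {x : X.left} (hxU : x ∈ U.opens)
    (hxV : x ∈ V.opens) : ∃ L : StableAffine G, L ≤ U ∧ L ≤ V ∧ x ∈ L.opens := by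
  obtain ⟨L, hLU, hxL, hLV⟩ := U.exists_mem_le V.isStable hxU hxV
  obtain ⟨M, hMV, hxM, hML⟩ := V.exists_mem_le L.isStable hxV hxL
  refine ⟨M, le_trans ?_ hLU, hMV, hxM⟩
  obtain ⟨s, hs, hM⟩ := hMV
  refine ⟨_, map_mem_invSections V.isStable hLV hs, ?_⟩
  rw [Scheme.basicOpen_res, ← hM, right_eq_inf]
  exact hML

variable (G) in
/-- The spectra of the rings of invariant sections on stable affine open subsets. -/
def specInv [Finite G] : StableAffine G ⥤ Scheme.{u} where
  obj U := Spec (.of (invSections G U.opens))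
  map {U V} i := Spec.map (CommRingCat.ofHom (resInv V.isStable (opens_le i.le)))
  map_id U := by
    rw [← Spec.map_id]
    congr 1
    ext s
    exact congrArg (fun f ↦ f.hom s.1) (X.left.presheaf.map_id _)
  map_comp {U V W} i j := by
    rw [← Spec.map_comp]
    congr 1
    ext s
    exact congrArg (fun f ↦ f.hom s.1) (X.left.presheaf.map_comp
      (homOfLE (opens_le j.le)).op (homOfLE (opens_le i.le)).op)

/-- The transition maps are localizations at one element, by `isLocalization_invSections`. -/
instance [Finite G] {U V : StableAffine G} (i : U ⟶ V) :
    IsOpenImmersion ((specInv G).map i) := by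
  obtain ⟨s, hs, h⟩ := i.le
  let := (resInv V.isStable (opens_le i.le)).toAlgebra
  have := isLocalization_invSections V.isStable V.isAffineOpen ⟨s, hs⟩ (opens_le i.le) h
  exact IsOpenImmersion.of_isLocalization (⟨s, hs⟩ : invSections G V.opens)

theorem specInv_map_toInv [Finite G] {U V : StableAffine G} (i : U ⟶ V) {x : X.left}
    (hx : x ∈ U.opens) : (specInv G).map i (toInv G U.opens ⟨x, hx⟩) =
      toInv G V.opens ⟨x, opens_le i.le hx⟩ :=
  toInv_naturality_apply V.isStable (opens_le i.le) hx

/-- Points of two charts with the same image in a larger chart come from a single orbit, which meets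
both stable sets and therefore lies in their intersection. That intersection is again a chart. -/
instance [Finite G] : (specInv G ⋙ Scheme.forget).IsLocallyDirected where
  cond {U V W} i j p q h := by
    obtain ⟨⟨x, hx⟩, rfl⟩ := surjective_toInv U.isStable U.isAffineOpen p
    obtain ⟨⟨y, hy⟩, rfl⟩ := surjective_toInv V.isStable V.isAffineOpen q
    have h' : (specInv G).map i (toInv G U.opens ⟨x, hx⟩) =
      (specInv G).map j (toInv G V.opens ⟨y, hy⟩) := h
    rw [specInv_map_toInv, specInv_map_toInv] at h'
    obtain ⟨g, hg, hgx⟩ := exists_apply_eq_of_toInv_eq W.isStable W.isAffineOpen h'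
    obtain ⟨L, hLU, hLV, hL⟩ := exists_le_inf i.le j.le
    have hxV : x ∈ V.opens := (V.isStable.apply_mem_iff hg x).mp (hgx ▸ hy)
    refine ⟨L, homOfLE hLU, homOfLE hLV, toInv G L.opens ⟨x, hL ▸ ⟨hx, hxV⟩⟩,
      specInv_map_toInv (homOfLE hLU) _, (specInv_map_toInv (homOfLE hLV) _).trans ?_⟩
    rw [← toInv_apply V.isStable hg]
    congr 1
    exact Subtype.ext hgx

end StableAffine

/-- The scheme glued from the spectra of invariant sections. -/
def quotScheme (G : Subgroup (Aut X)) [Finite G] : Scheme.{u} :=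
  colimit (StableAffine.specInv G)

/-- The charts of the glued scheme. -/
def quotι [Finite G] (U : StableAffine G) :
    Spec (.of (invSections G U.opens)) ⟶ quotScheme G :=
  colimit.ι (StableAffine.specInv G) U

instance [Finite G] (U : StableAffine G) : IsOpenImmersion (quotι U) :=
  inferInstanceAs (IsOpenImmersion (colimit.ι (StableAffine.specInv G) U))

theorem map_quotι [Finite G] {U V : StableAffine G} (h : U ≤ V) :
    Spec.map (CommRingCat.ofHom (resInv V.isStable (StableAffine.opens_le h))) ≫ quotι V =
      quotι U :=
  colimit.w (StableAffine.specInv G) (homOfLE h)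

variable (G) in
/-- The cover by stable affine open subsets. -/
def stableCover (hG : ∀ x : X.left, ∃ U : StableAffine G, x ∈ U.opens) :
    X.left.OpenCover :=
  X.left.openCoverOfIsOpenCover (fun U : StableAffine G ↦ U.opens)
    (TopologicalSpace.IsOpenCover.mk (top_le_iff.mp fun x _ ↦ by
      obtain ⟨U, hU⟩ := hG x
      exact TopologicalSpace.Opens.mem_iSup.mpr ⟨U, hU⟩))

instance [Finite G] (hG : ∀ x : X.left, ∃ U : StableAffine G, x ∈ U.opens) :
    Category (stableCover G hG).I₀ := inferInstanceAs (Category (StableAffine G))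

instance [Finite G] (hG : ∀ x : X.left, ∃ U : StableAffine G, x ∈ U.opens) :
    (stableCover G hG).LocallyDirected where
  trans {U V} i := X.left.homOfLE (StableAffine.opens_le (leOfHom (X := StableAffine G) i))
  trans_id U := X.left.homOfLE_rfl _
  trans_comp {U V W} i j := (X.left.homOfLE_homOfLE _ _).symm
  w {U V} i := X.left.homOfLE_ι _
  directed {U V} x := by
    let y : U.opens := pullback.fst ((stableCover G hG).f U) ((stableCover G hG).f V) x
    let z : V.opens := pullback.snd ((stableCover G hG).f U) ((stableCover G hG).f V) x
    have hyz : y.1 = z.1 := congr($(pullback.condition (f := (stableCover G hG).f U)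
      (g := (stableCover G hG).f V)) x)
    obtain ⟨L, hLU, hLV, hL⟩ := StableAffine.exists_mem_le_le U V y.2 (hyz ▸ z.2)
    refine ⟨L, homOfLE (X := StableAffine G) hLU, homOfLE (X := StableAffine G) hLV, ⟨y.1, hL⟩, ?_⟩
    apply (pullback.fst ((stableCover G hG).f U) ((stableCover G hG).f V)).injective
    refine Eq.trans (congr($(pullback.lift_fst (f := (stableCover G hG).f U)
      (g := (stableCover G hG).f V) (X.left.homOfLE (StableAffine.opens_le hLU))
      (X.left.homOfLE (StableAffine.opens_le hLV))
      ((X.left.homOfLE_ι _).trans (X.left.homOfLE_ι _).symm)) (⟨y.1, hL⟩ : L.opens))) ?_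
    exact Scheme.homOfLE_apply' _ _ _
  property_trans {U V} i := inferInstanceAs (IsOpenImmersion (X.left.homOfLE
    (StableAffine.opens_le (leOfHom (X := StableAffine G) i))))

end StableAffine
end CubicQuotient

end

noncomputable section

namespace CubicQuotient

/-! ### Pullback of sections along open immersions. -/

section AppLE

theorem isIso_appLE_of_image_eq {X Y : Scheme.{u}} (f : X ⟶ Y) [IsOpenImmersion f] {V : Y.Opens}
    {U : X.Opens} (h : U ≤ f ⁻¹ᵁ V) (e : f ''ᵁ U = V) : IsIso (f.appLE V U h) := by
  subst e
  rw [← Scheme.Hom.appIso_hom']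
  infer_instance

theorem appLE_top_top {X Y : Scheme.{u}} (f : X ⟶ Y) (h : ⊤ ≤ f ⁻¹ᵁ ⊤) :
    f.appLE ⊤ ⊤ h = f.appTop := f.appLE_eq_app

theorem opensι_appLE_top {X : Scheme.{u}} (U : X.Opens) (h : ⊤ ≤ U.ι ⁻¹ᵁ U) :
    U.ι.appLE U ⊤ h = U.topIso.inv := Scheme.Opens.ι_appLE _ _ _ _

end AppLE

/-! ### The morphism to the glued scheme: fibres, topology and sections. -/

section QuotientMap

variable {S : Scheme.{u}} {X : Over S} {G : Subgroup (Aut X)} [Finite G]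
  (hG : ∀ x : X.left, ∃ U : StableAffine G, x ∈ U.opens)

theorem homOfLE_toInv_quotι {U V : StableAffine G} (h : U ≤ V) :
    X.left.homOfLE (StableAffine.opens_le h) ≫ toInv G V.opens ≫ quotι V =
      toInv G U.opens ≫ quotι U := by
  rw [← Category.assoc, ← toInv_naturality V.isStable, Category.assoc, map_quotι h]

variable (G) in
/-- The morphism to the glued scheme. -/
def quotMap : X.left ⟶ quotScheme G :=
  (stableCover G hG).glueMorphismsOfLocallyDirected (fun U ↦ toInv G U.opens ≫ quotι U)
    fun i ↦ homOfLE_toInv_quotι (leOfHom (X := StableAffine G) i)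

theorem ι_quotMap (U : StableAffine G) :
    U.opens.ι ≫ quotMap G hG = toInv G U.opens ≫ quotι U :=
  (stableCover G hG).map_glueMorphismsOfLocallyDirected _
    (fun i ↦ homOfLE_toInv_quotι (leOfHom (X := StableAffine G) i)) U

theorem quotMap_apply (U : StableAffine G) {x : X.left} (hx : x ∈ U.opens) :
    quotMap G hG x = quotι U (toInv G U.opens ⟨x, hx⟩) :=
  congr($(ι_quotMap hG U) (⟨x, hx⟩ : U.opens))

theorem exists_quotι_eq (y : quotScheme G) : ∃ (U : StableAffine G) (x : X.left)
    (hx : x ∈ U.opens), quotι U (toInv G U.opens ⟨x, hx⟩) = y := by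
  obtain ⟨U, p, rfl⟩ := Scheme.IsLocallyDirected.ι_jointly_surjective
    (StableAffine.specInv G) y
  obtain ⟨⟨x, hx⟩, rfl⟩ := surjective_toInv U.isStable U.isAffineOpen p
  exact ⟨U, x, hx, rfl⟩

theorem surjective_quotMap : Function.Surjective (quotMap G hG) := by
  intro y
  obtain ⟨U, x, hx, rfl⟩ := exists_quotι_eq y
  exact ⟨x, quotMap_apply hG U hx⟩

/-- The preimage of a chart is no larger than expected: points identified in the colimit are already
identified in a common smaller chart `L`. So `x` lies in the orbit of a point of `L`, hence in `L`
by stability. -/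
theorem quotMap_mem_opensRange_iff (U : StableAffine G) (x : X.left) :
    quotMap G hG x ∈ (quotι U).opensRange ↔ x ∈ U.opens := by
  refine ⟨?_, fun hx ↦ ⟨_, (quotMap_apply hG U hx).symm⟩⟩
  rintro ⟨p, hp⟩
  obtain ⟨V, hxV⟩ := hG x
  rw [quotMap_apply hG V hxV] at hp
  obtain ⟨L, i, j, q, -, hq⟩ := Scheme.IsLocallyDirected.ι_eq_ι_iff
    (StableAffine.specInv G) |>.mp hp
  obtain ⟨⟨y, hy⟩, rfl⟩ := surjective_toInv L.isStable L.isAffineOpen q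
  rw [StableAffine.specInv_map_toInv] at hq
  obtain ⟨g, hg, h⟩ := exists_apply_eq_of_toInv_eq V.isStable V.isAffineOpen hq
  refine StableAffine.opens_le i.le ?_
  change g.hom.left y = x at h
  rw [← h, L.isStable.apply_mem_iff hg]
  exact hy

theorem quotMap_preimage_opensRange (U : StableAffine G) :
    quotMap G hG ⁻¹ᵁ (quotι U).opensRange = U.opens := by
  ext x
  exact quotMap_mem_opensRange_iff hG U x

theorem quotMap_orbit {x y : X.left} (h : quotMap G hG x = quotMap G hG y) :
    ∃ g ∈ G, g.hom.left x = y := by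
  obtain ⟨U, hx⟩ := hG x
  have hy : y ∈ U.opens := by
    rw [← quotMap_mem_opensRange_iff hG, ← h, quotMap_mem_opensRange_iff]
    exact hx
  rw [quotMap_apply hG U hx, quotMap_apply hG U hy] at h
  exact exists_apply_eq_of_toInv_eq U.isStable U.isAffineOpen ((quotι U).injective h)

/-- On a stable affine open subset, pulling back along `g` is the identity on invariant sections, so
it disappears after mapping to their spectrum. -/
theorem quotMap_invariant {g : Aut X} (hg : g ∈ G) :
    g.hom.left ≫ quotMap G hG = quotMap G hG := by
  refine (stableCover G hG).hom_ext _ _ fun (U : StableAffine G) ↦ ?_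
  change U.opens.ι ≫ g.hom.left ≫ quotMap G hG = U.opens.ι ≫ quotMap G hG
  have h1 : g.hom.left.resLE U.opens U.opens (U.isStable g hg) ≫ U.opens.ι =
    U.opens.ι ≫ g.hom.left := by simp
  rw [← reassoc_of% h1, ι_quotMap, ← Category.assoc, toInv, ← Category.assoc,
    ← Scheme.Opens.toSpecΓ_SpecMap_appLE]
  congr 1
  rw [Category.assoc, ← Spec.map_comp]
  congr 2
  ext s
  exact s.2 g hg _

/-- Openness in the target is tested on the charts, where `isQuotientMap_toInv` applies. -/
theorem isQuotientMap_quotMap : Topology.IsQuotientMap (quotMap G hG) := by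
  refine ⟨Topology.isCoinducing_iff.mpr ?_, surjective_quotMap hG⟩
  refine fun V ↦ ⟨fun h ↦ ?_, fun h ↦ h.preimage (quotMap G hG).continuous⟩
  rw [isOpen_iff_forall_mem_open]
  intro y hy
  obtain ⟨U, x, hx, rfl⟩ := exists_quotι_eq y
  refine ⟨quotι U '' (quotι U ⁻¹' V), Set.image_preimage_subset _ _,
    (quotι U).isOpenEmbedding.isOpenMap _ ?_, ⟨_, hy, rfl⟩⟩
  rw [← (isQuotientMap_toInv U.isStable U.isAffineOpen).isOpen_preimage]
  have : toInv G U.opens ⁻¹' (quotι U ⁻¹' V) = U.opens.ι ⁻¹' (quotMap G hG ⁻¹' V) := by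
    rw [← Set.preimage_comp, ← Set.preimage_comp]
    exact congrArg (· ⁻¹' V) (congrArg (fun f : U.opens.toScheme ⟶ quotScheme G ↦ ⇑f)
      (ι_quotMap hG U)).symm
  rw [this]
  exact h.preimage U.opens.ι.continuous

/-- The preimage of an open set is stable, so `exists_mem_le` shrinks a chart around any of its
points into it. -/
theorem isBasis_opensRange_quotι (hG : ∀ x : X.left, ∃ U : StableAffine G, x ∈ U.opens) :
    TopologicalSpace.Opens.IsBasis (Set.range fun U : StableAffine G ↦ (quotι U).opensRange) := by
  rw [TopologicalSpace.Opens.isBasis_iff_nbhd]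
  intro V y hy
  obtain ⟨U, x, hx, rfl⟩ := exists_quotι_eq y
  have hV : IsStable G (quotMap G hG ⁻¹ᵁ V) := by
    intro g hg
    rw [← Scheme.Hom.comp_preimage, quotMap_invariant hG hg]
  obtain ⟨L, hLU, hxL, hLV⟩ := U.exists_mem_le hV hx
    (show quotMap G hG x ∈ V by rwa [quotMap_apply hG U hx])
  refine ⟨_, ⟨L, rfl⟩, ?_, ?_⟩
  · rw [← quotMap_apply hG, quotMap_mem_opensRange_iff]
    exact hxL
  · rintro _ ⟨p, rfl⟩
    obtain ⟨⟨z, hz⟩, rfl⟩ := surjective_toInv L.isStable L.isAffineOpen p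
    rw [← quotMap_apply hG]
    exact hLV hz

/-- Over a chart the comorphism is the inclusion of the invariants. Only a bijection is recorded,
which is enough to test injectivity and the image on a basis. -/
theorem quotMap_appLE (U : StableAffine G) :
    ∃ e : Γ(quotScheme G, (quotι U).opensRange) → invSections G U.opens, Function.Bijective e ∧
      ∀ t, (quotMap G hG).appLE (quotι U).opensRange U.opens
        (quotMap_preimage_opensRange hG U).ge t = (e t).1 := by
  let V := (quotι U).opensRange
  let α := (quotι U).appLE V ⊤ (by simp [V])
  have hα : IsIso α := 
    isIso_appLE_of_image_eq _ _ (Scheme.Hom.image_top_eq_opensRange _)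
  let e := α ≫ (Scheme.ΓSpecIso (.of (invSections G U.opens))).hom
  refine ⟨e, ?_, fun t ↦ ?_⟩
  · exact (ConcreteCategory.isIso_iff_bijective e).mp inferInstance
  · have h1 : (quotMap G hG).appLE V U.opens (quotMap_preimage_opensRange hG U).ge ≫
        U.opens.topIso.inv = (toInv G U.opens ≫ quotι U).appLE V ⊤
          (by rw [← ι_quotMap hG, Scheme.Hom.comp_preimage, quotMap_preimage_opensRange]; simp) := by
      simp only [← ι_quotMap hG]
      rw [← Scheme.Hom.appLE_comp_appLE _ _ _ U.opens _ (quotMap_preimage_opensRange hG U).ge (by simp)]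
      rw [opensι_appLE_top]
    have h2 : (toInv G U.opens ≫ quotι U).appLE V ⊤
          (by rw [← ι_quotMap hG, Scheme.Hom.comp_preimage, quotMap_preimage_opensRange]; simp) =
          e ≫ CommRingCat.ofHom (invSections G U.opens).subtype ≫ U.opens.topIso.inv := by
      rw [← Scheme.Hom.appLE_comp_appLE _ _ _ ⊤ _ (by simp [V]) (by simp)]
      simp only [e, Category.assoc]
      congr 1
      refine (appLE_top_top (toInv G U.opens) _).trans ?_
      rw [toInv, Scheme.Hom.comp_appTop, Scheme.Opens.toSpecΓ_appTop,
        Scheme.ΓSpecIso_naturality_assoc]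
    rw [h2, ← Category.assoc] at h1
    exact congr($((cancel_mono _).mp h1) t)

end QuotientMap

/-! ### Testing injectivity and image of a comorphism on a basis. -/

section Basis

theorem app_injective_of_isBasis {X Y : Scheme.{u}} (f : X ⟶ Y) {B : Set Y.Opens}
    (hB : TopologicalSpace.Opens.IsBasis B) (h : ∀ V ∈ B, Function.Injective (f.app V))
    (V : Y.Opens) : Function.Injective (f.app V) := by
  intro s t hst
  refine Y.sheaf.eq_of_locally_eq' (fun W : {W // W ∈ B ∧ W ≤ V} ↦ W.1) V
    (fun W ↦ homOfLE W.2.2) (fun x hx ↦ ?_) s t fun W ↦ h W.1 W.2.1 ?_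
  · obtain ⟨W, hW, hxW, hWV⟩ := TopologicalSpace.Opens.isBasis_iff_nbhd.mp hB hx
    exact TopologicalSpace.Opens.mem_iSup.mpr ⟨⟨W, hW, hWV⟩, hxW⟩
  · have h1 (r : Γ(Y, V)) : f.app W.1 (Y.presheaf.map (homOfLE W.2.2).op r) =
        X.presheaf.map ((TopologicalSpace.Opens.map f.base).map (homOfLE W.2.2)).op
          (f.app V r) := congr($(f.naturality (homOfLE W.2.2).op) r)
    refine (h1 s).trans (Eq.trans ?_ (h1 t).symm)
    rw [hst]

/-- Local preimages of an invariant section agree on overlaps by injectivity, so they glue. -/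
theorem mem_range_app_of_isBasis {S : Scheme.{u}} {X : Over S} {G : Subgroup (Aut X)}
    {Y : Scheme.{u}} (f : X.left ⟶ Y) {B : Set Y.Opens} (hB : TopologicalSpace.Opens.IsBasis B)
    (hf : ∀ V : Y.Opens, IsStable G (f ⁻¹ᵁ V))
    (hinj : ∀ V : Y.Opens, Function.Injective (f.app V))
    (h : ∀ V ∈ B, ∀ s ∈ invSections G (f ⁻¹ᵁ V), s ∈ Set.range (f.app V))
    (V : Y.Opens) {s : Γ(X.left, f ⁻¹ᵁ V)} (hs : s ∈ invSections G (f ⁻¹ᵁ V)) :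
    s ∈ Set.range (f.app V) := by
  let ι := {W // W ∈ B ∧ W ≤ V}
  have hcover : V ≤ ⨆ W : ι, W.1 := fun x hx ↦ by
    obtain ⟨W, hW, hxW, hWV⟩ := TopologicalSpace.Opens.isBasis_iff_nbhd.mp hB hx
    exact TopologicalSpace.Opens.mem_iSup.mpr ⟨⟨W, hW, hWV⟩, hxW⟩
  have hnat {W W' : Y.Opens} (i : W ≤ W') (r : Γ(Y, W')) :
      f.app W (Y.presheaf.map (homOfLE i).op r) =
        X.left.presheaf.map (homOfLE (f.preimage_mono i)).op
          (f.app W' r) := congr($(f.naturality (homOfLE i).op) r)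
  have hmap {W W' W'' : X.left.Opens} (i : W ≤ W') (j : W' ≤ W'') (r : Γ(X.left, W'')) :
      X.left.presheaf.map (homOfLE i).op (X.left.presheaf.map (homOfLE j).op r) =
        X.left.presheaf.map (homOfLE (i.trans j)).op r :=
    congr($(X.left.presheaf.map_comp (homOfLE j).op (homOfLE i).op) r).symm
  choose t ht using fun W : ι ↦ h W.1 W.2.1 _
    (map_mem_invSections (hf V) (f.preimage_mono W.2.2) hs)
  obtain ⟨r, hr, -⟩ := Y.sheaf.existsUnique_gluing' (fun W : ι ↦ W.1) V
    (fun W ↦ homOfLE W.2.2) hcover t (by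
      intro W W'
      apply hinj
      refine (hnat inf_le_left (t W)).trans (Eq.trans ?_ (hnat inf_le_right (t W')).symm)
      rw [ht, ht, hmap, hmap])
  refine ⟨r, X.left.sheaf.eq_of_locally_eq' (fun W : ι ↦ f ⁻¹ᵁ W.1) (f ⁻¹ᵁ V)
    (fun W ↦ homOfLE (f.preimage_mono W.2.2)) (fun x hx ↦ ?_) _ _ fun W ↦ ?_⟩
  · obtain ⟨W, hW⟩ := TopologicalSpace.Opens.mem_iSup.mp (hcover hx)
    exact TopologicalSpace.Opens.mem_iSup.mpr ⟨W, hW⟩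
  · refine (hnat W.2.2 r).symm.trans (Eq.trans ?_ (ht W))
    exact congrArg _ (hr W)

end Basis

/-! ### Constants in the rings of sections. -/

section Scalars

/-- For a scheme over `Spec R`, the map from `R` to the sections over an open subset. -/
def scalars {R : CommRingCat.{u}} {Z : Scheme.{u}} (f : Z ⟶ Spec R) (U : Z.Opens) : R ⟶ Γ(Z, U) :=
  (Scheme.ΓSpecIso R).inv ≫ f.appTop ≫ Z.presheaf.map (homOfLE le_top).op

variable {R : CommRingCat.{u}} {Z Z' : Scheme.{u}}

theorem scalars_res (f : Z ⟶ Spec R) {U V : Z.Opens} (i : U ≤ V) :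
    scalars f V ≫ Z.presheaf.map (homOfLE i).op = scalars f U := by
  simp only [scalars, Category.assoc, ← Functor.map_comp]
  rfl

theorem scalars_appLE (f : Z ⟶ Spec R) (g : Z' ⟶ Z) {U : Z'.Opens} {V : Z.Opens}
    (i : U ≤ g ⁻¹ᵁ V) : scalars f V ≫ g.appLE V U i = scalars (g ≫ f) U := by
  simp only [scalars, Category.assoc, Scheme.Hom.map_appLE, Scheme.Hom.comp_appTop]
  rfl

theorem toSpecΓ_scalars (f : Z ⟶ Spec R) (U : Z.Opens) :
    U.toSpecΓ ≫ Spec.map (scalars f U) = U.ι ≫ f := by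
  rw [scalars, Spec.map_comp, Spec.map_comp, Category.assoc,
    Scheme.Opens.toSpecΓ_SpecMap_presheaf_map_top_assoc, ← Scheme.toSpecΓ_naturality_assoc,
    toSpecΓ_SpecMap_ΓSpecIso_inv, Category.comp_id]

end Scalars

/-! ### Assembling the quotient over an affine base. -/

section Existence

theorem map_eqToHom_bijective {X : Scheme.{u}} {U V : X.Opens} (e : U = V) (i : U ≤ V) :
    Function.Bijective (X.presheaf.map (homOfLE i).op) := by
  subst e
  have : IsIso (X.presheaf.map (homOfLE i).op) := by
    rw [show homOfLE i = 𝟙 U from rfl]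
    infer_instance
  exact (ConcreteCategory.isIso_iff_bijective _).mp this

theorem quotMap_app_injective {S : Scheme.{u}} {X : Over S} {G : Subgroup (Aut X)} [Finite G]
    (hG : ∀ x : X.left, ∃ U : StableAffine G, x ∈ U.opens) (V : (quotScheme G).Opens) :
    Function.Injective ((quotMap G hG).app V) := by
  refine app_injective_of_isBasis _ (isBasis_opensRange_quotι hG) ?_ V
  rintro _ ⟨U, rfl⟩ s t hst
  obtain ⟨e, he, h⟩ := quotMap_appLE hG U
  apply he.1
  apply Subtype.ext
  rw [← h, ← h, Scheme.Hom.appLE, CommRingCat.comp_apply, CommRingCat.comp_apply, hst]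

theorem mem_range_quotMap_app {S : Scheme.{u}} {X : Over S} {G : Subgroup (Aut X)} [Finite G]
    (hG : ∀ x : X.left, ∃ U : StableAffine G, x ∈ U.opens) (V : (quotScheme G).Opens)
    {s : Γ(X.left, quotMap G hG ⁻¹ᵁ V)} (hs : s ∈ invSections G (quotMap G hG ⁻¹ᵁ V)) :
    s ∈ Set.range ((quotMap G hG).app V) := by
  have hstable (V : (quotScheme G).Opens) : IsStable G (quotMap G hG ⁻¹ᵁ V) := fun g hg ↦ by
    rw [← Scheme.Hom.comp_preimage, quotMap_invariant hG hg]
  refine mem_range_app_of_isBasis _ (isBasis_opensRange_quotι hG) hstable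
    (quotMap_app_injective hG) ?_ V hs
  rintro _ ⟨U, rfl⟩ s hs
  obtain ⟨e, he, h⟩ := quotMap_appLE hG U
  have i : U.opens ≤ quotMap G hG ⁻¹ᵁ (quotι U).opensRange :=
    (quotMap_preimage_opensRange hG U).ge
  obtain ⟨t, ht⟩ := he.2 ⟨_, map_mem_invSections (hstable _) i hs⟩
  refine ⟨t, (map_eqToHom_bijective (quotMap_preimage_opensRange hG U).symm i).1 ?_⟩
  rw [← CommRingCat.comp_apply]
  exact (h t).trans (congrArg Subtype.val ht)

/-- The structure morphism of a chart of the quotient of a scheme over an affine base. -/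
theorem exists_toInv_comp_eq {R : CommRingCat.{u}} {X : Over (Spec R)} {G : Subgroup (Aut X)}
    (U : X.left.Opens) :
    ∃ φ : R ⟶ CommRingCat.of (invSections G U),
      φ ≫ CommRingCat.ofHom (invSections G U).subtype = scalars X.hom U := by
  have hψ (r : R) : scalars X.hom U r ∈ invSections G U := by
    intro g hg h
    rw [← CommRingCat.comp_apply]
    have h1 : g.hom.left ≫ X.hom = X.hom := Over.w g.hom
    have h2 := scalars_appLE X.hom g.hom.left h
    rw [h1] at h2
    exact congr($h2 r)
  exact ⟨CommRingCat.ofHom ((scalars X.hom U).hom.codRestrict _ hψ), rfl⟩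

/-- The quotient of a scheme over an affine base by a finite group of automorphisms exists if every
point has a stable affine neighbourhood. -/
theorem exists_isQuotient {R : CommRingCat.{u}} {X : Over (Spec R)} {G : Subgroup (Aut X)}
    [Finite G] (hG : ∀ x : X.left, ∃ U : StableAffine G, x ∈ U.opens) :
    ∃ (Y : Over (Spec R)) (π : X ⟶ Y), IsQuotient G π := by
  choose φ hφ using fun U : StableAffine G ↦ exists_toInv_comp_eq (G := G) U.opens
  have hφ' {U V : StableAffine G} (h : U ≤ V) :
      φ V ≫ CommRingCat.ofHom (resInv V.isStable (StableAffine.opens_le h)) = φ U := by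
    have hU : Mono (CommRingCat.ofHom (invSections G U.opens).subtype) :=
      ConcreteCategory.mono_of_injective _ Subtype.val_injective
    rw [← cancel_mono (CommRingCat.ofHom (invSections G U.opens).subtype), hφ U, Category.assoc]
    have : CommRingCat.ofHom (resInv V.isStable (StableAffine.opens_le h)) ≫
        CommRingCat.ofHom (invSections G U.opens).subtype =
        CommRingCat.ofHom (invSections G V.opens).subtype ≫
          X.left.presheaf.map (homOfLE (StableAffine.opens_le h)).op := rfl
    rw [this, reassoc_of% hφ V]
    exact scalars_res X.hom _
  have hs (U : StableAffine G) :
      toInv G U.opens ≫ Spec.map (φ U) = U.opens.ι ≫ X.hom := by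
    rw [toInv, Category.assoc, ← Spec.map_comp, hφ]
    exact toSpecΓ_scalars X.hom U.opens
  -- Constants are invariant, so each chart has a structure morphism; these are compatible by `hφ'`
  -- and descend to the colimit.
  let s : quotScheme G ⟶ Spec R := colimit.desc (StableAffine.specInv G)
    { pt := Spec R
      ι := { app := fun U ↦ Spec.map (φ U)
             naturality := fun U V i ↦ by
              refine ((Spec.map_comp _ _).symm.trans ?_).trans (Category.comp_id _).symm
              exact congrArg Spec.map (hφ' i.le) } }
  have hs' (U : StableAffine G) : quotι U ≫ s = Spec.map (φ U) := colimit.ι_desc _ _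
  refine ⟨Over.mk s, Over.homMk (quotMap G hG) ?_, ?_, ?_, ?_, ?_, ?_⟩
  · refine (stableCover G hG).hom_ext _ _ fun (U : StableAffine G) ↦ ?_
    change U.opens.ι ≫ quotMap G hG ≫ s = U.opens.ι ≫ X.hom
    rw [← hs, ← hs', ← Category.assoc, ι_quotMap, Category.assoc]
  · intro g hg
    ext1
    exact quotMap_invariant hG hg
  · exact isQuotientMap_quotMap hG
  · exact fun x x' h ↦ quotMap_orbit hG h
  · exact quotMap_app_injective hG
  · exact fun V s hs ↦ mem_range_quotMap_app hG V hs

end Existence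

end CubicQuotient

end

noncomputable section

namespace CubicQuotient

/-! ### Quotients of integral schemes -/

section IntegralQuotient

variable {S : Scheme.{u}} {X Y : Over S} {G : Subgroup (Aut X)} {π : X ⟶ Y}

theorem IsQuotient.isStable_preimage (hπ : IsQuotient G π) (V : Y.left.Opens) :
    IsStable G (π.left ⁻¹ᵁ V) := fun g hg ↦ by
  rw [← Scheme.Hom.comp_preimage, ← Over.comp_left, hπ.invariant g hg]

theorem IsQuotient.surjective (hπ : IsQuotient G π) : Function.Surjective π.left :=
  hπ.isQuotientMap.surjective

theorem IsQuotient.app_mem_invSections (hπ : IsQuotient G π) (V : Y.left.Opens)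
    (t : Γ(Y.left, V)) : π.left.app V t ∈ invSections G (π.left ⁻¹ᵁ V) := by
  intro g hg h
  have h1 : g.hom.left ≫ π.left = π.left := by rw [← Over.comp_left, hπ.invariant g hg]
  have h2 : π.left.app V ≫ g.hom.left.appLE _ _ h = π.left.app V := by
    rw [Scheme.Hom.app_eq_appLE, Scheme.Hom.appLE_comp_appLE]
    simp only [h1]
  exact congr($h2 t)

/-- Sections of the quotient over a nonempty open set embed in sections of `X` over its preimage,
which is nonempty by surjectivity. -/
theorem IsQuotient.isIntegral [IsIntegral X.left] (hπ : IsQuotient G π) : IsIntegral Y.left where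
  nonempty := ⟨π.left (Nonempty.some inferInstance)⟩
  component_integral U hU := by
    have : Nonempty (π.left ⁻¹ᵁ U) := by
      obtain ⟨y⟩ := hU
      obtain ⟨x, hx⟩ := hπ.surjective y.1
      exact ⟨⟨x, show π.left x ∈ U from hx ▸ y.2⟩⟩
    exact (hπ.injective U).isDomain (π.left.app U).hom

theorem IsQuotient.apply_genericPoint [IrreducibleSpace X.left] [IrreducibleSpace Y.left]
    (hπ : IsQuotient G π) : π.left (genericPoint X.left) = genericPoint Y.left := by
  apply ((genericPoint_spec Y.left).eq _).symm
  have := (genericPoint_spec X.left).image π.left.continuous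
  rwa [Set.image_univ, hπ.surjective.range_eq, closure_univ] at this

/-- A stable open subset is the preimage of an open subset of the quotient. -/
theorem IsQuotient.exists_preimage_eq (hπ : IsQuotient G π) {U : X.left.Opens}
    (hU : IsStable G U) : ∃ V : Y.left.Opens, π.left ⁻¹ᵁ V = U := by
  have h : π.left ⁻¹' (π.left '' U) = U := by
    refine (Set.subset_preimage_image _ _).antisymm' ?_
    rintro x ⟨y, hy, hyx⟩
    obtain ⟨g, hg, rfl⟩ := hπ.orbit y x hyx
    exact (hU.apply_mem_iff hg y).mpr hy
  refine ⟨⟨π.left '' U, ?_⟩, TopologicalSpace.Opens.ext h⟩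
  rw [← hπ.isQuotientMap.isCoinducing.isOpen_preimage, h]
  exact U.2

/-- The quotient here is arbitrary, not the glued one, so affine open sets of `Y` must be matched
with principal ones of `X`. An affine `W` around `π x` is chosen first, then an invariant `s` with
`D(s)` inside its preimage; `s` descends to `W`, and the locus where the descended section is
invertible is the required affine. -/
theorem IsQuotient.exists_isAffineOpen [Finite G] (hπ : IsQuotient G π) (U : StableAffine G)
    {x : X.left} (hx : x ∈ U.opens) :
    ∃ s ∈ invSections G U.opens, x ∈ X.left.basicOpen s ∧ ∃ V : Y.left.Opens, IsAffineOpen V ∧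
      π.left ⁻¹ᵁ V = X.left.basicOpen s := by
  obtain ⟨V, hV⟩ := hπ.exists_preimage_eq U.isStable
  obtain ⟨W, hW, hxW, hWV⟩ := exists_isAffineOpen_mem_and_subset
    (show π.left x ∈ V from hV.ge hx)
  obtain ⟨s, hs, hxs, hsW⟩ := exists_inv_basicOpen_le U.isStable U.isAffineOpen
    (hπ.isStable_preimage W) hx hxW
  have i : π.left ⁻¹ᵁ W ≤ U.opens := (π.left.preimage_mono hWV).trans hV.le
  obtain ⟨t, ht⟩ := hπ.mem_range W _ (map_mem_invSections U.isStable i hs)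
  refine ⟨s, hs, hxs, Y.left.basicOpen t, hW.basicOpen t, ?_⟩
  rw [Scheme.preimage_basicOpen, ht, Scheme.basicOpen_res, inf_eq_right]
  exact hsW

/-- The germs at the generic point of the quotient of `X` by `G` are the fractions of invariant
sections over any nonempty stable affine open subset. -/
theorem IsQuotient.mem_range_stalkMap_iff [Finite G] [IsIntegral X.left] (hπ : IsQuotient G π)
    (U : StableAffine G) (hη : genericPoint X.left ∈ U.opens) (f : X.left.functionField) :
    f ∈ (π.left.stalkMap (genericPoint X.left)).hom.range ↔
      ∃ a ∈ invSections G U.opens, ∃ b ∈ invSections G U.opens,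
        X.left.presheaf.germ U.opens _ hη b ≠ 0 ∧
        f * X.left.presheaf.germ U.opens _ hη b = X.left.presheaf.germ U.opens _ hη a := by
  have hY := hπ.isIntegral
  obtain ⟨s, hs, hηs, V, hV, hVs⟩ := hπ.exists_isAffineOpen U hη
  have hηV : π.left (genericPoint X.left) ∈ V := hVs.ge hηs
  have hle : π.left ⁻¹ᵁ V ≤ U.opens := hVs.le.trans (X.left.basicOpen_le s)
  have hgerm (t : Γ(Y.left, V)) : π.left.stalkMap (genericPoint X.left)
      (Y.left.presheaf.germ V _ hηV t) =
      X.left.presheaf.germ (π.left ⁻¹ᵁ V) (genericPoint X.left) hηV (π.left.app V t) :=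
    Scheme.Hom.germ_stalkMap_apply _ _ _ _ _
  have hres (t : Γ(X.left, U.opens)) :
      X.left.presheaf.germ (π.left ⁻¹ᵁ V) (genericPoint X.left) hηV
        (X.left.presheaf.map (homOfLE hle).op t) = X.left.presheaf.germ U.opens _ hη t :=
    X.left.presheaf.germ_res_apply (homOfLE hle) _ _ _
  have hinv (a : Γ(X.left, U.opens)) (ha : a ∈ invSections G U.opens) :
      X.left.presheaf.germ U.opens _ hη a ∈
        (π.left.stalkMap (genericPoint X.left)).hom.range := by
    obtain ⟨t, ht⟩ := hπ.mem_range V _ (map_mem_invSections U.isStable hle ha)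
    exact ⟨_, (hgerm t).trans (ht ▸ hres a)⟩
  -- The generic point maps to the generic point, so this stalk is the function field of `Y` and
  -- denominators can be inverted in it.
  have hfield : IsField (Y.left.presheaf.stalk (π.left (genericPoint X.left))) := by
    rw [hπ.apply_genericPoint]
    exact Field.toIsField Y.left.functionField
  constructor
  · rintro ⟨y, rfl⟩
    let : Algebra Γ(Y.left, V) (Y.left.presheaf.stalk (π.left (genericPoint X.left))) :=
      (Y.left.presheaf.germ V _ hηV).hom.toAlgebra
    have hloc : IsLocalization.AtPrime (Y.left.presheaf.stalk (π.left (genericPoint X.left)))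
      (hV.primeIdealOf ⟨π.left (genericPoint X.left), hηV⟩).asIdeal :=
      hV.isLocalization_stalk ⟨_, hηV⟩
    obtain ⟨⟨a, b⟩, hab⟩ := IsLocalization.surj
      (hV.primeIdealOf ⟨π.left (genericPoint X.left), hηV⟩).asIdeal.primeCompl y
    have hb0 := (IsLocalization.map_units (Y.left.presheaf.stalk (π.left (genericPoint X.left)))
      b).map (π.left.stalkMap (genericPoint X.left)).hom
    have hab' := congrArg (π.left.stalkMap (genericPoint X.left)) hab
    rw [map_mul] at hab'
    change _ * π.left.stalkMap _ (Y.left.presheaf.germ V _ hηV b.1) =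
      π.left.stalkMap _ (Y.left.presheaf.germ V _ hηV a) at hab'
    change IsUnit (π.left.stalkMap _ (Y.left.presheaf.germ V _ hηV b.1)) at hb0
    rw [hgerm] at hb0
    rw [hgerm, hgerm] at hab'
    -- Sections over `V` are invariants on `D(s)`, so a power of `s` turns them into invariants on
    -- all of `U`.
    have hfrac (t : Γ(Y.left, V)) : ∃ n : ℕ, ∃ c ∈ invSections G U.opens,
        X.left.presheaf.germ (π.left ⁻¹ᵁ V) (genericPoint X.left) hηV (π.left.app V t) *
          X.left.presheaf.germ U.opens _ hη s ^ n = X.left.presheaf.germ U.opens _ hη c := by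
      let := (resInv U.isStable hle).toAlgebra
      have := isLocalization_invSections U.isStable U.isAffineOpen ⟨s, hs⟩ hle hVs
      obtain ⟨n, c, hc⟩ := IsLocalization.Away.surj (⟨s, hs⟩ : invSections G U.opens)
        (⟨_, hπ.app_mem_invSections V t⟩ : invSections G (π.left ⁻¹ᵁ V))
      refine ⟨n, c.1, c.2, ?_⟩
      have hc' : π.left.app V t * (X.left.presheaf.map (homOfLE hle).op s) ^ n =
        X.left.presheaf.map (homOfLE hle).op c.1 := congrArg Subtype.val hc
      rw [← hres c.1, ← hc', map_mul, map_pow, hres]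
    obtain ⟨n, c, hc, hca⟩ := hfrac a
    obtain ⟨n', c', hc', hcb⟩ := hfrac b.1
    have hs0 : X.left.presheaf.germ U.opens _ hη s ≠ 0 :=
      (X.left.mem_basicOpen s _ hη |>.mp hηs).ne_zero
    refine ⟨c * s ^ n', mul_mem hc (pow_mem hs _), c' * s ^ n, mul_mem hc' (pow_mem hs _), ?_, ?_⟩
    · rw [map_mul, map_pow, ← hcb]
      exact mul_ne_zero (mul_ne_zero hb0.ne_zero (pow_ne_zero _ hs0)) (pow_ne_zero _ hs0)
    · rw [map_mul, map_mul, map_pow, map_pow, ← hcb, ← hca, ← hab']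
      ring
  · rintro ⟨a, ha, b, hb, hb0, h⟩
    obtain ⟨a', ha'⟩ := hinv a ha
    obtain ⟨b', hb'⟩ := hinv b hb
    have hb'0 : b' ≠ 0 := by
      rintro rfl
      exact hb0 (hb'.symm.trans (map_zero _))
    obtain ⟨c, hc⟩ := hfield.mul_inv_cancel hb'0
    refine ⟨a' * c, ?_⟩
    rw [map_mul, ha', ← h, ← hb', mul_assoc, ← map_mul, hc, map_one, mul_one]

end IntegralQuotient

end CubicQuotient

end

noncomputable section

namespace CubicQuotient

/-! ### Algebras of finite type with the same field of fractions are birational -/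

section CommonLocalization

variable {k K : Type*} [Field k] [Field K] [Algebra k K]

/-- The localization `A[1/a]` of a subalgebra `A` of a field. -/
def awaySubalgebra (A : Subalgebra k K) (a : A) : Subalgebra k K where
  carrier := {r | ∃ n : ℕ, r * a.1 ^ n ∈ A}
  mul_mem' := by
    rintro r s ⟨n, hn⟩ ⟨m, hm⟩
    refine ⟨n + m, ?_⟩
    have : r * s * a.1 ^ (n + m) = (r * a.1 ^ n) * (s * a.1 ^ m) := by ring
    exact this ▸ mul_mem hn hm
  add_mem' := by
    rintro r s ⟨n, hn⟩ ⟨m, hm⟩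
    refine ⟨n + m, ?_⟩
    have : (r + s) * a.1 ^ (n + m) = (r * a.1 ^ n) * a.1 ^ m + (s * a.1 ^ m) * a.1 ^ n := by ring
    exact this ▸ add_mem (mul_mem hn (pow_mem a.2 _)) (mul_mem hm (pow_mem a.2 _))
  algebraMap_mem' r := ⟨0, by simp⟩

theorem le_awaySubalgebra (A : Subalgebra k K) (a : A) : A ≤ awaySubalgebra A a :=
  fun r hr ↦ ⟨0, by simpa using hr⟩

theorem awaySubalgebra_le {A B : Subalgebra k K} {a : A} (ha : a ≠ 0) (h : A ≤ B)
    (h' : a.1⁻¹ ∈ B) : awaySubalgebra A a ≤ B := by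
  rintro r ⟨n, hn⟩
  have : r = (r * a.1 ^ n) * a.1⁻¹ ^ n := by
    have : a.1 ≠ 0 := fun h ↦ ha (Subtype.ext h)
    rw [mul_assoc, ← mul_pow, mul_inv_cancel₀ this, one_pow, mul_one]
  exact this ▸ mul_mem (h hn) (pow_mem h' _)

/-- `R` is kept separate from `awaySubalgebra A a` so that one and the same ring can be exhibited as
a localization of two different algebras. -/
theorem isLocalization_awaySubalgebra {A R : Subalgebra k K} {a : A} (ha : a ≠ 0)
    (h : R = awaySubalgebra A a) {C : Type*} [CommRing C] (f : C →+* R) (i : C →+* K)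
    (hi : Function.Injective i) (hf : ∀ x, (f x : K) = i x) (hA : (i.range : Set K) = A)
    {c : C} (hc : i c = a.1) :
    letI := f.toAlgebra
    IsLocalization.Away c R := by
  let := f.toAlgebra
  have ha' : a.1 ≠ 0 := fun h ↦ ha (Subtype.ext h)
  have hinv : a.1⁻¹ ∈ R := h ▸ ⟨1, by simp [ha']⟩
  refine ⟨?_, ?_, ?_⟩
  · rintro ⟨_, n, rfl⟩
    rw [map_pow]
    refine IsUnit.pow _ (.of_mul_eq_one ⟨a.1⁻¹, hinv⟩ (Subtype.ext ?_))
    change (f c : K) * a.1⁻¹ = 1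
    rw [hf, hc, mul_inv_cancel₀ ha']
  · rintro ⟨r, hr⟩
    obtain ⟨n, hn⟩ := h ▸ hr
    obtain ⟨x, hx⟩ := hA.ge hn
    refine ⟨⟨x, ⟨_, n, rfl⟩⟩, Subtype.ext ?_⟩
    change r * (f (c ^ n) : K) = f x
    rw [hf, hf, hx, map_pow, hc]
  · intro x y hxy
    refine ⟨1, congrArg _ (hi ?_)⟩
    rw [← hf, ← hf]
    exact congrArg Subtype.val hxy

/-- The product of denominators of a finite set of generators is a common denominator for the whole
algebra. -/
theorem exists_le_awaySubalgebra {A B : Subalgebra k K} (hA : A.FG)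
    (h : ∀ r ∈ A, ∃ b ∈ B, b ≠ 0 ∧ r * b ∈ B) : ∃ b : B, b ≠ 0 ∧ A ≤ awaySubalgebra B b := by
  obtain ⟨S, rfl⟩ := hA
  choose! d hd hd0 hd' using h
  have hS (s : K) (hs : s ∈ S) : s ∈ Algebra.adjoin k (S : Set K) := Algebra.subset_adjoin hs
  refine ⟨⟨∏ s ∈ S, d s, prod_mem fun s hs ↦ hd s (hS s hs)⟩, ?_, ?_⟩
  · intro h
    exact Finset.prod_ne_zero_iff.mpr (fun s hs ↦ hd0 s (hS s hs)) (congrArg Subtype.val h)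
  · rw [Algebra.adjoin_le_iff]
    intro s hs
    refine ⟨1, ?_⟩
    classical
    change s * (∏ s ∈ S, d s) ^ 1 ∈ B
    rw [pow_one, ← Finset.mul_prod_erase S d hs, ← mul_assoc]
    exact mul_mem (hd' s (hS s hs))
      (prod_mem fun t ht ↦ hd t (hS t (Finset.mem_of_mem_erase ht)))

theorem exists_awaySubalgebra_le {A B : Subalgebra k K} {a₀ : A} {b₀ : B} (ha₀ : a₀ ≠ 0)
    (hb₀ : b₀ ≠ 0) (hB : B ≤ awaySubalgebra A a₀) :
    ∃ a : A, a ≠ 0 ∧ B ≤ awaySubalgebra A a ∧ a₀.1⁻¹ ∈ awaySubalgebra A a ∧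
      b₀.1⁻¹ ∈ awaySubalgebra A a ∧ ∃ N : ℕ, a.1 = a₀.1 ^ N * b₀.1 := by
  have ha' : a₀.1 ≠ 0 := fun h ↦ ha₀ (Subtype.ext h)
  have hb' : b₀.1 ≠ 0 := fun h ↦ hb₀ (Subtype.ext h)
  obtain ⟨N, hN⟩ := hB b₀.2
  -- `N` factors `a₀` bring `b₀` into `A`; the extra one ensures that `a₀` becomes invertible even
  -- when `N = 0`.
  obtain ⟨a, ha⟩ : ∃ a : A, a.1 = a₀.1 ^ (N + 1) * b₀.1 :=
    ⟨a₀ * ⟨_, hN⟩, by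
      change a₀.1 * (b₀.1 * a₀.1 ^ N) = _
      ring⟩
  have h1 : a₀.1⁻¹ ∈ awaySubalgebra A a := ⟨1, by
    rwa [pow_one, ha, pow_succ', mul_assoc, inv_mul_cancel_left₀ ha', mul_comm]⟩
  refine ⟨a, ?_, hB.trans (awaySubalgebra_le ha₀ (le_awaySubalgebra _ _) h1), h1, ⟨1, ?_⟩, N + 1, ha⟩
  · rintro rfl
    exact mul_ne_zero (pow_ne_zero _ ha') hb' ha.symm
  · rw [pow_one, ha, mul_comm, mul_inv_cancel_right₀ hb']
    exact pow_mem a₀.2 _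

/-- Each algebra lies in the other after inverting one element, `a₀` or `b₀`. Inverting both,
through `a = a₀ᴺ b₀` in `A` and `b = b₀ᴹ a₀` in `B`, makes the two localizations contain each other.
-/
theorem exists_awaySubalgebra_eq {A B : Subalgebra k K} (hA : A.FG) (hB : B.FG)
    (hAB : ∀ r ∈ A, ∃ b ∈ B, b ≠ 0 ∧ r * b ∈ B) (hBA : ∀ r ∈ B, ∃ a ∈ A, a ≠ 0 ∧ r * a ∈ A) :
    ∃ (a : A) (b : B), a ≠ 0 ∧ b ≠ 0 ∧ awaySubalgebra A a = awaySubalgebra B b := by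
  obtain ⟨b₀, hb₀, h₁⟩ := exists_le_awaySubalgebra hA hAB
  obtain ⟨a₀, ha₀, h₂⟩ := exists_le_awaySubalgebra hB hBA
  obtain ⟨a, ha, h₃, h₄, h₅, N, hN⟩ := exists_awaySubalgebra_le ha₀ hb₀ h₂
  obtain ⟨b, hb, h₆, h₇, h₈, M, hM⟩ := exists_awaySubalgebra_le hb₀ ha₀ h₁
  refine ⟨a, b, ha, hb, le_antisymm (awaySubalgebra_le ha h₆ ?_) (awaySubalgebra_le hb h₃ ?_)⟩
  · rw [hN, mul_inv, ← inv_pow]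
    exact mul_mem (pow_mem h₈ _) h₇
  · rw [hM, mul_inv, ← inv_pow]
    exact mul_mem (pow_mem h₅ _) h₄

end CommonLocalization

/-! ### Birationality of spectra. -/

section SpecBirational

variable {k : Type u} [Field k]

theorem isDominant_of_isOpenImmersion {X Y : Scheme.{u}} (f : X ⟶ Y) [IsOpenImmersion f]
    [IrreducibleSpace Y] [Nonempty X] : IsDominant f :=
  ⟨f.isOpenEmbedding.isOpen_range.dense (Set.range_nonempty _)⟩

/-- Spectra of two domains of finite type over `k` inside a field `K` are birational if the domains
have the same field of fractions. -/
theorem birationalOver_Spec {C D : CommRingCat.{u}} (φ : .of k ⟶ C) (ψ : .of k ⟶ D)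
    (hφ : φ.hom.FiniteType) (hψ : ψ.hom.FiniteType) {K : Type u} [Field K] (i : C →+* K)
    (j : D →+* K) (hi : Function.Injective i) (hj : Function.Injective j)
    (hij : i.comp φ.hom = j.comp ψ.hom)
    (hCD : ∀ c : C, ∃ d d' : D, d' ≠ 0 ∧ i c * j d' = j d)
    (hDC : ∀ d : D, ∃ c c' : C, c' ≠ 0 ∧ j d * i c' = i c) :
    Scheme.BirationalOver (Spec.map φ) (Spec.map ψ) := by
  let : Algebra k C := φ.hom.toAlgebra
  let : Algebra k D := ψ.hom.toAlgebra
  let : Algebra k K := (i.comp φ.hom).toAlgebra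
  have : Algebra.FiniteType k C := hφ
  have : Algebra.FiniteType k D := hψ
  let i' : C →ₐ[k] K := { i with commutes' := fun _ ↦ rfl }
  let j' : D →ₐ[k] K := { j with commutes' := fun x ↦ congr($(hij) x).symm }
  obtain ⟨a, b, ha, hb, hab⟩ := exists_awaySubalgebra_eq (A := i'.range) (B := j'.range)
    (Algebra.map_top i' ▸ (Algebra.FiniteType.out (R := k) (A := C)).map i')
    (Algebra.map_top j' ▸ (Algebra.FiniteType.out (R := k) (A := D)).map j')
    (by
      rintro _ ⟨c, rfl⟩
      obtain ⟨d, d', hd', h⟩ := hCD c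
      exact ⟨j d', ⟨d', rfl⟩, (map_ne_zero_iff j hj).mpr hd', ⟨d, h.symm⟩⟩)
    (by
      rintro _ ⟨d, rfl⟩
      obtain ⟨c, c', hc', h⟩ := hDC d
      exact ⟨i c', ⟨c', rfl⟩, (map_ne_zero_iff i hi).mpr hc', ⟨c, h.symm⟩⟩)
  -- The spectrum of this common localization is a dense open subscheme of both spectra.
  let R := awaySubalgebra i'.range a
  let f : C →+* R := i.codRestrict R fun x ↦ le_awaySubalgebra _ _ ⟨x, rfl⟩
  let g : D →+* R := j.codRestrict R fun x ↦ by
    change j x ∈ awaySubalgebra _ _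
    rw [hab]
    exact le_awaySubalgebra _ _ ⟨x, rfl⟩
  obtain ⟨c, hc⟩ := a.2
  obtain ⟨d, hd⟩ := b.2
  have hC : IsDomain C := hi.isDomain i
  have hD : IsDomain D := hj.isDomain j
  have hf : IsOpenImmersion (Spec.map (CommRingCat.ofHom f)) := by
    let := f.toAlgebra
    have : IsLocalization.Away c R :=
      isLocalization_awaySubalgebra ha rfl f i hi (fun _ ↦ rfl) rfl hc
    exact IsOpenImmersion.of_isLocalization c
  have hg : IsOpenImmersion (Spec.map (CommRingCat.ofHom g)) := by
    let := g.toAlgebra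
    have : IsLocalization.Away d R :=
      isLocalization_awaySubalgebra hb hab g j hj (fun _ ↦ rfl) rfl hd
    exact IsOpenImmersion.of_isLocalization d
  have : Nonempty (Spec (.of R)) := inferInstanceAs (Nonempty (PrimeSpectrum R))
  have : IrreducibleSpace (Spec C) := inferInstanceAs (IrreducibleSpace (PrimeSpectrum C))
  have : IrreducibleSpace (Spec D) := inferInstanceAs (IrreducibleSpace (PrimeSpectrum D))
  have := isDominant_of_isOpenImmersion (Spec.map (CommRingCat.ofHom f))
  have := isDominant_of_isOpenImmersion (Spec.map (CommRingCat.ofHom g))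
  refine ((Spec.map (CommRingCat.ofHom f)).birationalOver (Spec.map φ) _ rfl).symm.trans
    ((Spec.map (CommRingCat.ofHom g)).birationalOver (Spec.map ψ) _ ?_)
  rw [← Spec.map_comp, ← Spec.map_comp]
  congr 1
  ext x
  exact congr($(hij) x).symm

end SpecBirational

end CubicQuotient

end

noncomputable section

namespace CubicQuotient

/-! ### Quotients with a purely transcendental function field -/

section QuotientBirational

variable {k : Type u} [Field k]

theorem germ_scalars (X : Over (Spec (.of k))) (U : X.left.Opens) (x : X.left) (hx : x ∈ U)
    (c : k) : X.left.presheaf.germ U x hx (scalars X.hom U c) = constants X x c := by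
  rw [scalars, constants, CommRingCat.comp_apply, CommRingCat.comp_apply]
  exact X.left.presheaf.germ_res_apply (homOfLE le_top) _ _ _

variable {X Y : Over (Spec (.of k))} {G : Subgroup (Aut X)} {π : X ⟶ Y}

theorem app_scalars (π : X ⟶ Y) (V : Y.left.Opens) (c : k) :
    π.left.app V (scalars Y.hom V c) = scalars X.hom (π.left ⁻¹ᵁ V) c := by
  have h := scalars_appLE Y.hom π.left (le_refl (π.left ⁻¹ᵁ V))
  rw [Scheme.Hom.appLE_eq_app, Over.w π] at h
  exact congr($h c)

theorem scalars_mem_invSections (U : X.left.Opens) (c : k) :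
    scalars X.hom U c ∈ invSections G U := by
  obtain ⟨φ, hφ⟩ := exists_toInv_comp_eq (G := G) U
  rw [← hφ]
  exact (φ c).2

/-- Invariants of an algebra of finite type under a finite group are of finite type. -/
theorem finiteType_invSections [Finite G] {U : X.left.Opens} (hU : IsStable G U)
    (h : (scalars X.hom U).hom.FiniteType) :
    ((scalars X.hom U).hom.codRestrict (invSections G U)
      (scalars_mem_invSections U)).FiniteType := by
  let : Algebra k Γ(X.left, U) := (scalars X.hom U).hom.toAlgebra
  let : Algebra k (invSections G U) := ((scalars X.hom U).hom.codRestrict (invSections G U)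
      (scalars_mem_invSections U)).toAlgebra
  have : IsScalarTower k (invSections G U) Γ(X.left, U) := .of_algebraMap_eq fun _ ↦ rfl
  have : Algebra.FiniteType k Γ(X.left, U) := h
  have : Algebra.FiniteType (invSections G U) Γ(X.left, U) :=
    .of_restrictScalars_finiteType k _ _
  have := hU.isIntegral
  have : Module.Finite (invSections G U) Γ(X.left, U) := Algebra.IsIntegral.finite
  -- The Artin–Tate lemma: the sections are of finite type over `k` and a finite module over the
  -- invariants.
  exact ⟨fg_of_fg_of_fg k (invSections G U) Γ(X.left, U) Algebra.FiniteType.out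
    Module.Finite.fg_top Subtype.val_injective⟩

/-- Sections over `V` are the invariants on `D(s)`, a localization at `s` of the invariants on `U`.
-/
theorem IsQuotient.finiteType [Finite G] (hπ : IsQuotient G π) (U : StableAffine G)
    (h : (scalars X.hom U.opens).hom.FiniteType) {V : Y.left.Opens} {s : Γ(X.left, U.opens)}
    (hs : s ∈ invSections G U.opens) (hV : π.left ⁻¹ᵁ V = X.left.basicOpen s) :
    (scalars Y.hom V).hom.FiniteType := by
  have hle : π.left ⁻¹ᵁ V ≤ U.opens := hV.le.trans (X.left.basicOpen_le s)
  let := (resInv U.isStable hle).toAlgebra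
  have := isLocalization_invSections U.isStable U.isAffineOpen ⟨s, hs⟩ hle hV
  have h1 : (resInv U.isStable hle).FiniteType :=
    IsLocalization.finiteType_of_monoid_fg
      (Submonoid.powers (⟨s, hs⟩ : invSections G U.opens)) (invSections G (π.left ⁻¹ᵁ V))
  let e : Γ(Y.left, V) ≃+* invSections G (π.left ⁻¹ᵁ V) :=
    RingEquiv.ofBijective ((π.left.app V).hom.codRestrict _ (hπ.app_mem_invSections V))
      ⟨fun a b hab ↦ hπ.injective V (congrArg Subtype.val hab),
        fun b ↦ (hπ.mem_range V b.1 b.2).imp fun _ ha ↦ Subtype.ext ha⟩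
  have h2 : (scalars Y.hom V).hom = (e.symm : _ →+* Γ(Y.left, V)).comp
      ((resInv U.isStable hle).comp ((scalars X.hom U.opens).hom.codRestrict
        (invSections G U.opens) (scalars_mem_invSections U.opens))) := by
    ext c
    apply e.injective
    refine Eq.trans ?_ (e.apply_symm_apply _).symm
    refine Subtype.ext ((app_scalars π V c).trans ?_)
    exact congr($(scalars_res X.hom hle) c).symm
  rw [h2]
  exact (RingHom.FiniteType.of_surjective _ e.symm.surjective).comp
    (h1.comp (finiteType_invSections U.isStable h))

/-- A quotient whose function field is purely transcendental over `k` is birational to an affine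
space. -/
theorem IsQuotient.birationalOver [Finite G] [IsIntegral X.left] (hπ : IsQuotient G π)
    (U : StableAffine G) (hη : genericPoint X.left ∈ U.opens)
    (h : (scalars X.hom U.opens).hom.FiniteType) {ι : Type u} [Finite ι]
    (g : ι → X.left.functionField)
    (hg : IsPurelyTranscendentalOn (constants X (genericPoint X.left))
      (π.left.stalkMap (genericPoint X.left)).hom.range g) :
    Scheme.BirationalOver (S := Spec (.of k)) Y.hom (𝔸(ι; Spec (.of k)) ↘ Spec (.of k)) := by
  have hY := hπ.isIntegral
  obtain ⟨s, hs, hηs, V, hV, hVs⟩ := hπ.exists_isAffineOpen U hη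
  have hηV : π.left (genericPoint X.left) ∈ V := hVs.ge hηs
  have hle : π.left ⁻¹ᵁ V ≤ U.opens := hVs.le.trans (X.left.basicOpen_le s)
  let : Algebra k X.left.functionField := (constants X (genericPoint X.left)).toAlgebra
  obtain ⟨hg1, hg2⟩ := hg
  change AlgebraicIndependent k g at hg1
  let i : Γ(Y.left, V) →+* X.left.functionField :=
    (X.left.presheaf.germ (π.left ⁻¹ᵁ V) (genericPoint X.left) hηV).hom.comp (π.left.app V).hom
  let j : MvPolynomial ι k →+* X.left.functionField := (MvPolynomial.aeval (R := k) g).toRingHom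
  have hi : Function.Injective i := by
    have : Nonempty (π.left ⁻¹ᵁ V) := ⟨⟨_, hηV⟩⟩
    exact (Scheme.germToFunctionField_injective X.left (π.left ⁻¹ᵁ V)).comp (hπ.injective V)
  have hj : Function.Injective j := hg1
  have hi' (c : Γ(Y.left, V)) : i c ∈ (π.left.stalkMap (genericPoint X.left)).hom.range :=
    ⟨Y.left.presheaf.germ V _ hηV c, Scheme.Hom.germ_stalkMap_apply _ _ _ _ _⟩
  -- Both `Γ(Y, V)` and the polynomial ring are embedded in the function field of `X`, where they
  -- have the same fractions by `hg2`.
  have h1 : Scheme.BirationalOver (Spec.map (scalars Y.hom V))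
      (Spec.map (CommRingCat.ofHom (MvPolynomial.C (σ := ι) (R := k)))) := by
    refine birationalOver_Spec _ _ (hπ.finiteType U h hs hVs) ?_ i j hi hj ?_ ?_ ?_
    · have : (algebraMap k (MvPolynomial ι k)).FiniteType :=
        RingHom.finiteType_algebraMap.mpr inferInstance
      exact this
    · ext c
      refine Eq.trans ?_ (MvPolynomial.aeval_C g c).symm
      refine (congrArg _ (app_scalars π V c)).trans ?_
      exact germ_scalars X _ _ _ c
    · intro c
      have hc : i c ∈ IntermediateField.adjoin k (Set.range g) := hg2.le (hi' c)
      obtain ⟨r, q, hrq⟩ := (IntermediateField.mem_adjoin_range_iff k g _).mp hc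
      -- Membership in the adjoined field allows a zero denominator; then the fraction is 0 by
      -- convention.
      by_cases hq : j q = 0
      · refine ⟨0, 1, one_ne_zero, ?_⟩
        have : i c = j r / j q := hrq
        rw [this, hq, div_zero, zero_mul, map_zero]
      · refine ⟨r, q, fun h ↦ hq (by rw [h, map_zero]), ?_⟩
        have : i c = j r / j q := hrq
        rw [this, div_mul_cancel₀ _ hq]
    · intro d
      have hd : j d ∈ (π.left.stalkMap (genericPoint X.left)).hom.range := by
        refine hg2.ge ?_
        refine IntermediateField.algebra_adjoin_le_adjoin _ _ ?_
        rw [Algebra.adjoin_range_eq_range_aeval]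
        exact ⟨d, rfl⟩
      obtain ⟨a, ha, b, hb, hb0, hab⟩ := (hπ.mem_range_stalkMap_iff U hη _).mp hd
      have hlift (a : Γ(X.left, U.opens)) (ha : a ∈ invSections G U.opens) :
          ∃ c, i c = X.left.presheaf.germ U.opens _ hη a := by
        obtain ⟨c, hc⟩ := hπ.mem_range V _ (map_mem_invSections U.isStable hle ha)
        refine ⟨c, (congrArg _ hc).trans ?_⟩
        exact X.left.presheaf.germ_res_apply (homOfLE hle) _ _ _
      obtain ⟨c, hc⟩ := hlift a ha
      obtain ⟨c', hc'⟩ := hlift b hb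
      refine ⟨c, c', ?_, by rw [hc, hc', hab]⟩
      rintro rfl
      exact hb0 (hc'.symm.trans (map_zero i))
  have h2 : Scheme.BirationalOver (Spec.map (scalars Y.hom V)) Y.hom := by
    have : Nonempty V := ⟨⟨_, hηV⟩⟩
    have h3 := isDominant_of_isOpenImmersion V.ι
    have : IsDominant (hV.isoSpec.inv ≫ V.ι) := inferInstance
    refine (hV.isoSpec.inv ≫ V.ι).birationalOver _ _ ?_
    rw [Category.assoc, ← toSpecΓ_scalars, Iso.inv_comp_eq]
    rfl
  refine h2.symm.trans (h1.trans ?_)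
  exact (AffineSpace.SpecIso ι (.of k)).inv.birationalOver _ _ (AffineSpace.SpecIso_inv_over _)

end QuotientBirational

end CubicQuotient

end

noncomputable section

namespace CubicQuotient

/-! ### The ring extension `R → R[u, v] / (u³ - v² - v)` -/

section CubicExtension

open Polynomial

variable {R P Q : Type*} [CommRing R] [CommRing P] [CommRing Q]

/-- The polynomial `u³ - (v² + v)` in `u` with coefficients in `R[v]`. -/
def cubicPoly (R : Type*) [CommRing R] : R[X][X] := X ^ 3 - C (X ^ 2 + X)

theorem cubicPoly_monic (R : Type*) [CommRing R] : (cubicPoly R).Monic :=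
  monic_X_pow_sub_C _ (by norm_num)

theorem cubicPoly_map (f : R →+* P) : (cubicPoly R).map (mapRingHom f) = cubicPoly P := by
  simp [cubicPoly]

/-- Eisenstein at the prime `v` of `K[v]`: the constant term `-(v² + v)` is divisible by `v` but not
by `v²`. This holds in every characteristic. -/
theorem cubicPoly_prime (K : Type*) [Field K] : Prime (cubicPoly K) := by
  have hprime : (Ideal.span {(X : K[X])}).IsPrime :=
    (Ideal.span_singleton_prime X_ne_zero).mpr prime_X
  refine Irreducible.prime ?_
  have hdeg : (cubicPoly K).degree = 3 := degree_X_pow_sub_C (by norm_num) _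
  refine irreducible_of_eisenstein_criterion hprime ?_ ?_ ?_ ?_
    (cubicPoly_monic K).isPrimitive
  · rw [(cubicPoly_monic K).leadingCoeff]
    exact (Ideal.ne_top_iff_one _).mp hprime.ne_top
  · intro n hn
    rw [hdeg] at hn
    have hn' : n ≠ 3 := by rintro rfl; exact lt_irrefl _ hn
    rw [cubicPoly, coeff_sub, coeff_X_pow, if_neg hn', zero_sub, coeff_C]
    split_ifs
    · refine neg_mem (Ideal.mem_span_singleton.mpr ⟨X + 1, by ring⟩)
    · simp
  · rw [hdeg]; exact Nat.cast_pos.mpr (by norm_num)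
  · rw [Ideal.span_singleton_pow, Ideal.mem_span_singleton, X_pow_dvd_iff]
    intro h
    have := h 1 (by norm_num)
    rw [cubicPoly, coeff_sub, coeff_X_pow, if_neg (by norm_num), zero_sub, coeff_C_zero] at this
    simp [coeff_X_pow] at this

/-- The ring `R[u, v] / (u³ - v² - v)`. -/
abbrev CubicRing (R : Type*) [CommRing R] : Type _ := AdjoinRoot (cubicPoly R)

theorem cubicRing_root_pow (R : Type*) [CommRing R] : AdjoinRoot.root (cubicPoly R) ^ 3 =
    AdjoinRoot.of (cubicPoly R) X ^ 2 + AdjoinRoot.of (cubicPoly R) X := by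
  have h : (cubicPoly R).eval₂ (AdjoinRoot.of _) (AdjoinRoot.root (cubicPoly R)) = 0 :=
    AdjoinRoot.eval₂_root (cubicPoly R)
  conv_lhs at h => enter [3]; rw [cubicPoly]
  rwa [eval₂_sub, eval₂_X_pow, eval₂_C, sub_eq_zero, map_add, map_pow] at h

/-- The ring embeds in its analogue over the fraction field: since the polynomial is monic,
divisibility over the larger ring descends. -/
theorem cubicRing_isDomain (R : Type*) [CommRing R] [IsDomain R] : IsDomain (CubicRing R) := by
  let K := FractionRing R
  have := AdjoinRoot.isDomain_of_prime (cubicPoly_prime K)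
  let f : R[X] →+* K[X] := mapRingHom (algebraMap R K)
  have hf : Function.Injective f := map_injective _ (IsFractionRing.injective R K)
  have h : cubicPoly K ∣ (cubicPoly R).map f := (cubicPoly_map _).symm.dvd
  refine Function.Injective.isDomain (AdjoinRoot.map f _ _ h) ?_
  rw [injective_iff_map_eq_zero]
  intro a ha
  obtain ⟨p, rfl⟩ := AdjoinRoot.mk_surjective a
  have h1 : AdjoinRoot.mk (cubicPoly K) (p.map f) = 0 := by
    rw [← ha, AdjoinRoot.map, AdjoinRoot.lift_mk, ← eval₂_map, ← AdjoinRoot.aeval_eq]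
    rfl
  rw [AdjoinRoot.mk_eq_zero, ← cubicPoly_map (algebraMap R K)] at h1
  rw [AdjoinRoot.mk_eq_zero]
  exact (map_dvd_map f hf (cubicPoly_monic R)).mp h1

/-- The homomorphism out of `R[u, v] / (u³ - v² - v)` determined by the images of `u` and `v`. -/
def cubicLift (φ : R →+* P) {u v : P} (h : u ^ 3 = v ^ 2 + v) : CubicRing R →+* P :=
  AdjoinRoot.lift (eval₂RingHom φ v) u (by
    rw [cubicPoly, eval₂_sub, eval₂_X_pow, eval₂_C, h]
    simp)

theorem cubicLift_root (φ : R →+* P) {u v : P} (h : u ^ 3 = v ^ 2 + v) :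
    cubicLift φ h (AdjoinRoot.root _) = u := AdjoinRoot.lift_root _

theorem cubicLift_of (φ : R →+* P) {u v : P} (h : u ^ 3 = v ^ 2 + v) (p : R[X]) :
    cubicLift φ h (AdjoinRoot.of _ p) = p.eval₂ φ v := AdjoinRoot.lift_of _

theorem cubicRing_hom_ext {f g : CubicRing R →+* P}
    (h : ∀ r, f (AdjoinRoot.of _ (C r)) = g (AdjoinRoot.of _ (C r)))
    (hu : f (AdjoinRoot.root _) = g (AdjoinRoot.root _))
    (hv : f (AdjoinRoot.of _ X) = g (AdjoinRoot.of _ X)) : f = g :=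
  AdjoinRoot.ringHom_ext (Polynomial.ringHom_ext h hv) hu

/-- The homomorphism `φ : R → P` together with `u, v ∈ P` identifies `P` with
`R[u, v] / (u³ - v² - v)`. -/
structure IsCubicExt (φ : R →+* P) (u v : P) : Prop where
  eq : u ^ 3 = v ^ 2 + v
  bijective : Function.Bijective (cubicLift φ eq)

variable {φ : R →+* P} {u v : P}

theorem IsCubicExt.isDomain [IsDomain R] (h : IsCubicExt φ u v) : IsDomain P :=
  have := cubicRing_isDomain R
  (RingEquiv.ofBijective _ h.bijective).symm.injective.isDomain
    (RingEquiv.ofBijective _ h.bijective).symm.toRingHom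

theorem IsCubicExt.eval₂_injective [IsDomain R] (h : IsCubicExt φ u v) :
    Function.Injective (eval₂RingHom φ v) := by
  have h1 : Function.Injective (AdjoinRoot.of (cubicPoly R)) := by
    refine AdjoinRoot.of.injective_of_degree_ne_zero ?_
    rw [cubicPoly, degree_X_pow_sub_C (by norm_num)]
    norm_num
  have h2 := h.bijective.1.comp h1
  intro a b hab
  refine h2 ?_
  simpa [cubicLift_of] using hab

/-- Induction step for algebraic independence: the new `v` is transcendental over `R`, and it is
placed at index 0 to match `finSuccEquiv`. -/
theorem IsCubicExt.eval₂Hom_injective [IsDomain R] (h : IsCubicExt φ u v) {k : Type*} [CommRing k]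
    {c : k →+* R} {n : ℕ} {x : Fin n → R}
    (hx : Function.Injective (MvPolynomial.eval₂Hom c x)) :
    Function.Injective (MvPolynomial.eval₂Hom (φ.comp c)
      (Fin.cons v fun i ↦ φ (x i) : Fin (n + 1) → P)) := by
  have h1 : MvPolynomial.eval₂Hom (φ.comp c) (Fin.cons v fun i ↦ φ (x i) : Fin (n + 1) → P) =
      ((eval₂RingHom φ v).comp (mapRingHom (MvPolynomial.eval₂Hom c x))).comp
        (MvPolynomial.finSuccEquiv k n : MvPolynomial (Fin (n + 1)) k →+* _) := by
    refine MvPolynomial.ringHom_ext (fun c ↦ ?_) fun i ↦ ?_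
    · simp [MvPolynomial.finSuccEquiv_apply]
    · cases i using Fin.cases <;> simp [MvPolynomial.finSuccEquiv_apply]
  rw [h1]
  exact (h.eval₂_injective.comp (map_injective _ hx)).comp (MvPolynomial.finSuccEquiv k n).injective

theorem IsCubicExt.eq_top (h : IsCubicExt φ u v) (T : Subring P) (hφ : ∀ r, φ r ∈ T)
    (hu : u ∈ T) (hv : v ∈ T) : T = ⊤ := by
  rw [eq_top_iff]
  intro x _
  obtain ⟨a, rfl⟩ := h.bijective.2 x
  obtain ⟨p, rfl⟩ := AdjoinRoot.mk_surjective a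
  have hq (q : R[X]) : q.eval₂ φ v ∈ T := by
    rw [eval₂_eq_sum_range]
    exact sum_mem fun i _ ↦ mul_mem (hφ _) (pow_mem hv _)
  rw [cubicLift, AdjoinRoot.lift_mk, eval₂_eq_sum_range]
  exact sum_mem fun i _ ↦ mul_mem (hq _) (pow_mem hu _)

/-- If the maps into `P` are determined by their values on `R`, `u` and `v`, and `R[u, v]` is a
retract of `P`, then `P` is `R[u, v]`. -/
theorem IsCubicExt.of_retraction (e : u ^ 3 = v ^ 2 + v) (ψ : P →+* CubicRing R)
    (hφ : ∀ r, ψ (φ r) = AdjoinRoot.of _ (C r)) (hu : ψ u = AdjoinRoot.root _)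
    (hv : ψ v = AdjoinRoot.of _ X) (h : ∀ x, cubicLift φ e (ψ x) = x) : IsCubicExt φ u v := by
  have h1 : ψ.comp (cubicLift φ e) = RingHom.id _ := by
    refine cubicRing_hom_ext ?_ ?_ ?_
    · intro r
      simp [cubicLift_of, hφ]
    · simp [cubicLift_root, hu]
    · simp [cubicLift_of, hv]
  exact ⟨e, ⟨Function.LeftInverse.injective (g := ψ) fun x ↦ congr($h1 x),
    fun x ↦ ⟨_, h x⟩⟩⟩

/-- The presentation is stable under base change. The universal property of the pushout supplies the
inverse, a map to `CubicRing R`, so no tensor product has to be computed. -/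
theorem IsCubicExt.of_isPushout {k A R P : CommRingCat.{u}} {a : k ⟶ A} {b : k ⟶ R} {f : A ⟶ P}
    {g : R ⟶ P} (H : IsPushout a b f g) {u v : A} (h : IsCubicExt a.hom u v) :
    IsCubicExt g.hom (f u) (f v) := by
  have e : f u ^ 3 = f v ^ 2 + f v := by rw [← map_pow, h.eq, map_add, map_pow]
  let r : R ⟶ .of (CubicRing R) := CommRingCat.ofHom ((AdjoinRoot.of (cubicPoly R)).comp C)
  let E := RingEquiv.ofBijective _ h.bijective
  have hEu : E.symm u = AdjoinRoot.root _ := by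
    rw [RingEquiv.symm_apply_eq]
    exact (cubicLift_root _ h.eq).symm
  have hEv : E.symm v = AdjoinRoot.of _ X := by
    rw [RingEquiv.symm_apply_eq]
    exact ((cubicLift_of _ h.eq _).trans (eval₂_X _ _)).symm
  have hEc (c : k) : E.symm (a c) = AdjoinRoot.of _ (C c) := by
    rw [RingEquiv.symm_apply_eq]
    exact ((cubicLift_of _ h.eq _).trans (eval₂_C _ _)).symm
  let s : A ⟶ .of (CubicRing R) := CommRingCat.ofHom
    ((cubicLift (r.hom.comp b.hom) (cubicRing_root_pow R)).comp E.symm.toRingHom)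
  have hsu : s u = AdjoinRoot.root _ :=
    (congrArg _ hEu).trans (cubicLift_root _ (cubicRing_root_pow R))
  have hsv : s v = AdjoinRoot.of _ X :=
    (congrArg _ hEv).trans ((cubicLift_of _ (cubicRing_root_pow R) _).trans (eval₂_X _ _))
  have hw : a ≫ s = b ≫ r := by
    ext c
    exact (congrArg _ (hEc c)).trans ((cubicLift_of _ (cubicRing_root_pow R) _).trans (eval₂_C _ _))
  let ψ : P ⟶ .of (CubicRing R) := H.desc s r hw
  have hψg : g ≫ ψ = r := H.inr_desc _ _ _
  have hψf : f ≫ ψ = s := H.inl_desc _ _ _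
  have hψu : ψ (f u) = AdjoinRoot.root _ := congr($hψf u).trans hsu
  have hψv : ψ (f v) = AdjoinRoot.of _ X := congr($hψf v).trans hsv
  refine .of_retraction e ψ.hom (fun x ↦ congr($hψg x)) hψu hψv ?_
  have h1 : ψ ≫ CommRingCat.ofHom (cubicLift g.hom e) = 𝟙 P := by
    refine H.hom_ext ?_ ?_
    · rw [reassoc_of% hψf, Category.comp_id]
      have h2 : ((s ≫ CommRingCat.ofHom (cubicLift g.hom e)).hom.comp E.toRingHom) =
          f.hom.comp E.toRingHom := by
        refine cubicRing_hom_ext ?_ ?_ ?_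
        · intro c
          have : E (AdjoinRoot.of _ (C c)) = a c := by
            rw [← hEc, E.apply_symm_apply]
          change cubicLift g.hom e (s (E _)) = f (E _)
          rw [this]
          have h3 : s (a c) = r (b c) := congr($hw c)
          have h4 : f (a c) = g (b c) := congr($(H.w) c)
          rw [h3, h4]
          exact (cubicLift_of _ _ _).trans (eval₂_C _ _)
        · change cubicLift g.hom e (s (E _)) = f (E _)
          rw [← hEu, E.apply_symm_apply, hsu]
          exact cubicLift_root _ _
        · change cubicLift g.hom e (s (E _)) = f (E _)
          rw [← hEv, E.apply_symm_apply, hsv]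
          exact (cubicLift_of _ _ _).trans (eval₂_X _ _)
      ext x
      have := congr($h2 (E.symm x))
      simpa using this
    · rw [reassoc_of% hψg, Category.comp_id]
      ext x
      exact (cubicLift_of _ e _).trans (eval₂_C _ _)
  intro x
  exact congr($h1 x)

end CubicExtension

end CubicQuotient

end

noncomputable section

namespace CubicQuotient

/-! ### The two affine charts of the curve -/

theorem IsCubicExt.comp_equiv {R P Q : Type*} [CommRing R] [CommRing P] [CommRing Q]
    {φ : R →+* P} {u v : P} (h : IsCubicExt φ u v) (E : P ≃+* Q) :
    IsCubicExt (E.toRingHom.comp φ) (E u) (E v) := by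
  have e : E u ^ 3 = E v ^ 2 + E v := by rw [← map_pow, h.eq, map_add, map_pow]
  have : cubicLift (E.toRingHom.comp φ) e = E.toRingHom.comp (cubicLift φ h.eq) := by
    refine cubicRing_hom_ext ?_ ?_ ?_ <;> simp [cubicLift_of, cubicLift_root]
  exact ⟨e, by rw [this]; exact E.bijective.comp h.bijective⟩

/-- Compares a form of degree `n` with its dehomogenization, `w` being the inverse of the inverted
coordinate. -/
theorem eval₂_mul_of_isHomogeneous {σ R S : Type*} [CommRing R] [CommRing S]
    {p : MvPolynomial σ R} {n : ℕ} (hp : p.IsHomogeneous n) (f : R →+* S) (g : σ → S) (w : S) :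
    p.eval₂ f (fun i ↦ g i * w) = p.eval₂ f g * w ^ n := by
  rw [MvPolynomial.eval₂_eq, MvPolynomial.eval₂_eq, Finset.sum_mul]
  refine Finset.sum_congr rfl fun d hd ↦ ?_
  rw [hp.degree_eq_sum_deg_support hd, ← Finset.prod_pow_eq_pow_sum, mul_assoc,
    ← Finset.prod_mul_distrib]
  simp only [mul_pow]

section Charts

variable (k : Type u) [Field k]

theorem homCoord_pow_three : homCoord k 0 ^ 3 =
    homCoord k 1 ^ 2 * homCoord k 2 + homCoord k 1 * homCoord k 2 ^ 2 := by
  have h : Ideal.Quotient.mk (Ideal.span {cubicForm k}) (cubicForm k) = 0 :=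
    Ideal.Quotient.eq_zero_iff_mem.mpr (Ideal.mem_span_singleton_self _)
  rw [← sub_eq_zero, ← neg_eq_zero, ← h]
  conv_rhs => enter [2]; rw [cubicForm_eq]
  simp only [homCoord, map_sub, map_add, map_mul, map_pow]
  ring

/-- The equation of the curve is symmetric in `Y` and `Z`. -/
theorem homCoord_pow_three' (s : Fin 2) : homCoord k 0 ^ 3 =
    homCoord k s.rev.succ ^ 2 * homCoord k s.succ +
      homCoord k s.rev.succ * homCoord k s.succ ^ 2 := by
  rw [homCoord_pow_three]
  fin_cases s
  · change homCoord k 1 ^ 2 * homCoord k 2 + homCoord k 1 * homCoord k 2 ^ 2 =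
      homCoord k 2 ^ 2 * homCoord k 1 + homCoord k 2 * homCoord k 1 ^ 2
    ring
  · rfl

/-- The coordinate `X i / T` in the ring of the chart `T ≠ 0`, where `T` is `Y` for `s = 0` and `Z`
for `s = 1`. -/
def awayCoord (s : Fin 2) (i : Fin 3) :
    HomogeneousLocalization.Away (homGrading k) (homCoord k s.succ) :=
  HomogeneousLocalization.Away.mk (homGrading k) (homCoord_mem k s.succ) 1 (homCoord k i)
    (homCoord_mem k i)

/-- The constants in the ring of a chart. -/
def awayConst (s : Fin 2) :
    k →+* HomogeneousLocalization.Away (homGrading k) (homCoord k s.succ) :=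
  (HomogeneousLocalization.fromZeroRingHom (homGrading k) _).comp (algebraMap k (homGrading k 0))

theorem val_awayConst (s : Fin 2) (c : k) : (awayConst k s c).val =
    algebraMap (HomCoordRing k) (Localization.Away (homCoord k s.succ))
      (algebraMap k (HomCoordRing k) c) :=
  (HomogeneousLocalization.val_mk _).trans (Localization.mk_one_eq_algebraMap _)

theorem val_awayMk (s : Fin 2) (n : ℕ) (p : HomCoordRing k) (hp : p ∈ homGrading k (n • 1)) :
    (HomogeneousLocalization.Away.mk (homGrading k) (homCoord_mem k s.succ) n p hp).val =
    algebraMap _ (Localization.Away (homCoord k s.succ)) p *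
      IsLocalization.Away.invSelf (homCoord k s.succ) ^ n := by
  rw [HomogeneousLocalization.Away.val_mk, Localization.mk_eq_mk', IsLocalization.mk'_eq_iff_eq_mul,
    mul_assoc, map_pow, ← mul_pow, mul_comm (IsLocalization.Away.invSelf _),
    IsLocalization.Away.mul_invSelf, one_pow, mul_one]

theorem val_awayCoord (s : Fin 2) (i : Fin 3) : (awayCoord k s i).val =
    algebraMap _ (Localization.Away (homCoord k s.succ)) (homCoord k i) *
      IsLocalization.Away.invSelf (homCoord k s.succ) := by
  rw [awayCoord, val_awayMk, pow_one]

theorem awayCoord_self (s : Fin 2) : awayCoord k s s.succ = 1 := by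
  apply HomogeneousLocalization.val_injective
  rw [val_awayCoord, IsLocalization.Away.mul_invSelf, HomogeneousLocalization.val_one]

/-- Divide the homogeneous equation by the cube of the inverted coordinate `s.succ`. By the symmetry
in `Y` and `Z` both charts acquire the same equation, with `s.rev.succ` the index of the remaining
coordinate. -/
theorem awayCoord_eq (s : Fin 2) :
    awayCoord k s 0 ^ 3 = awayCoord k s s.rev.succ ^ 2 + awayCoord k s s.rev.succ := by
  apply HomogeneousLocalization.val_injective
  simp only [HomogeneousLocalization.val_pow, HomogeneousLocalization.val_add, val_awayCoord]
  have h1 := congrArg (algebraMap _ (Localization.Away (homCoord k s.succ)))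
    (homCoord_pow_three' k s)
  have h2 := IsLocalization.Away.mul_invSelf (S := Localization.Away (homCoord k s.succ))
    (homCoord k s.succ)
  simp only [map_pow, map_add, map_mul] at h1
  generalize IsLocalization.Away.invSelf (S := Localization.Away (homCoord k s.succ))
    (homCoord k s.succ) = w at h2 ⊢
  generalize algebraMap _ (Localization.Away (homCoord k s.succ)) (homCoord k s.succ) = t at h1 h2 ⊢
  generalize algebraMap _ (Localization.Away (homCoord k s.succ)) (homCoord k 0) = x at h1 h2 ⊢
  generalize algebraMap _ (Localization.Away (homCoord k s.succ)) (homCoord k s.rev.succ) = y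
    at h1 h2 ⊢
  linear_combination w ^ 3 * h1 + (y ^ 2 * w ^ 2 + y * w * (t * w + 1)) * h2

/-- The affine coordinates corresponding to the homogeneous ones in the chart `s`. -/
def dehomCoord (s : Fin 2) : Fin 3 → CubicRing k :=
  fun i ↦ if i = 0 then AdjoinRoot.root _ else if i = s.succ then 1 else
    AdjoinRoot.of _ Polynomial.X

theorem dehomCoord_zero (s : Fin 2) : dehomCoord k s 0 = AdjoinRoot.root _ := if_pos rfl

theorem dehomCoord_succ (s : Fin 2) : dehomCoord k s s.succ = 1 := by
  rw [dehomCoord, if_neg (Fin.succ_ne_zero s), if_pos rfl]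

theorem dehomCoord_rev (s : Fin 2) :
    dehomCoord k s s.rev.succ = AdjoinRoot.of _ Polynomial.X := by
  rw [dehomCoord, if_neg (Fin.succ_ne_zero _), if_neg]
  fin_cases s <;> decide

/-- The homomorphism from the homogeneous coordinate ring to the ring of a chart. -/
def dehom (s : Fin 2) : HomCoordRing k →+* CubicRing k :=
  Ideal.Quotient.lift _ (MvPolynomial.eval₂Hom ((AdjoinRoot.of _).comp Polynomial.C)
    (dehomCoord k s)) (by
      intro a ha
      obtain ⟨b, rfl⟩ := Ideal.mem_span_singleton.mp ha
      have h : dehomCoord k s 1 ^ 2 * dehomCoord k s 2 + dehomCoord k s 1 * dehomCoord k s 2 ^ 2 =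
          dehomCoord k s 0 ^ 3 := by
        rw [dehomCoord_zero, cubicRing_root_pow]
        have h1 := dehomCoord_succ k s
        have h2 := dehomCoord_rev k s
        fin_cases s
        · change dehomCoord k 0 1 = 1 at h1
          change dehomCoord k 0 2 = _ at h2
          simp only [Fin.zero_eta, h1, h2]
          ring
        · change dehomCoord k 1 2 = 1 at h1
          change dehomCoord k 1 1 = _ at h2
          simp only [Fin.mk_one, h1, h2]
          ring
      rw [map_mul, cubicForm_eq]
      simp [h])

theorem dehom_mk (s : Fin 2) (p : MvPolynomial (Fin 3) k) :
    dehom k s (Ideal.Quotient.mk _ p) =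
      p.eval₂ ((AdjoinRoot.of _).comp Polynomial.C) (dehomCoord k s) := rfl

theorem dehom_homCoord (s : Fin 2) (i : Fin 3) : dehom k s (homCoord k i) = dehomCoord k s i :=
  (dehom_mk k s _).trans (MvPolynomial.eval₂_X _ _ _)

/-- The homomorphism from the chart ring to `k[u, v] / (u³ - v² - v)`. -/
def awayToCubicRing (s : Fin 2) :
    HomogeneousLocalization.Away (homGrading k) (homCoord k s.succ) →+* CubicRing k :=
  (IsLocalization.Away.lift (S := Localization.Away (homCoord k s.succ)) (homCoord k s.succ)
    (g := dehom k s) (by rw [dehom_homCoord, dehomCoord_succ]; exact isUnit_one)).comp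
    (algebraMap _ _)

/-- The inverted coordinate goes to 1, so only the numerator of a fraction matters. -/
theorem awayToCubicRing_eq (s : Fin 2)
    (x : HomogeneousLocalization.Away (homGrading k) (homCoord k s.succ)) (p : HomCoordRing k)
    (n : ℕ) (h : x.val = algebraMap _ (Localization.Away (homCoord k s.succ)) p *
      IsLocalization.Away.invSelf (homCoord k s.succ) ^ n) :
    awayToCubicRing k s x = dehom k s p := by
  have hu : IsUnit (dehom k s (homCoord k s.succ)) := by
    rw [dehom_homCoord, dehomCoord_succ]; exact isUnit_one
  let L := IsLocalization.Away.lift (S := Localization.Away (homCoord k s.succ))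
    (homCoord k s.succ) (g := dehom k s) hu
  have h1 (a) : L (algebraMap _ _ a) = dehom k s a := IsLocalization.Away.lift_eq _ hu a
  have h2 : L (IsLocalization.Away.invSelf (homCoord k s.succ)) = 1 := by
    have := congrArg L (IsLocalization.Away.mul_invSelf
      (S := Localization.Away (homCoord k s.succ)) (homCoord k s.succ))
    rwa [map_mul, h1, dehom_homCoord, dehomCoord_succ, one_mul, map_one] at this
  change L x.val = _
  rw [h, map_mul, h1, map_pow, h2, one_pow, mul_one]

/-- The ring of either chart is `k[u, v] / (u³ - v² - v)`. -/
theorem isCubicExt_awayCoord (s : Fin 2) :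
    IsCubicExt (awayConst k s) (awayCoord k s 0) (awayCoord k s s.rev.succ) := by
  refine .of_retraction (awayCoord_eq k s) (awayToCubicRing k s) ?_ ?_ ?_ ?_
  · intro r
    rw [awayToCubicRing_eq k s _ (algebraMap k _ r) 0 (by rw [pow_zero, mul_one, val_awayConst])]
    exact (dehom_mk k s (MvPolynomial.C r)).trans (MvPolynomial.eval₂_C _ _ _)
  · rw [awayToCubicRing_eq k s _ _ 1 (by rw [pow_one, val_awayCoord]), dehom_homCoord,
      dehomCoord_zero]
  · rw [awayToCubicRing_eq k s _ _ 1 (by rw [pow_one, val_awayCoord]), dehom_homCoord,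
      dehomCoord_rev]
  · intro x
    obtain ⟨n, a, ha, rfl⟩ := HomogeneousLocalization.Away.mk_surjective
      (homGrading k) (homCoord_mem k s.succ) x
    obtain ⟨p, hp, hpa⟩ := id ha
    have hpa' : a = Ideal.Quotient.mk _ p := hpa.symm
    rw [awayToCubicRing_eq k s _ _ n (val_awayMk k s n _ _)]
    let θ := (algebraMap (HomogeneousLocalization.Away (homGrading k) (homCoord k s.succ))
      (Localization.Away (homCoord k s.succ))).comp (cubicLift (awayConst k s) (awayCoord_eq k s))
    apply HomogeneousLocalization.val_injective
    change θ (dehom k s a) = _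
    have hθ (i : Fin 3) : θ (dehomCoord k s i) =
        algebraMap _ (Localization.Away (homCoord k s.succ)) (homCoord k i) *
        IsLocalization.Away.invSelf (homCoord k s.succ) := by
      rw [← val_awayCoord]
      refine congrArg HomogeneousLocalization.val
        (a₁ := cubicLift (awayConst k s) (awayCoord_eq k s) (dehomCoord k s i)) ?_
      have hi : i = 0 ∨ i = s.succ ∨ i = s.rev.succ := by
        revert i s; decide
      obtain rfl | rfl | rfl := hi
      · rw [dehomCoord_zero, cubicLift_root]
      · rw [dehomCoord_succ, map_one, awayCoord_self]
      · rw [dehomCoord_rev, cubicLift_of, Polynomial.eval₂_X]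
    have hp' : p.IsHomogeneous n := by
      have : p.IsHomogeneous (n • 1) := hp
      rwa [smul_eq_mul, mul_one] at this
    refine Eq.trans ?_ (val_awayMk k s n _ _).symm
    rw [hpa', dehom_mk, MvPolynomial.hom_eval₂]
    simp only [hθ]
    -- Homogeneity of degree `n` collects the denominators of the `Xᵢ / T` into the required `1 /
    -- Tⁿ`.
    rw [eval₂_mul_of_isHomogeneous hp']
    congr 1
    change _ = ((algebraMap _ (Localization.Away (homCoord k s.succ))).comp
      (Ideal.Quotient.mk (Ideal.span {cubicForm k}))) p
    have h1 : MvPolynomial.eval₂Hom (θ.comp ((AdjoinRoot.of _).comp Polynomial.C))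
        (fun i ↦ algebraMap _ (Localization.Away (homCoord k s.succ)) (homCoord k i)) =
        (algebraMap _ (Localization.Away (homCoord k s.succ))).comp
          (Ideal.Quotient.mk (Ideal.span {cubicForm k})) := by
      refine MvPolynomial.ringHom_ext ?_ ?_
      · intro r
        rw [MvPolynomial.eval₂Hom_C]
        refine Eq.trans ?_ (val_awayConst k s r)
        refine congrArg HomogeneousLocalization.val
          (a₁ := cubicLift (awayConst k s) (awayCoord_eq k s) (AdjoinRoot.of _ (Polynomial.C r))) ?_
        rw [cubicLift_of, Polynomial.eval₂_C]
      · intro i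
        rw [MvPolynomial.eval₂Hom_X']
        rfl
    exact congr($h1 p)

end Charts

end CubicQuotient

end

noncomputable section

namespace CubicQuotient

/-! ### Sections over the two charts and the action of `τ` on them. -/

section ChartSections

variable (k : Type u) [Field k]

/-- The affine charts `Y ≠ 0` (for `s = 0`) and `Z ≠ 0` (for `s = 1`) of the curve. -/
def chart (s : Fin 2) : (curveE k).left.Opens := Proj.basicOpen (homGrading k) (homCoord k s.succ)

theorem isAffineOpen_chart (s : Fin 2) : IsAffineOpen (chart k s) :=
  Proj.isAffineOpen_basicOpen _ _ (homCoord_mem k s.succ) one_pos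

/-- The coordinate functions on the charts of the curve. -/
def chartCoord (s : Fin 2) (i : Fin 3) : Γ((curveE k).left, chart k s) :=
  (Proj.awayToSection (homGrading k) (homCoord k s.succ)).hom (awayCoord k s i)

theorem awayConst_awayToSection (s : Fin 2) :
    CommRingCat.ofHom (awayConst k s) ≫ Proj.awayToSection (homGrading k) (homCoord k s.succ) =
      scalars (curveE k).hom (chart k s) := by
  have h1 := toSpecΓ_scalars (curveE k).hom (chart k s)
  have h2 : (chart k s).ι =
      Proj.basicOpenToSpec (homGrading k) (homCoord k s.succ) ≫
        Proj.awayι (homGrading k) (homCoord k s.succ) (homCoord_mem k s.succ) one_pos := by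
    rw [← Proj.basicOpenIsoSpec_hom _ _ (homCoord_mem k s.succ) one_pos, Proj.awayι,
      Iso.hom_inv_id_assoc]
    rfl
  have h3 : (chart k s).ι ≫ (curveE k).hom = (chart k s).toSpecΓ ≫
      Spec.map (Proj.awayToSection (homGrading k) (homCoord k s.succ)) ≫
        Spec.map (CommRingCat.ofHom (awayConst k s)) := by
    rw [h2]
    change (Proj.basicOpenToSpec (homGrading k) (homCoord k s.succ) ≫
        Proj.awayι (homGrading k) (homCoord k s.succ) (homCoord_mem k s.succ) one_pos) ≫
        structE k = _
    rw [structE, Category.assoc, Proj.awayι_toSpecZero_assoc, Proj.basicOpenToSpec,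
      Category.assoc, ← Spec.map_comp _ (CommRingCat.ofHom _)]
    rfl
  have : IsIso (chart k s).toSpecΓ := (isAffineOpen_chart k s).isoSpec.isIso_hom
  rw [h3, cancel_epi] at h1
  exact (Spec.map_injective (h1.trans (Spec.map_comp _ _).symm)).symm

theorem awayToSection_awayConst (s : Fin 2) (c : k) :
    Proj.awayToSection (homGrading k) (homCoord k s.succ) (awayConst k s c) =
      scalars (curveE k).hom (chart k s) c := congr($(awayConst_awayToSection k s) c)

/-- The ring of functions on either chart is `k[u, v] / (u³ - v² - v)`. -/
theorem isCubicExt_chart (s : Fin 2) : IsCubicExt (scalars (curveE k).hom (chart k s)).hom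
    (chartCoord k s 0) (chartCoord k s s.rev.succ) := by
  have h := (isCubicExt_awayCoord k s).comp_equiv
    (Proj.basicOpenIsoAway (homGrading k) (homCoord k s.succ) (homCoord_mem k s.succ)
      one_pos).commRingCatIsoToRingEquiv
  rw [← awayConst_awayToSection]
  exact h

/-- Where `Y` and `Z` vanish, the equation forces `X³ = 0`; such a prime would contain the
irrelevant ideal. -/
theorem chart_sup : chart k 0 ⊔ chart k 1 = ⊤ := by
  rw [eq_top_iff]
  intro x _
  by_contra h
  have h1 : x ∉ chart k 0 := fun h' ↦ h (Or.inl h')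
  have h2 : x ∉ chart k 1 := fun h' ↦ h (Or.inr h')
  let p : ProjectiveSpectrum (homGrading k) := x
  have h1' : homCoord k 1 ∈ p.asHomogeneousIdeal := not_not.mp h1
  have h2' : homCoord k 2 ∈ p.asHomogeneousIdeal := not_not.mp h2
  have h3 : homCoord k 0 ∈ p.asHomogeneousIdeal := by
    refine p.isPrime.mem_of_pow_mem 3 ?_
    rw [homCoord_pow_three]
    exact add_mem (Ideal.mul_mem_left _ _ h2') (Ideal.mul_mem_right _ _ h1')
  refine p.not_irrelevant_le ?_
  rw [HomogeneousIdeal.irrelevant_le]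
  rintro i hi _ ⟨q, hq, rfl⟩
  have hq' : q.IsHomogeneous i := hq
  change Ideal.Quotient.mk _ q ∈ p.asHomogeneousIdeal.toIdeal
  rw [q.as_sum, map_sum]
  refine sum_mem fun d hd ↦ ?_
  rw [MvPolynomial.monomial_eq, map_mul]
  refine Ideal.mul_mem_left _ _ ?_
  have hd' := hq'.degree_eq_sum_deg_support hd
  obtain ⟨j, hj⟩ : ∃ j, j ∈ d.support := by
    rw [← Finset.Nonempty, Finset.nonempty_iff_ne_empty]
    intro h
    rw [h, Finset.sum_empty] at hd'
    omega
  rw [Finsupp.prod, map_prod]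
  refine Ideal.prod_mem _ hj ?_
  rw [map_pow]
  refine Ideal.pow_mem_of_mem _ ?_ _ (Nat.pos_of_ne_zero (Finsupp.mem_support_iff.mp hj))
  change homCoord k j ∈ p.asHomogeneousIdeal
  fin_cases j
  exacts [h3, h1', h2']

theorem exists_mem_chart (x : (curveE k).left) : ∃ s, x ∈ chart k s := by
  have : x ∈ chart k 0 ⊔ chart k 1 := chart_sup k ▸ trivial
  exact this.elim (fun h ↦ ⟨0, h⟩) fun h ↦ ⟨1, h⟩

variable {k}
variable (ζ : k) (hζ : ζ ^ 3 = 1)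

theorem scaleGraded_homCoord_zero : scaleGraded ζ hζ (homCoord k 0) =
    algebraMap k _ ζ * homCoord k 0 := by
  refine (scaleRing_mk ζ hζ _).trans ?_
  rw [scalePoly, MvPolynomial.aeval_X]
  exact map_mul _ _ _

theorem scaleGraded_homCoord_succ (s : Fin 2) :
    scaleGraded ζ hζ (homCoord k s.succ) = homCoord k s.succ := by
  refine (scaleRing_mk ζ hζ _).trans ?_
  rw [scalePoly, MvPolynomial.aeval_X]
  fin_cases s <;> rfl

/-- The image of `a` is a separate variable `b` because the coordinates `Y`, `Z` are fixed only up
to a propositional equality. -/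
theorem appLE_awayToSection {a b : HomCoordRing k} (h : scaleGraded ζ hζ a = b)
    (ha : a ∈ homGrading k 1) (hb : b ∈ homGrading k 1) (hle) (n : ℕ) (x : HomCoordRing k) (hx) :
    (scaleHom ζ hζ).appLE (Proj.basicOpen (homGrading k) a) (Proj.basicOpen (homGrading k) b) hle
      (Proj.awayToSection (homGrading k) a (.mk _ ha n x hx)) =
    Proj.awayToSection (homGrading k) b
      (.mk _ hb n (scaleGraded ζ hζ x) ((scaleGraded ζ hζ).map_mem hx)) := by
  subst h
  have := Proj.awayToSection_comp_appLE (scaleGraded ζ hζ) (irrelevant_le_map_scaleGraded ζ hζ) ha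
  refine congr($this (.mk _ ha n x hx)).trans ?_
  exact congrArg (Proj.awayToSection (homGrading k) _)
    (HomogeneousLocalization.Away.map_mk (scaleGraded ζ hζ) a ha n x hx)

theorem tau_preimage_chart (s : Fin 2) :
    (tau ζ hζ).hom.left ⁻¹ᵁ chart k s = chart k s := by
  change scaleHom ζ hζ ⁻¹ᵁ Proj.basicOpen _ _ = Proj.basicOpen _ _
  rw [scaleHom, Proj.map_preimage_basicOpen, scaleGraded_homCoord_succ]

theorem tau_appLE_zero (s : Fin 2) (h : chart k s ≤ (tau ζ hζ).hom.left ⁻¹ᵁ chart k s) :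
    (tau ζ hζ).hom.left.appLE (chart k s) (chart k s) h (chartCoord k s 0) =
      scalars (curveE k).hom (chart k s) ζ * chartCoord k s 0 := by
  refine (appLE_awayToSection ζ hζ (scaleGraded_homCoord_succ ζ hζ s) (homCoord_mem k s.succ)
    (homCoord_mem k s.succ) h 1 _ (homCoord_mem k 0)).trans ?_
  rw [← awayToSection_awayConst]
  refine Eq.trans ?_ (map_mul (Proj.awayToSection (homGrading k) (homCoord k s.succ)).hom
    (awayConst k s ζ) (awayCoord k s 0))
  refine congrArg (Proj.awayToSection (homGrading k) (homCoord k s.succ)) ?_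
  apply HomogeneousLocalization.val_injective
  rw [HomogeneousLocalization.val_mul, val_awayMk, val_awayConst, val_awayCoord,
    scaleGraded_homCoord_zero, map_mul, pow_one, mul_assoc]

theorem tau_appLE_succ (s t : Fin 2) (h : chart k s ≤ (tau ζ hζ).hom.left ⁻¹ᵁ chart k s) :
    (tau ζ hζ).hom.left.appLE (chart k s) (chart k s) h (chartCoord k s t.succ) =
      chartCoord k s t.succ := by
  refine (appLE_awayToSection ζ hζ (scaleGraded_homCoord_succ ζ hζ s) (homCoord_mem k s.succ)
    (homCoord_mem k s.succ) h 1 _ (homCoord_mem k t.succ)).trans ?_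
  refine congrArg (Proj.awayToSection (homGrading k) (homCoord k s.succ)) ?_
  apply HomogeneousLocalization.val_injective
  rw [val_awayMk, val_awayCoord, scaleGraded_homCoord_succ, pow_one]

end ChartSections

end CubicQuotient

end

noncomputable section

namespace CubicQuotient

/-! ### Affine charts of the product -/

/-- Functions on a product of affine schemes over `Spec R`. -/
theorem isPushout_scalars {R : CommRingCat.{u}} {P X Y : Scheme.{u}} {fst : P ⟶ X} {snd : P ⟶ Y}
    {f : X ⟶ Spec R} {g : Y ⟶ Spec R} (H : IsPullback fst snd f g) {U : X.Opens} {V : Y.Opens}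
    (hU : IsAffineOpen U) (hV : IsAffineOpen V) {W : P.Opens}
    (hW : W = fst ⁻¹ᵁ U ⊓ snd ⁻¹ᵁ V) :
    IsPushout (scalars f U) (scalars g V) (fst.appLE U W (hW.le.trans inf_le_left))
      (snd.appLE V W (hW.le.trans inf_le_right)) := by
  have h1 := (isIso_pushoutSection_iff H (US := ⊤) le_top le_top hW).mp
    (isIso_pushoutSection_of_isAffineOpen H le_top le_top hW (isAffineOpen_top _) hV hU)
  refine h1.of_iso (Scheme.ΓSpecIso R) (Iso.refl _) (Iso.refl _) (Iso.refl _) ?_ ?_ ?_ ?_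
  · rw [Iso.refl_hom, Category.comp_id, scalars, Iso.hom_inv_id_assoc]
    rfl
  · rw [Iso.refl_hom, Category.comp_id, scalars, Iso.hom_inv_id_assoc]
    rfl
  · rw [Iso.refl_hom, Category.comp_id, Iso.refl_hom, Category.id_comp]
  · rw [Iso.refl_hom, Category.comp_id, Iso.refl_hom, Category.id_comp]

theorem isAffineOpen_of_isPullback {R : CommRingCat.{u}} {P X Y : Scheme.{u}} {fst : P ⟶ X}
    {snd : P ⟶ Y} {f : X ⟶ Spec R} {g : Y ⟶ Spec R} (H : IsPullback fst snd f g) {U : X.Opens}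
    {V : Y.Opens} (hU : IsAffineOpen U) (hV : IsAffineOpen V) {W : P.Opens}
    (hW : W = fst ⁻¹ᵁ U ⊓ snd ⁻¹ᵁ V) : IsAffineOpen W := by
  have : IsAffine _ := hU
  have : IsAffine _ := hV
  have : IsAffine ((⊤ : (Spec R).Opens).toScheme) := isAffineOpen_top _
  exact .of_isIso (Scheme.Hom.isPullback_resLE H (US := ⊤) le_top le_top hW).isoPullback.hom

theorem eval₂Hom_injective_of_isEmpty {R A ι : Type*} [CommRing R] [CommRing A] [IsEmpty ι]
    {c : R →+* A} (hc : Function.Injective c) (x : ι → A) :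
    Function.Injective (MvPolynomial.eval₂Hom c x) := by
  intro p q hpq
  obtain ⟨a, rfl⟩ := MvPolynomial.C_surjective ι p
  obtain ⟨b, rfl⟩ := MvPolynomial.C_surjective ι q
  rw [MvPolynomial.eval₂Hom_C, MvPolynomial.eval₂Hom_C] at hpq
  rw [hc hpq]

section Product

variable (k : Type u) [Field k]

/-- The projection of `E₃ⁿ⁺¹` to its last `n` factors. -/
def tailE (n : ℕ) : powE k (n + 1) ⟶ powE k n := Pi.lift fun i ↦ projE k (n + 1) i.succ

theorem tailE_projE (n : ℕ) (i : Fin n) : tailE k n ≫ projE k n i = projE k (n + 1) i.succ :=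
  Pi.lift_π _ _

theorem powE_hom_ext {n : ℕ} {T : Over (Spec (.of k))} {f g : T ⟶ powE k n}
    (h : ∀ i, f ≫ projE k n i = g ≫ projE k n i) : f = g :=
  Pi.hom_ext _ _ h

/-- The splitting of the product into its first factor and the rest; the inductions on `n` below
rest on it. A binary product over `Spec k` is a fibre product of schemes. -/
theorem isPullback_powE (n : ℕ) :
    IsPullback (projE k (n + 1) 0).left (tailE k n).left (curveE k).hom (powE k n).hom := by
  let l {T : Over (Spec (.of k))} (f : T ⟶ curveE k) (g : T ⟶ powE k n) : T ⟶ powE k (n + 1) :=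
    Pi.lift (Fin.cons (α := fun _ ↦ (T ⟶ curveE k)) f fun i ↦ g ≫ projE k n i)
  have hl {T : Over (Spec (.of k))} (f : T ⟶ curveE k) (g : T ⟶ powE k n) (i : Fin (n + 1)) :
      l f g ≫ projE k (n + 1) i = Fin.cons (α := fun _ ↦ (T ⟶ curveE k)) f
        (fun i ↦ g ≫ projE k n i) i := Pi.lift_π _ _
  have hl0 {T : Over (Spec (.of k))} (f : T ⟶ curveE k) (g : T ⟶ powE k n) :
      l f g ≫ projE k (n + 1) 0 = f := hl f g 0
  have hls {T : Over (Spec (.of k))} (f : T ⟶ curveE k) (g : T ⟶ powE k n) (i : Fin n) :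
      l f g ≫ projE k (n + 1) i.succ = g ≫ projE k n i := hl f g i.succ
  refine Over.isPullback_of_binaryFan_isLimit (BinaryFan.mk (projE k (n + 1) 0) (tailE k n))
    (BinaryFan.isLimitMk (fun s ↦ l s.fst s.snd) (fun s ↦ hl0 _ _) (fun s ↦ ?_)
      fun s m h₁ h₂ ↦ ?_)
  · refine powE_hom_ext k fun i ↦ ?_
    rw [Category.assoc, tailE_projE]
    exact hls _ _ i
  · refine powE_hom_ext k fun i ↦ ?_
    cases i using Fin.cases with
    | zero => exact h₁.trans (hl0 _ _).symm
    | succ i =>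
      refine Eq.trans ?_ (hls _ _ i).symm
      rw [← tailE_projE, ← Category.assoc, h₂]

theorem isIso_powE_zero_hom : IsIso (powE k 0).hom := by
  let e : powE k 0 ≅ Over.mk (𝟙 (Spec (.of k))) :=
    { hom := Over.mkIdTerminal.from _
      inv := Pi.lift fun i : Fin 0 ↦ i.elim0
      hom_inv_id := powE_hom_ext k fun i ↦ i.elim0
      inv_hom_id := Over.mkIdTerminal.hom_ext _ _ }
  have h : e.hom.left = (powE k 0).hom := (Category.comp_id _).symm.trans (Over.w e.hom)
  rw [← h]
  have := e.isIso_hom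
  exact inferInstanceAs (IsIso ((Over.forget _).map e.hom))

variable {k}

/-- The affine chart of `E₃ⁿ` on which the `i`-th point lies in the chart `S i`. -/
def powChart {n : ℕ} (S : Fin n → Fin 2) : (powE k n).left.Opens :=
  ⟨{x | ∀ i, (projE k n i).left x ∈ chart k (S i)}, by
    rw [Set.ofPred_forall]
    exact isOpen_iInter_of_finite fun i ↦ ((projE k n i).left ⁻¹ᵁ chart k (S i)).2⟩

theorem powChart_le {n : ℕ} (S : Fin n → Fin 2) (i : Fin n) :
    powChart S ≤ (projE k n i).left ⁻¹ᵁ chart k (S i) := fun _ hx ↦ hx i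

theorem exists_mem_powChart {n : ℕ} (x : (powE k n).left) : ∃ S : Fin n → Fin 2, x ∈ powChart S := by
  choose S hS using fun i ↦ exists_mem_chart k ((projE k n i).left x)
  exact ⟨S, hS⟩

/-- The coordinate functions on the charts of `E₃ⁿ`. -/
def powCoord {n : ℕ} (S : Fin n → Fin 2) (i : Fin n) (j : Fin 3) :
    Γ((powE k n).left, powChart S) :=
  (projE k n i).left.appLE (chart k (S i)) (powChart S) (powChart_le S i) (chartCoord k (S i) j)

theorem tailE_projE_apply {n : ℕ} (i : Fin n) (x : (powE k (n + 1)).left) :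
    (projE k n i).left ((tailE k n).left x) = (projE k (n + 1) i.succ).left x := by
  rw [← tailE_projE]
  rfl

theorem powChart_succ {n : ℕ} (S : Fin (n + 1) → Fin 2) :
    powChart (k := k) S = (projE k (n + 1) 0).left ⁻¹ᵁ chart k (S 0) ⊓
      (tailE k n).left ⁻¹ᵁ powChart fun i ↦ S i.succ := by
  ext x
  refine Fin.forall_fin_succ.trans (and_congr_right fun _ ↦ forall_congr' fun i ↦ ?_)
  rw [tailE_projE_apply]

theorem tailE_appLE_powCoord {n : ℕ} (S : Fin (n + 1) → Fin 2) (i : Fin n) (j : Fin 3) (h) :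
    (tailE k n).left.appLE (powChart fun i ↦ S i.succ) (powChart S) h
      (powCoord (fun i ↦ S i.succ) i j) = powCoord S i.succ j := by
  have h1 : (tailE k n).left ≫ (projE k n i).left = (projE k (n + 1) i.succ).left :=
    congrArg CommaMorphism.left (tailE_projE k n i)
  rw [powCoord, ← CommRingCat.comp_apply, Scheme.Hom.appLE_comp_appLE, powCoord]
  simp only [h1]

/-- The chart of `E₃ⁿ⁺¹` is obtained from that of `E₃ⁿ` by adjoining a point of the curve. -/
theorem isCubicExt_powChart {n : ℕ} (S : Fin (n + 1) → Fin 2)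
    (h : IsAffineOpen (powChart (k := k) fun i ↦ S i.succ)) :
    IsCubicExt ((tailE k n).left.appLE (powChart fun i ↦ S i.succ) (powChart S)
      ((powChart_succ S).le.trans inf_le_right)).hom (powCoord S 0 0)
      (powCoord S 0 (S 0).rev.succ) :=
  .of_isPushout (isPushout_scalars (isPullback_powE k n) (isAffineOpen_chart k (S 0)) h
    (powChart_succ S)) (isCubicExt_chart k (S 0))

theorem isAffineOpen_powChart {n : ℕ} (S : Fin n → Fin 2) : IsAffineOpen (powChart (k := k) S) := by
  induction n with
  | zero =>
    have h : powChart (k := k) S = ⊤ := by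
      rw [eq_top_iff]
      exact fun x _ i ↦ i.elim0
    have := isIso_powE_zero_hom k
    have : IsAffine (powE k 0).left := .of_isIso (powE k 0).hom
    rw [h]
    exact isAffineOpen_top _
  | succ n ih =>
    exact isAffineOpen_of_isPullback (isPullback_powE k n) (isAffineOpen_chart k (S 0)) (ih _)
      (powChart_succ S)

theorem scalars_powChart_zero_bijective (S : Fin 0 → Fin 2) :
    Function.Bijective (scalars (powE k 0).hom (powChart S)) := by
  have h : powChart (k := k) S = ⊤ := by
    rw [eq_top_iff]
    exact fun x _ i ↦ i.elim0
  have := isIso_powE_zero_hom k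
  have h2 : IsIso (scalars (powE k 0).hom ⊤) := by
    have : (powE k 0).left.presheaf.map (homOfLE (le_top (a := ⊤))).op = 𝟙 _ :=
      (powE k 0).left.presheaf.map_id _
    let f : (powE k 0).left ⟶ Spec (.of k) := (powE k 0).hom
    have hf : IsIso f := isIso_powE_zero_hom k
    have h3 : IsIso f.appTop := inferInstanceAs (IsIso (f.app ⊤))
    rw [scalars, this, Category.comp_id]
    exact IsIso.comp_isIso' inferInstance h3
  rw [h]
  exact ConcreteCategory.bijective_of_isIso _

/-- Each factor is a cubic extension of the ring built so far, and `cubicRing_isDomain` holds over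
any domain, so no separate argument about geometric integrality of the curve is needed. -/
theorem isDomain_powChart {n : ℕ} (S : Fin n → Fin 2) :
    IsDomain Γ((powE k n).left, powChart S) := by
  induction n with
  | zero =>
    let e := RingEquiv.ofBijective (scalars (powE k 0).hom (powChart S)).hom
      (scalars_powChart_zero_bijective S)
    exact e.symm.injective.isDomain e.symm.toRingHom
  | succ n ih =>
    have := ih fun i ↦ S i.succ
    exact (isCubicExt_powChart S (isAffineOpen_powChart _)).isDomain

/-- The functions on a chart are the polynomials in the coordinates. -/
theorem powChart_eq_top {n : ℕ} (S : Fin n → Fin 2) (T : Subring Γ((powE k n).left, powChart S))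
    (h : ∀ c, scalars (powE k n).hom (powChart S) c ∈ T) (hu : ∀ i, powCoord S i 0 ∈ T)
    (hv : ∀ i, powCoord S i (S i).rev.succ ∈ T) : T = ⊤ := by
  induction n with
  | zero =>
    rw [eq_top_iff]
    intro x _
    obtain ⟨c, rfl⟩ := (scalars_powChart_zero_bijective S).2 x
    exact h c
  | succ n ih =>
    refine (isCubicExt_powChart S (isAffineOpen_powChart _)).eq_top T ?_ (hu 0) (hv 0)
    have hle := (powChart_succ (k := k) S).le.trans inf_le_right
    have h1 := ih (fun i ↦ S i.succ)
      (T.comap ((tailE k n).left.appLE (powChart fun i ↦ S i.succ) (powChart S) hle).hom) ?_ ?_ ?_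
    · intro r
      exact h1.ge (Subring.mem_top r)
    · intro c
      have h2 := scalars_appLE (powE k n).hom (tailE k n).left hle
      rw [Over.w (tailE k n)] at h2
      exact (congr($h2 c) ▸ h c :)
    · intro i
      exact (tailE_appLE_powCoord S i 0 hle).symm.subst (motive := (· ∈ T)) (hu i.succ)
    · intro i
      exact (tailE_appLE_powCoord S i _ hle).symm.subst (motive := (· ∈ T)) (hv i.succ)

theorem powCoord_algebraicIndependent {n : ℕ} (S : Fin n → Fin 2) :
    Function.Injective (MvPolynomial.eval₂Hom (scalars (powE k n).hom (powChart S)).hom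
      fun i ↦ powCoord S i (S i).rev.succ) := by
  induction n with
  | zero =>
    exact eval₂Hom_injective_of_isEmpty (scalars_powChart_zero_bijective S).1 _
  | succ n ih =>
    have h0 := isDomain_powChart (k := k) fun i ↦ S i.succ
    have hle := (powChart_succ (k := k) S).le.trans inf_le_right
    have h1 := (isCubicExt_powChart S (isAffineOpen_powChart _)).eval₂Hom_injective (ih _)
    have h2 : ((tailE k n).left.appLE (powChart fun i ↦ S i.succ) (powChart S) hle).hom.comp
        (scalars (powE k n).hom (powChart fun i ↦ S i.succ)).hom =
        (scalars (powE k (n + 1)).hom (powChart S)).hom := by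
      have h3 := scalars_appLE (powE k n).hom (tailE k n).left hle
      rw [Over.w (tailE k n)] at h3
      exact congrArg CommRingCat.Hom.hom h3
    have h4 : (Fin.cons (powCoord S 0 (S 0).rev.succ) fun i ↦
        ((tailE k n).left.appLE (powChart fun i ↦ S i.succ) (powChart S) hle).hom
          (powCoord (fun i ↦ S i.succ) i (S i.succ).rev.succ)) =
        (fun i ↦ powCoord S i (S i).rev.succ) := by
      funext i
      cases i using Fin.cases with
      | zero => rfl
      | succ i => exact tailE_appLE_powCoord S i _ hle
    rw [h2, h4] at h1
    exact h1

end Product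

end CubicQuotient

end

noncomputable section

namespace CubicQuotient

/-! ### The product is integral -/

section Integral

variable (k : Type u) [Field k]

/-- It suffices that `YZ` is not nilpotent: its image in the fraction field of the ring of the chart
`Z ≠ 0` is the nonzero coordinate `y`. -/
theorem exists_mem_chart_inf : ∃ x, x ∈ chart k 0 ∧ x ∈ chart k 1 := by
  have hmem : homCoord k 1 * homCoord k 2 ∈ homGrading k (1 + 1) :=
    SetLike.mul_mem_graded (homCoord_mem k 1) (homCoord_mem k 2)
  have := cubicRing_isDomain k
  let f : HomCoordRing k →+* FractionRing (CubicRing k) := (algebraMap _ _).comp (dehom k 1)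
  have hf : IsUnit (f (homCoord k 1 * homCoord k 2)) := by
    have h1 : dehom k 1 (homCoord k 1) = AdjoinRoot.of _ Polynomial.X :=
      (dehom_homCoord k 1 1).trans (dehomCoord_rev k 1)
    have h2 : dehom k 1 (homCoord k 2) = 1 := (dehom_homCoord k 1 2).trans (dehomCoord_succ k 1)
    have h3 : Function.Injective (AdjoinRoot.of (cubicPoly k)) := by
      refine AdjoinRoot.of.injective_of_degree_ne_zero ?_
      rw [cubicPoly, Polynomial.degree_X_pow_sub_C (by norm_num)]
      norm_num
    rw [isUnit_iff_ne_zero, RingHom.comp_apply, map_mul, h1, h2, mul_one,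
      map_ne_zero_iff _ (IsFractionRing.injective _ _), map_ne_zero_iff _ h3]
    exact Polynomial.X_ne_zero
  let L := IsLocalization.Away.lift (S := Localization.Away (homCoord k 1 * homCoord k 2))
    (homCoord k 1 * homCoord k 2) (g := f) hf
  have : Nontrivial (Localization.Away (homCoord k 1 * homCoord k 2)) := L.domain_nontrivial
  have : Nontrivial (HomogeneousLocalization.Away (homGrading k) (homCoord k 1 * homCoord k 2)) :=
    (algebraMap _ (Localization.Away (homCoord k 1 * homCoord k 2))).domain_nontrivial
  obtain ⟨p⟩ : Nonempty (PrimeSpectrum (HomogeneousLocalization.Away (homGrading k)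
    (homCoord k 1 * homCoord k 2))) := inferInstance
  let ι := Proj.awayι (homGrading k) (homCoord k 1 * homCoord k 2) hmem two_pos
  have hx : ι p ∈ Proj.basicOpen (homGrading k) (homCoord k 1 * homCoord k 2) := by
    rw [← Proj.opensRange_awayι (homGrading k) (homCoord k 1 * homCoord k 2) hmem two_pos]
    exact ⟨p, rfl⟩
  rw [Proj.basicOpen_mul] at hx
  exact ⟨ι p, hx.1, hx.2⟩

variable {k}

/-- A pair of points over the same point of the base lifts to the fibre product, and `Spec k` has
only one point. -/
theorem exists_projE_eq {n : ℕ} (p : Fin n → (curveE k).left) :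
    ∃ x, ∀ i, (projE k n i).left x = p i := by
  have : Subsingleton (Spec (.of k)) := inferInstanceAs (Subsingleton (PrimeSpectrum k))
  induction n with
  | zero =>
    have := isIso_powE_zero_hom k
    obtain ⟨y⟩ : Nonempty (PrimeSpectrum k) := inferInstance
    exact ⟨inv (powE k 0).hom y, fun i ↦ i.elim0⟩
  | succ n ih =>
    obtain ⟨y, hy⟩ := ih fun i ↦ p i.succ
    obtain ⟨x, h0, h1⟩ := Scheme.exists_preimage_of_isPullback (isPullback_powE k n) (p 0) y
      (Subsingleton.elim (α := Spec (.of k)) _ _)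
    refine ⟨x, fun i ↦ ?_⟩
    cases i using Fin.cases with
    | zero => exact h0
    | succ i =>
      rw [← tailE_projE_apply, ← hy i]
      exact congrArg _ h1

theorem exists_forall_mem_powChart (n : ℕ) :
    ∃ x : (powE k n).left, ∀ S : Fin n → Fin 2, x ∈ powChart S := by
  obtain ⟨p, hp0, hp1⟩ := exists_mem_chart_inf k
  have hp (s : Fin 2) : p ∈ chart k s := by
    fin_cases s
    exacts [hp0, hp1]
  obtain ⟨x, hx⟩ := exists_projE_eq (n := n) fun _ ↦ p
  exact ⟨x, fun S i ↦ (hx i).symm ▸ hp (S i)⟩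

theorem isIntegral_powChart {n : ℕ} (S : Fin n → Fin 2) :
    IsIntegral (powChart (k := k) S).toScheme := by
  have : IsAffine (powChart (k := k) S).toScheme := isAffineOpen_powChart S
  have := isDomain_powChart (k := k) S
  have : IsDomain Γ((powChart (k := k) S).toScheme, ⊤) :=
    (powChart (k := k) S).topIso.commRingCatIsoToRingEquiv.injective.isDomain
      (powChart (k := k) S).topIso.commRingCatIsoToRingEquiv.toRingHom
  have : Nonempty (powChart (k := k) S) :=
    have ⟨x, hx⟩ := exists_forall_mem_powChart (k := k) n
    ⟨x, hx S⟩
  exact isIntegral_of_isAffine_of_isDomain _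

theorem isReduced_powE (n : ℕ) : IsReduced (powE k n).left := by
  have hS : TopologicalSpace.IsOpenCover fun S : Fin n → Fin 2 ↦ powChart (k := k) S := by
    rw [TopologicalSpace.IsOpenCover, eq_top_iff]
    intro x _
    exact TopologicalSpace.Opens.mem_iSup.mpr (exists_mem_powChart x)
  have hred : ∀ S, IsReduced (((powE k n).left.openCoverOfIsOpenCover _ hS).X S) := fun S ↦
    have := isIntegral_powChart (k := k) S
    inferInstanceAs (IsReduced (powChart (k := k) S).toScheme)
  exact .of_openCover _ ((powE k n).left.openCoverOfIsOpenCover _ hS)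

theorem isIrreducible_powChart {n : ℕ} (S : Fin n → Fin 2) :
    IsIrreducible (powChart (k := k) S : Set (powE k n).left) := by
  have := isIntegral_powChart (k := k) S
  have h := (IrreducibleSpace.isIrreducible_univ (powChart (k := k) S).toScheme).image
    (powChart (k := k) S).ι (powChart (k := k) S).ι.continuous.continuousOn
  rwa [Set.image_univ, Scheme.Opens.range_ι] at h

/-- Irreducible open charts sharing a point meet one another, so each of them is dense. -/
theorem irreducibleSpace_powE (n : ℕ) : IrreducibleSpace (powE k n).left := by
  obtain ⟨x, hxS⟩ := exists_forall_mem_powChart (k := k) n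
  let S₀ : Fin n → Fin 2 := fun _ ↦ 1
  have h := (isIrreducible_powChart (k := k) S₀).closure
  have h2 : closure (powChart (k := k) S₀ : Set (powE k n).left) = Set.univ := by
    rw [Set.eq_univ_iff_forall]
    intro y
    obtain ⟨S, hS⟩ := exists_mem_powChart y
    rw [mem_closure_iff]
    intro V hV hy
    exact (((isIrreducible_powChart (k := k) S).2 V _ hV (powChart S₀).2 ⟨y, hS, hy⟩
      ⟨x, hxS S, hxS S₀⟩)).mono fun z hz ↦ hz.2
  rw [h2] at h
  have : PreirreducibleSpace (powE k n).left := ⟨h.2⟩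
  exact { toNonempty := ⟨x⟩ }

theorem isIntegral_powE (n : ℕ) : IsIntegral (powE k n).left :=
  have := isReduced_powE (k := k) n
  have := irreducibleSpace_powE (k := k) n
  isIntegral_of_irreducibleSpace_of_isReduced _

theorem genericPoint_mem_powChart {n : ℕ} [IrreducibleSpace (powE k n).left] (S : Fin n → Fin 2) :
    genericPoint (powE k n).left ∈ powChart S :=
  ((genericPoint_spec (powE k n).left).mem_open_set_iff (powChart S).2).mpr
    (by simpa using (isIrreducible_powChart (k := k) S).1)

end Integral

end CubicQuotient

end

noncomputable section

namespace CubicQuotient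

/-! ### The group `G₁` -/

/-- The subgroup is the image of the injective homomorphism `(a₁, …, aₙ) ↦ (a₁, …, aₙ, ∏ aⱼ)`. The
last entry is multiplicative because `Z` is commutative; the ambient automorphism group `A` need not
be. -/
theorem nonempty_closure_snoc_mulEquiv {A H Z : Type*} [Group A] [Group H] [CommGroup Z] {n : ℕ}
    (ι : Z →* A) (hι : Function.Injective ι) (t : Z) (ht : ∀ z, z ∈ Subgroup.zpowers t)
    (Θ : (Fin (n + 1) → A) →* H) (hΘ : Function.Injective Θ) :
    Nonempty (Subgroup.closure (Set.range fun j : Fin n ↦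
      Θ (Fin.snoc (α := fun _ ↦ A) (Pi.mulSingle j (ι t)) (ι t))) ≃* (Fin n → Z)) := by
  let σ : (Fin n → Z) →* (Fin (n + 1) → A) :=
    { toFun a := Fin.snoc (α := fun _ ↦ A) (fun j ↦ ι (a j)) (ι (∏ j, a j))
      map_one' := by
        funext i
        cases i using Fin.lastCases <;> simp
      map_mul' a b := by
        funext i
        cases i using Fin.lastCases <;> simp [Finset.prod_mul_distrib] }
  have hσ : Function.Injective σ := by
    intro a b hab
    funext j
    have := congrFun hab j.castSucc
    exact hι (by simpa [σ] using this)
  have hσt (j : Fin n) : σ (Pi.mulSingle j t) =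
      Fin.snoc (α := fun _ ↦ A) (Pi.mulSingle j (ι t)) (ι t) := by
    funext i
    cases i using Fin.lastCases with
    | last => simp [σ]
    | cast i =>
      rcases eq_or_ne i j with rfl | h
      · simp [σ]
      · simp [σ, h]
  have hrange : (Θ.comp σ).range = Subgroup.closure (Set.range fun j : Fin n ↦
      Θ (Fin.snoc (α := fun _ ↦ A) (Pi.mulSingle j (ι t)) (ι t))) := by
    apply le_antisymm
    · intro x hx
      obtain ⟨a, rfl⟩ := hx
      have ha : a ∈ (Subgroup.closure (Set.range fun j : Fin n ↦
          Θ (Fin.snoc (α := fun _ ↦ A) (Pi.mulSingle j (ι t)) (ι t)))).comap (Θ.comp σ) := by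
        rw [← Finset.univ_prod_mulSingle a]
        refine Subgroup.prod_mem _ fun j _ ↦ ?_
        obtain ⟨z, hz⟩ := Subgroup.mem_zpowers_iff.mp (ht (a j))
        rw [← hz, Pi.mulSingle_zpow]
        refine zpow_mem (Subgroup.mem_comap.mpr ?_) z
        rw [MonoidHom.comp_apply, hσt]
        exact Subgroup.subset_closure ⟨j, rfl⟩
      exact ha
    · rw [Subgroup.closure_le]
      rintro _ ⟨j, rfl⟩
      exact ⟨Pi.mulSingle j t, by simp [hσt]⟩
  rw [← hrange]
  exact ⟨(MonoidHom.ofInjective (f := Θ.comp σ) (hΘ.comp hσ)).symm⟩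

section Group

variable {k : Type u} [Field k]

theorem powAut_hom_projE {n : ℕ} (σ : Fin n → Aut (curveE k)) (i : Fin n) :
    (powAut σ).hom ≫ projE k n i = projE k n i ≫ (σ i).hom :=
  Pi.mapIso_hom_π σ i

/-- `powAut` as a group homomorphism. -/
def powAutHom (k : Type u) [Field k] (n : ℕ) : (Fin n → Aut (curveE k)) →* Aut (powE k n) :=
  MonoidHom.mk' powAut fun σ σ' ↦ by
    refine Iso.ext (powE_hom_ext k fun i ↦ ?_)
    change _ = ((powAut σ').hom ≫ (powAut σ).hom) ≫ _
    rw [Category.assoc, powAut_hom_projE, powAut_hom_projE, ← Category.assoc, powAut_hom_projE,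
      Category.assoc]
    rfl

/-- The diagonal is a section of every projection, so each factor can be read off. -/
theorem powAutHom_injective (n : ℕ) : Function.Injective (powAutHom k n) := by
  intro σ σ' h
  funext i
  let δ : curveE k ⟶ powE k n := Pi.lift fun _ ↦ 𝟙 _
  have hδ : δ ≫ projE k n i = 𝟙 _ := Pi.lift_π _ _
  have h1 : δ ≫ (powAut σ).hom ≫ projE k n i = δ ≫ (powAut σ').hom ≫ projE k n i :=
    congrArg (fun g : Aut (powE k n) ↦ δ ≫ g.hom ≫ projE k n i) h
  rw [powAut_hom_projE, powAut_hom_projE, reassoc_of% hδ, reassoc_of% hδ] at h1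
  exact Iso.ext h1

theorem scaleHom_self_comp (ζ : k) (hζ : ζ ^ 3 = 1) (hζ' : (ζ ^ 2) ^ 3 = 1) :
    scaleHom ζ hζ ≫ scaleHom ζ hζ = scaleHom (ζ ^ 2) hζ' := by
  have h : (scaleGraded ζ hζ).comp (scaleGraded ζ hζ) = scaleGraded (ζ ^ 2) hζ' := by
    ext a
    obtain ⟨p, rfl⟩ := Ideal.Quotient.mk_surjective a
    change scaleRing ζ hζ (scaleRing ζ hζ (Ideal.Quotient.mk _ p)) =
      scaleRing (ζ ^ 2) hζ' (Ideal.Quotient.mk _ p)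
    rw [scaleRing_mk, scaleRing_mk, scaleRing_mk]
    congr 1
    change ((scalePoly ζ).comp (scalePoly ζ)) p = _
    congr 1
    ext i : 1
    fin_cases i
    · simp only [scalePoly, AlgHom.comp_apply, MvPolynomial.aeval_X, Fin.zero_eta,
        Matrix.cons_val_zero, map_mul, MvPolynomial.aeval_C]
      rw [← mul_assoc, MvPolynomial.algebraMap_eq, ← map_mul, pow_two]
    · simp [scalePoly]
    · simp [scalePoly]
  rw [scaleHom, scaleHom, ← Proj.map_comp]
  congr 1

theorem tau_pow_three (ζ : k) (hζ : ζ ^ 3 = 1) : tau ζ hζ ^ 3 = 1 := by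
  have hζ' : (ζ ^ 2) ^ 3 = 1 := by rw [← pow_mul, mul_comm, pow_mul, hζ, one_pow]
  -- The inverse of `τ` is by construction the scaling by `ζ²`.
  have h : tau ζ hζ * tau ζ hζ = (tau ζ hζ)⁻¹ := by
    refine Iso.ext (Over.OverMorphism.ext ?_)
    exact scaleHom_self_comp ζ hζ hζ'
  rw [pow_succ, pow_two, h, inv_mul_cancel]

/-- If `x = 0` then `y² + y = 0`, but `y` is transcendental over `k`. -/
theorem chartCoord_zero_ne_zero (s : Fin 2) : chartCoord k s 0 ≠ 0 := by
  have h := isCubicExt_chart k s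
  have := h.isDomain
  have h1 : Polynomial.eval₂RingHom (scalars (curveE k).hom (chart k s)).hom
      (chartCoord k s s.rev.succ) (Polynomial.X ^ 2 + Polynomial.X) ≠ 0 := by
    rw [map_ne_zero_iff _ h.eval₂_injective]
    intro h0
    have := congrArg (Polynomial.coeff · 1) h0
    simp [Polynomial.coeff_X_pow] at this
  intro h0
  have h2 := h.eq
  rw [h0] at h2
  apply h1
  simpa using h2.symm

/-- Otherwise `x = ζ x` in a domain with `x ≠ 0`. -/
theorem tau_ne_one {ζ : k} (hζ : IsPrimitiveRoot ζ 3) : tau ζ hζ.pow_eq_one ≠ 1 := by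
  intro h
  have h0 := tau_appLE_zero ζ hζ.pow_eq_one 1 (tau_preimage_chart ζ hζ.pow_eq_one 1).ge
  have h1 : (tau ζ hζ.pow_eq_one).hom.left = 𝟙 _ := by rw [h]; rfl
  simp only [h1] at h0
  have h2 : chartCoord k 1 0 = scalars (curveE k).hom (chart k 1) ζ * chartCoord k 1 0 := by
    refine Eq.trans ?_ h0
    exact congrArg (fun f ↦ f.hom (chartCoord k 1 0))
      ((curveE k).left.presheaf.map_id (.op (chart k 1))).symm
  have := (isCubicExt_chart k 1).isDomain
  have h3 := mul_right_cancel₀ (chartCoord_zero_ne_zero 1) ((one_mul _).trans h2)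
  have h4 : (scalars (curveE k).hom (chart k 1)).hom 1 =
    (scalars (curveE k).hom (chart k 1)).hom ζ := (map_one _).trans h3
  exact hζ.ne_one (by norm_num) ((scalars (curveE k).hom (chart k 1)).hom.injective h4).symm

theorem orderOf_tau {ζ : k} (hζ : IsPrimitiveRoot ζ 3) : orderOf (tau ζ hζ.pow_eq_one) = 3 :=
  have : Fact (Nat.Prime 3) := ⟨Nat.prime_three⟩
  orderOf_eq_prime (tau_pow_three _ _) (tau_ne_one hζ)

theorem nonempty_groupG_mulEquiv {ζ : k} (hζ : IsPrimitiveRoot ζ 3) (n : ℕ) :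
    Nonempty (groupG ζ hζ.pow_eq_one n 1 ≃* (Fin n → Multiplicative (ZMod 3))) := by
  have : Fact (Nat.Prime 3) := ⟨Nat.prime_three⟩
  let e : Subgroup.zpowers (tau ζ hζ.pow_eq_one) ≃* Multiplicative (ZMod 3) :=
    mulEquivOfPrimeCardEq (p := 3) ((Nat.card_zpowers _).trans (orderOf_tau hζ)) (by simp)
  let t := e ⟨tau ζ hζ.pow_eq_one, Subgroup.mem_zpowers _⟩
  have ht (z) : z ∈ Subgroup.zpowers t := by
    obtain ⟨⟨_, i, rfl⟩, rfl⟩ := e.surjective z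
    exact ⟨i, (map_zpow e _ _).symm⟩
  have h := nonempty_closure_snoc_mulEquiv ((Subgroup.subtype _).comp e.symm.toMonoidHom)
    (Subtype.val_injective.comp e.symm.injective) t ht (powAutHom k (n + 1))
    (powAutHom_injective (n + 1))
  have he : ((Subgroup.subtype _).comp e.symm.toMonoidHom) t = tau ζ hζ.pow_eq_one :=
    congrArg Subtype.val (e.symm_apply_apply _)
  rw [he] at h
  rw [groupG, pow_one]
  exact h

theorem finite_groupG {ζ : k} (hζ : IsPrimitiveRoot ζ 3) (n : ℕ) :
    Finite (groupG ζ hζ.pow_eq_one n 1) :=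
  have ⟨e⟩ := nonempty_groupG_mulEquiv hζ n
  have : Finite (Multiplicative (ZMod 3)) := inferInstanceAs (Finite (Fin 3))
  Finite.of_equiv _ e.symm.toEquiv

theorem card_groupG {ζ : k} (hζ : IsPrimitiveRoot ζ 3) (n : ℕ) :
    Nat.card (groupG ζ hζ.pow_eq_one n 1) = 3 ^ n := by
  obtain ⟨e⟩ := nonempty_groupG_mulEquiv hζ n
  rw [Nat.card_congr e.toEquiv]
  simp

end Group

end CubicQuotient

end

noncomputable section

namespace CubicQuotient

/-! ### The action of `G₁` on the charts of the product -/

section Action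

variable {k : Type u} [Field k]

theorem aut_preimage_chart {ζ : k} {hζ : ζ ^ 3 = 1} {τ : Aut (curveE k)}
    (hτ : τ = 1 ∨ τ = tau ζ hζ) (s : Fin 2) : τ.hom.left ⁻¹ᵁ chart k s = chart k s := by
  obtain rfl | rfl := hτ
  · rfl
  · exact tau_preimage_chart ζ hζ s

theorem powAut_apply {n : ℕ} (σ : Fin n → Aut (curveE k)) (i : Fin n) (x : (powE k n).left) :
    (projE k n i).left ((powAut σ).hom.left x) = (σ i).hom.left ((projE k n i).left x) := by
  have h := congrArg (fun f ↦ f.left x) (powAut_hom_projE σ i)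
  exact h

theorem powAut_appLE {n : ℕ} (σ : Fin n → Aut (curveE k)) (S : Fin n → Fin 2) (i : Fin n)
    (c : Fin 3) (h : powChart S ≤ (powAut σ).hom.left ⁻¹ᵁ powChart S)
    (h' : chart k (S i) ≤ (σ i).hom.left ⁻¹ᵁ chart k (S i)) :
    (powAut σ).hom.left.appLE (powChart S) (powChart S) h (powCoord S i c) =
      (projE k n i).left.appLE (chart k (S i)) (powChart S) (powChart_le S i)
        ((σ i).hom.left.appLE (chart k (S i)) (chart k (S i)) h' (chartCoord k (S i) c)) := by
  have h1 : (powAut σ).hom.left ≫ (projE k n i).left = (projE k n i).left ≫ (σ i).hom.left :=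
    congrArg CommaMorphism.left (powAut_hom_projE σ i)
  rw [powCoord, ← CommRingCat.comp_apply, Scheme.Hom.appLE_comp_appLE, ← CommRingCat.comp_apply,
    Scheme.Hom.appLE_comp_appLE]
  simp only [h1]

/-- The factors of the `j`-th generator of `G₁`. -/
def genFactor (ζ : k) (hζ : ζ ^ 3 = 1) {n : ℕ} (j : Fin n) : Fin (n + 1) → Aut (curveE k) :=
  Fin.snoc (α := fun _ => Aut (curveE k)) (Pi.mulSingle j (tau ζ hζ)) (tau ζ hζ ^ 1)

/-- The scalars by which the `j`-th generator of `G₁` multiplies the coordinates `xᵢ`. -/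
def genWeight (ζ : k) {n : ℕ} (j : Fin n) : Fin (n + 1) → k :=
  Fin.snoc (α := fun _ => k) (Pi.mulSingle j ζ) ζ

/-- Pairs each factor with its weight, so that statements about a generator are checked only for the
identity and for `τ`. -/
theorem genFactor_eq (ζ : k) (hζ : ζ ^ 3 = 1) {n : ℕ} (j : Fin n) (i : Fin (n + 1)) :
    (genFactor ζ hζ j i = 1 ∧ genWeight ζ j i = 1) ∨
      (genFactor ζ hζ j i = tau ζ hζ ∧ genWeight ζ j i = ζ) := by
  cases i using Fin.lastCases with
  | last => right; simp [genFactor, genWeight]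
  | cast i =>
    rcases eq_or_ne i j with rfl | h
    · right; simp [genFactor, genWeight]
    · left; simp [genFactor, genWeight, h]

theorem genFactor_preimage_chart (ζ : k) (hζ : ζ ^ 3 = 1) {n : ℕ} (j : Fin n) (i : Fin (n + 1))
    (s : Fin 2) : (genFactor ζ hζ j i).hom.left ⁻¹ᵁ chart k s = chart k s :=
  aut_preimage_chart (hζ := hζ) ((genFactor_eq ζ hζ j i).imp And.left And.left) s

theorem groupG_apply_mem_chart (ζ : k) (hζ : ζ ^ 3 = 1) {n : ℕ} {g : Aut (powE k (n + 1))}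
    (hg : g ∈ groupG ζ hζ n 1) (i : Fin (n + 1)) (s : Fin 2) (x : (powE k (n + 1)).left) :
    (projE k (n + 1) i).left (g.hom.left x) ∈ chart k s ↔
      (projE k (n + 1) i).left x ∈ chart k s := by
  induction hg using Subgroup.closure_induction generalizing x with
  | mem g hg =>
    obtain ⟨j, rfl⟩ := hg
    change (projE k (n + 1) i).left ((powAut (genFactor ζ hζ j)).hom.left x) ∈ chart k s ↔ _
    rw [powAut_apply]
    conv_rhs => rw [← genFactor_preimage_chart ζ hζ j i s]
    rfl
  | one => rfl
  | mul a b _ _ ha hb =>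
    change (projE k (n + 1) i).left (a.hom.left (b.hom.left x)) ∈ chart k s ↔ _
    rw [ha, hb]
  | inv a _ ha =>
    rw [← ha]
    have : a.hom.left ((a⁻¹).hom.left x) = x :=
      congrArg (fun f : Aut (powE k (n + 1)) ↦ f.hom.left x) (mul_inv_cancel a)
    rw [this]

theorem isStable_powChart (ζ : k) (hζ : ζ ^ 3 = 1) {n : ℕ} (S : Fin (n + 1) → Fin 2) :
    IsStable (groupG ζ hζ n 1) (powChart (k := k) S) := fun _ hg x hx i ↦
  (groupG_apply_mem_chart ζ hζ hg i (S i) x).mpr (hx i)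

/-- The charts of the product as stable affine open subsets. -/
def stablePowChart (ζ : k) (hζ : ζ ^ 3 = 1) {n : ℕ} (S : Fin (n + 1) → Fin 2) :
    StableAffine (groupG ζ hζ n 1) where
  opens := powChart S
  isStable := isStable_powChart ζ hζ S
  isAffineOpen := isAffineOpen_powChart S

theorem exists_isQuotient_powE {ζ : k} (hζ : IsPrimitiveRoot ζ 3) (n : ℕ) :
    ∃ (Y : Over (Spec (.of k))) (π : powE k (n + 1) ⟶ Y),
      IsQuotient (groupG ζ hζ.pow_eq_one n 1) π :=
  have := finite_groupG hζ n
  exists_isQuotient fun x ↦ (exists_mem_powChart x).imp' (stablePowChart ζ hζ.pow_eq_one) fun _ ↦ id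

theorem finiteType_powChart {n : ℕ} (S : Fin n → Fin 2) :
    (scalars (powE k n).hom (powChart S)).hom.FiniteType := by
  let : Algebra k Γ((powE k n).left, powChart S) :=
    (scalars (powE k n).hom (powChart S)).hom.toAlgebra
  let v : Fin n ⊕ Fin n → Γ((powE k n).left, powChart S) :=
    Sum.elim (fun i ↦ powCoord S i 0) fun i ↦ powCoord S i (S i).rev.succ
  have h : Algebra.adjoin k (Set.range v) = ⊤ := by
    have h1 := powChart_eq_top S (Algebra.adjoin k (Set.range v)).toSubring
      (fun c ↦ (Algebra.adjoin k (Set.range v)).algebraMap_mem c)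
      (fun i ↦ Algebra.subset_adjoin ⟨.inl i, rfl⟩) (fun i ↦ Algebra.subset_adjoin ⟨.inr i, rfl⟩)
    rw [eq_top_iff]
    intro x _
    exact h1.ge (Subring.mem_top x)
  refine ⟨⟨(Set.finite_range v).toFinset, ?_⟩⟩
  rw [Set.Finite.coe_toFinset]
  exact h

/-- The `j`-th generator of `G₁`. -/
def genG (ζ : k) (hζ : ζ ^ 3 = 1) {n : ℕ} (j : Fin n) : groupG ζ hζ n 1 :=
  ⟨powAut (genFactor ζ hζ j), Subgroup.subset_closure ⟨j, rfl⟩⟩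

theorem genG_appLE_zero (ζ : k) (hζ : ζ ^ 3 = 1) {n : ℕ} (S : Fin (n + 1) → Fin 2) (j : Fin n)
    (i : Fin (n + 1)) (h) :
    (genG ζ hζ j).1.hom.left.appLE (powChart S) (powChart S) h (powCoord S i 0) =
      scalars (powE k (n + 1)).hom (powChart S) (genWeight ζ j i) * powCoord S i 0 := by
  refine (powAut_appLE (genFactor ζ hζ j) S i 0 h (genFactor_preimage_chart ζ hζ j i _).ge).trans ?_
  have hs := scalars_appLE (curveE k).hom (projE k (n + 1) i).left (powChart_le S i)
  rw [Over.w (projE k (n + 1) i)] at hs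
  have key : ∀ (τ : Aut (curveE k)) (ω : k), (τ = 1 ∧ ω = 1) ∨ (τ = tau ζ hζ ∧ ω = ζ) →
      ∀ h' : chart k (S i) ≤ τ.hom.left ⁻¹ᵁ chart k (S i),
      τ.hom.left.appLE (chart k (S i)) (chart k (S i)) h' (chartCoord k (S i) 0) =
        scalars (curveE k).hom (chart k (S i)) ω * chartCoord k (S i) 0 := by
    rintro _ _ (⟨rfl, rfl⟩ | ⟨rfl, rfl⟩) h'
    · refine Eq.trans ?_ ((congrArg (· * chartCoord k (S i) 0) (map_one _)).trans
        (one_mul _)).symm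
      exact congrArg (fun f ↦ f.hom (chartCoord k (S i) 0))
        ((curveE k).left.presheaf.map_id (.op (chart k (S i))))
    · exact tau_appLE_zero _ hζ (S i) h'
  rw [key _ _ (genFactor_eq ζ hζ j i), map_mul]
  exact congrArg (· * powCoord S i 0) congr($hs _)

theorem genG_appLE_succ (ζ : k) (hζ : ζ ^ 3 = 1) {n : ℕ} (S : Fin (n + 1) → Fin 2) (j : Fin n)
    (i : Fin (n + 1)) (t : Fin 2) (h) :
    (genG ζ hζ j).1.hom.left.appLE (powChart S) (powChart S) h (powCoord S i t.succ) =
      powCoord S i t.succ := by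
  refine (powAut_appLE (genFactor ζ hζ j) S i _ h (genFactor_preimage_chart ζ hζ j i _).ge).trans ?_
  have key : ∀ τ : Aut (curveE k), τ = 1 ∨ τ = tau ζ hζ →
      ∀ h' : chart k (S i) ≤ τ.hom.left ⁻¹ᵁ chart k (S i),
      τ.hom.left.appLE (chart k (S i)) (chart k (S i)) h' (chartCoord k (S i) t.succ) =
        chartCoord k (S i) t.succ := by
    rintro _ (rfl | rfl) h'
    · exact congrArg (fun f ↦ f.hom (chartCoord k (S i) t.succ))
        ((curveE k).left.presheaf.map_id (.op (chart k (S i))))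
    · exact tau_appLE_succ _ hζ (S i) t h'
  rw [key _ ((genFactor_eq ζ hζ j i).imp And.left And.left)]
  rfl

end Action

end CubicQuotient

end

noncomputable section

namespace CubicQuotient

/-! ### Invariants of a group acting diagonally -/

section Averaging

variable {k A K G σ J : Type*} [Field k] [CommRing A] [IsDomain A] [Field K] [Algebra k A]
  [Algebra k K] [Group G] [Finite G] [MulSemiringAction G A] [SMulCommClass G k A] [Fintype σ]

/-- If a finite group acts diagonally on the generators of an algebra, then the invariants are
spanned by the invariant monomials. -/
theorem map_mem_of_forall_smul_eq (ι : A →ₐ[k] K) (v : σ → A)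
    (hv : Algebra.adjoin k (Set.range v) = ⊤) (g : J → G)
    (hg : ∀ a : A, (∀ j, g j • a = a) → ∀ h : G, h • a = a) (w : J → σ → k)
    (hw : ∀ j i, g j • v i = w j i • v i) (hcard : (Nat.card G : k) ≠ 0)
    (F : IntermediateField k K)
    (hF : ∀ d : σ → ℕ, (∀ j, ∏ i, w j i ^ d i = 1) → ι (∏ i, v i ^ d i) ∈ F) {a : A}
    (ha : ∀ h : G, h • a = a) : ι a ∈ F := by
  have := Fintype.ofFinite G
  -- A monomial is an eigenvector of every `g j`. If all eigenvalues are 1, its orbit sum is a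
  -- multiple of it; otherwise the sum vanishes.
  have hmon (d : σ → ℕ) : ι (∑ h : G, h • ∏ i, v i ^ d i) ∈ F := by
    have hgj (j : J) : g j • ∏ i, v i ^ d i = (∏ i, w j i ^ d i) • ∏ i, v i ^ d i := by
      rw [Finset.smul_prod', Algebra.smul_def, map_prod, ← Finset.prod_mul_distrib]
      refine Finset.prod_congr rfl fun i _ ↦ ?_
      rw [smul_pow', hw, Algebra.smul_def, mul_pow, map_pow]
    by_cases hd : ∀ j, ∏ i, w j i ^ d i = 1
    · have h1 := hg (∏ i, v i ^ d i) fun j ↦ by rw [hgj, hd, one_smul]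
      rw [Finset.sum_congr rfl fun h _ ↦ h1 h, Finset.sum_const, map_nsmul]
      exact nsmul_mem (hF d hd) _
    · push Not at hd
      obtain ⟨j, hj⟩ := hd
      have h1 : ∑ h : G, h • ∏ i, v i ^ d i =
          (∏ i, w j i ^ d i) • ∑ h : G, h • ∏ i, v i ^ d i := by
        -- Reindexing by `h ↦ h * g j` multiplies the sum by an eigenvalue different from 1, so the
        -- sum is 0.
        conv_lhs => rw [← Equiv.sum_comp (Equiv.mulRight (g j))]
        rw [Finset.smul_sum]
        refine Finset.sum_congr rfl fun h _ ↦ ?_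
        rw [Equiv.coe_mulRight, mul_smul, hgj, smul_comm]
      have h2 : (1 - ∏ i, w j i ^ d i) • ∑ h : G, h • ∏ i, v i ^ d i = 0 := by
        rw [sub_smul, one_smul, sub_eq_zero]
        exact h1
      rw [(smul_eq_zero.mp h2).resolve_left (sub_ne_zero.mpr (Ne.symm hj)), map_zero]
      exact zero_mem F
  obtain ⟨p, rfl⟩ : ∃ p, MvPolynomial.aeval (R := k) v p = a := by
    have : a ∈ Algebra.adjoin k (Set.range v) := hv ▸ Algebra.mem_top
    rwa [Algebra.adjoin_range_eq_range_aeval] at this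
  have h1 : ∑ h : G, h • MvPolynomial.aeval v p =
      ∑ d ∈ p.support, p.coeff d • ∑ h : G, h • ∏ i, v i ^ d i := by
    simp only [MvPolynomial.aeval_def, MvPolynomial.eval₂_eq', ← Algebra.smul_def, Finset.smul_sum]
    rw [Finset.sum_comm]
    refine Finset.sum_congr rfl fun d _ ↦ Finset.sum_congr rfl fun h _ ↦ ?_
    rw [smul_comm]
  have h2 : ι (∑ h : G, h • MvPolynomial.aeval v p) ∈ F := by
    rw [h1, map_sum]
    refine sum_mem fun d _ ↦ ?_
    rw [map_smul]
    exact F.smul_mem (hmon d)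
  -- For invariant `a` the orbit sum is `|G| a`, and `|G|` is invertible in `k`.
  rw [Finset.sum_congr rfl fun h _ ↦ ha h, Finset.sum_const, Finset.card_univ,
    ← Nat.card_eq_fintype_card, ← Nat.cast_smul_eq_nsmul k, map_smul] at h2
  have h3 := F.smul_mem (x := (Nat.card G : k)⁻¹) h2
  rwa [smul_smul, inv_mul_cancel₀ hcard, one_smul] at h3

end Averaging

/-! ### The field generated by `y₁, …, yₙ₋₂`, `z` and `α` -/

section Generators

variable {k K : Type*} [Field k] [Field K] [Algebra k K] {m : ℕ} {x y : Fin (m + 2) → K}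

theorem y_add_one_ne_zero (hy : AlgebraicIndependent k y) (i : Fin (m + 2)) : y i + 1 ≠ 0 := by
  intro h
  refine hy.transcendental i ?_
  rw [eq_neg_of_add_eq_zero_left h]
  exact isAlgebraic_one.neg

theorem x_ne_zero (hxy : ∀ i, x i ^ 3 = y i ^ 2 + y i) (hy : AlgebraicIndependent k y)
    (i : Fin (m + 2)) : x i ≠ 0 := by
  intro h
  have h1 := hxy i
  rw [h, zero_pow (by norm_num), pow_two, ← mul_add_one] at h1
  exact mul_ne_zero (hy.ne_zero i) (y_add_one_ne_zero hy i) h1.symm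

theorem z_mem (x y : Fin (m + 2) → K) :
    (∏ i : Fin (m + 1), x i.castSucc) / x (Fin.last (m + 1)) ∈
      IntermediateField.adjoin k (Set.range (generators x y)) :=
  IntermediateField.subset_adjoin _ _ ⟨.inr 0, rfl⟩

theorem alpha_mem (x y : Fin (m + 2) → K) :
    y (Fin.last (m + 1)) / y (Fin.last m).castSucc ∈
      IntermediateField.adjoin k (Set.range (generators x y)) :=
  IntermediateField.subset_adjoin _ _ ⟨.inr 1, rfl⟩

/-- With `a = yₙ₋₁` and `b = yₙ = α a`, cubing the definition of `z` gives `z³ (b² + b) = P (a² +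
a)`. Both sides are divisible by `a`, and what remains is the linear equation `a (z³ α² - P) = P -
z³ α`. -/
theorem y_mem (hxy : ∀ i, x i ^ 3 = y i ^ 2 + y i) (hy : AlgebraicIndependent k y)
    (i : Fin (m + 2)) : y i ∈ IntermediateField.adjoin k (Set.range (generators x y)) := by
  set F := IntermediateField.adjoin k (Set.range (generators x y))
  have hlt (i : Fin m) : y i.castSucc.castSucc ∈ F :=
    IntermediateField.subset_adjoin _ _ ⟨.inl i, rfl⟩
  have hz : (∏ i : Fin (m + 1), x i.castSucc) / x (Fin.last (m + 1)) ∈ F := z_mem x y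
  have hα : y (Fin.last (m + 1)) / y (Fin.last m).castSucc ∈ F := alpha_mem x y
  set z := (∏ i : Fin (m + 1), x i.castSucc) / x (Fin.last (m + 1)) with hz'
  set α := y (Fin.last (m + 1)) / y (Fin.last m).castSucc with hα'
  set P := ∏ i : Fin m, (y i.castSucc.castSucc ^ 2 + y i.castSucc.castSucc) with hP'
  have hP : P ∈ F := prod_mem fun i _ ↦ add_mem (pow_mem (hlt i) 2) (hlt i)
  set a := y (Fin.last m).castSucc with ha'
  set b := y (Fin.last (m + 1)) with hb'
  have ha0 : a ≠ 0 := hy.ne_zero _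
  have hb0 : b ≠ 0 := hy.ne_zero _
  have hba : b = α * a := (div_mul_cancel₀ b ha0).symm
  have hα0 : α ≠ 0 := div_ne_zero hb0 ha0
  have hα1 : α ≠ 1 := by
    intro h
    rw [h, one_mul] at hba
    have := congrArg Fin.val (hy.injective hba)
    simp at this
  have hz0 : z ≠ 0 :=
    div_ne_zero (Finset.prod_ne_zero_iff.mpr fun i _ ↦ x_ne_zero hxy hy _) (x_ne_zero hxy hy _)
  have hzeq : z ^ 3 * (b ^ 2 + b) = P * (a ^ 2 + a) := by
    rw [← hxy, hz', ← mul_pow, div_mul_cancel₀ _ (x_ne_zero hxy hy _), Fin.prod_univ_castSucc,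
      mul_pow, hxy, ← Finset.prod_pow]
    congr 1
    exact Finset.prod_congr rfl fun i _ ↦ hxy _
  have h1 : a * (z ^ 3 * α ^ 2 - P) = P - z ^ 3 * α := by
    rw [hba] at hzeq
    have : a * (a * (z ^ 3 * α ^ 2 - P) - (P - z ^ 3 * α)) = 0 := by linear_combination hzeq
    exact sub_eq_zero.mp ((mul_eq_zero.mp this).resolve_left ha0)
  -- If the leading coefficient vanished, so would the constant term, giving `z³ α (α - 1) = 0`; but
  -- `α ≠ 1` by independence of the `yᵢ`.
  have h2 : z ^ 3 * α ^ 2 - P ≠ 0 := by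
    intro h
    rw [h, mul_zero] at h1
    have : z ^ 3 * (α * (α - 1)) = 0 := by linear_combination h - h1
    exact mul_ne_zero (pow_ne_zero 3 hz0) (mul_ne_zero hα0 (sub_ne_zero.mpr hα1)) this
  have ha : a ∈ F := by
    rw [eq_div_of_mul_eq h2 h1]
    exact div_mem (sub_mem hP (mul_mem (pow_mem hz 3) hα))
      (sub_mem (mul_mem (pow_mem hz 3) (pow_mem hα 2)) hP)
  cases i using Fin.lastCases with
  | last => exact hba.symm.subst (motive := (· ∈ F)) (mul_mem hα ha)
  | cast i =>
    cases i using Fin.lastCases with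
    | last => exact ha
    | cast i => exact hlt i

/-- Replacing `xₙ` by `(x₁ ⋯ xₙ₋₁) / z` raises the exponent of each other `xⱼ` to `dⱼ + dₙ`, a
multiple of 3, and `xⱼ³ = yⱼ² + yⱼ`. -/
theorem monomial_mem (hxy : ∀ i, x i ^ 3 = y i ^ 2 + y i) (hy : AlgebraicIndependent k y)
    (d : Fin (m + 2) → ℕ) (hd : ∀ j : Fin (m + 1), 3 ∣ d j.castSucc + d (Fin.last (m + 1))) :
    ∏ i, x i ^ d i ∈ IntermediateField.adjoin k (Set.range (generators x y)) := by
  set F := IntermediateField.adjoin k (Set.range (generators x y))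
  have hz : (∏ i : Fin (m + 1), x i.castSucc) / x (Fin.last (m + 1)) ∈ F := z_mem x y
  have hx0 := x_ne_zero hxy hy
  have h1 : ∏ i, x i ^ d i = (∏ j : Fin (m + 1), x j.castSucc ^ (d j.castSucc + d (Fin.last (m + 1))))
      / ((∏ i : Fin (m + 1), x i.castSucc) / x (Fin.last (m + 1))) ^ d (Fin.last (m + 1)) := by
    have h2 : (∏ i : Fin (m + 1), x i.castSucc) ≠ 0 :=
      Finset.prod_ne_zero_iff.mpr fun i _ ↦ hx0 _
    rw [Fin.prod_univ_castSucc, eq_div_iff (pow_ne_zero _ (div_ne_zero h2 (hx0 _))), div_pow,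
      mul_assoc, mul_div_cancel₀ _ (pow_ne_zero _ (hx0 _)), ← Finset.prod_pow,
      ← Finset.prod_mul_distrib]
    exact Finset.prod_congr rfl fun i _ ↦ (pow_add _ _ _).symm
  rw [h1]
  refine div_mem (prod_mem fun j _ ↦ ?_) (pow_mem hz _)
  obtain ⟨q, hq⟩ := hd j
  rw [hq, pow_mul, hxy]
  exact pow_mem (add_mem (pow_mem (y_mem hxy hy _) 2) (y_mem hxy hy _)) _

/-- The `yᵢ` are rational in the generators and the `xᵢ` are cube roots of polynomials in them, so
`K` is algebraic over the `m + 2` generators. The independent `yᵢ` bound the transcendence degree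
below by `m + 2`, so the generators form a transcendence basis. -/
theorem generators_algebraicIndependent (hxy : ∀ i, x i ^ 3 = y i ^ 2 + y i)
    (hy : AlgebraicIndependent k y)
    (hK : ∀ f : K, ∃ a ∈ Algebra.adjoin k (Set.range (Sum.elim x y)),
      ∃ b ∈ Algebra.adjoin k (Set.range (Sum.elim x y)), f = a / b) :
    AlgebraicIndependent k (generators x y) := by
  let R := Algebra.adjoin k (Set.range (generators x y))
  have hF (f : K) (hf : f ∈ IntermediateField.adjoin k (Set.range (generators x y))) :
      IsAlgebraic R f := by
    obtain ⟨a, ha, b, hb, rfl⟩ := IntermediateField.mem_adjoin_iff_div.mp hf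
    rw [div_eq_mul_inv]
    exact IsAlgebraic.mul (R := R) (isAlgebraic_algebraMap (⟨a, ha⟩ : R))
      (IsAlgebraic.inv (isAlgebraic_algebraMap (⟨b, hb⟩ : R)))
  have hyalg (i) : IsAlgebraic R (y i) := hF _ (y_mem hxy hy i)
  have hxalg (i) : IsAlgebraic R (x i) := by
    refine IsAlgebraic.of_pow (n := 3) (by norm_num) ?_
    rw [hxy]
    exact ((hyalg i).pow 2).add (hyalg i)
  have hadj (f : K) (hf : f ∈ Algebra.adjoin k (Set.range (Sum.elim x y))) : IsAlgebraic R f := by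
    induction hf using Algebra.adjoin_induction with
    | mem f hf =>
      obtain ⟨i | i, rfl⟩ := hf
      exacts [hxalg i, hyalg i]
    | algebraMap c => exact isAlgebraic_algebraMap (algebraMap k R c)
    | add f g _ _ hf hg => exact hf.add hg
    | mul f g _ _ hf hg => exact hf.mul hg
  have : Algebra.IsAlgebraic R K := ⟨fun f ↦ by
    obtain ⟨a, ha, b, hb, rfl⟩ := hK f
    rw [div_eq_mul_inv]
    exact (hadj a ha).mul (hadj b hb).inv⟩
  refine (Algebra.IsAlgebraic.isTranscendenceBasis_of_lift_le_trdeg_of_finite k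
    (generators x y) ?_).1
  have h := hy.lift_cardinalMk_le_trdeg
  simpa using h

end Generators

end CubicQuotient

end

noncomputable section

namespace CubicQuotient

/-! ### The field of fractions of the invariants -/

section InvariantField

variable {k A K G : Type*} [Field k] [CommRing A] [IsDomain A] [Field K] [Algebra k A]
  [Algebra k K] [Group G] [Finite G] [MulSemiringAction G A] [SMulCommClass G k A] {m : ℕ}

theorem prod_genWeight_pow (ζ : k) {n : ℕ} (j : Fin n) (d : Fin (n + 1) → ℕ) :
    ∏ i, genWeight ζ j i ^ d i = ζ ^ (d j.castSucc + d (Fin.last n)) := by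
  rw [Fin.prod_univ_castSucc, pow_add]
  congr 1
  · rw [Finset.prod_eq_single j]
    · simp [genWeight]
    · intro i _ hij
      simp [genWeight, hij]
    · simp
  · simp [genWeight]

theorem three_ne_zero_of_isPrimitiveRoot {ζ : k} (hζ : IsPrimitiveRoot ζ 3) : (3 : k) ≠ 0 := by
  have := hζ.neZero'
  exact_mod_cast NeZero.ne ((3 : ℕ) : k)

/-- If `G₁` acts in the standard way on the ring generated by the coordinates `xᵢ`, `yᵢ`, then the
fractions of its invariants form the field generated by `y₁, …, yₙ₋₂`, `z` and `α`. -/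
theorem fractions_invariants_eq_adjoin {ζ : k} (hζ : IsPrimitiveRoot ζ 3) (ι : A →ₐ[k] K)
    (x y : Fin (m + 2) → A) (hxy : ∀ i, x i ^ 3 = y i ^ 2 + y i)
    (hy : AlgebraicIndependent k (ι ∘ y))
    (htop : Algebra.adjoin k (Set.range (Sum.elim x y)) = ⊤) (g : Fin (m + 1) → G)
    (hg : ∀ a : A, (∀ j, g j • a = a) → ∀ h : G, h • a = a)
    (hgx : ∀ j i, g j • x i = genWeight ζ j i • x i) (hgy : ∀ j i, g j • y i = y i)
    (hcard : Nat.card G = 3 ^ (m + 1)) (L : Subring K)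
    (hL : ∀ f, f ∈ L ↔ ∃ a b : A, (∀ h : G, h • a = a) ∧ (∀ h : G, h • b = b) ∧ ι b ≠ 0 ∧
      f * ι b = ι a) :
    (L : Set K) = IntermediateField.adjoin k (Set.range (generators (ι ∘ x) (ι ∘ y))) := by
  have hxy' (i) : (ι ∘ x) i ^ 3 = (ι ∘ y) i ^ 2 + (ι ∘ y) i := by
    simp only [Function.comp_apply, ← map_pow, ← map_add, hxy]
  have hx0 := x_ne_zero hxy' hy
  have hinv {a : A} (ha : ∀ h : G, h • a = a) :
      ι a ∈ IntermediateField.adjoin k (Set.range (generators (ι ∘ x) (ι ∘ y))) := by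
    refine map_mem_of_forall_smul_eq ι (Sum.elim x y) htop g hg
      (fun j ↦ Sum.elim (genWeight ζ j) 1) ?_ ?_ _ ?_ ha
    · rintro j (i | i)
      · exact hgx j i
      · exact (hgy j i).trans (one_smul k (y i)).symm
    · rw [hcard, Nat.cast_pow]
      exact pow_ne_zero _ (by exact_mod_cast three_ne_zero_of_isPrimitiveRoot hζ)
    · intro d hd
      rw [Fintype.prod_sum_type, map_mul, map_prod, map_prod]
      simp only [Sum.elim_inl, Sum.elim_inr, map_pow]
      refine mul_mem (monomial_mem hxy' hy _ fun j ↦ ?_)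
        (prod_mem fun i _ ↦ pow_mem (y_mem hxy' hy i) _)
      -- The weights on the `y`'s are 1, so invariance under the `j`-th generator reads `ζ ^ (dⱼ +
      -- dₙ) = 1`.
      have h1 := hd j
      rw [Fintype.prod_sum_type] at h1
      simp only [Sum.elim_inl, Sum.elim_inr, Pi.one_apply, one_pow, Finset.prod_const_one,
        mul_one] at h1
      rw [prod_genWeight_pow ζ j fun i ↦ d (.inl i)] at h1
      exact (hζ.pow_eq_one_iff_dvd _).mp h1
  have hyinv (i) : ∀ h : G, h • y i = y i := hg _ fun j ↦ hgy j i
  have hsc (c : k) : ∀ h : G, h • algebraMap k A c = algebraMap k A c := fun h ↦ by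
    rw [Algebra.algebraMap_eq_smul_one, smul_comm, smul_one]
  have hfrac {a b : A} (ha : ∀ h : G, h • a = a) (hb : ∀ h : G, h • b = b) (hb0 : ι b ≠ 0) :
      ι a / ι b ∈ L := (hL _).mpr ⟨a, b, ha, hb, hb0, div_mul_cancel₀ _ hb0⟩
  have hL1 {a : A} (ha : ∀ h : G, h • a = a) : ι a ∈ L :=
    (hL _).mpr ⟨a, 1, ha, fun _ ↦ smul_one _, by simp, by simp⟩
  apply Set.Subset.antisymm
  · intro f hf
    obtain ⟨a, b, ha, hb, hb0, h⟩ := (hL f).mp hf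
    rw [eq_div_of_mul_eq hb0 h]
    exact div_mem (hinv ha) (hinv hb)
  · intro f hf
    induction hf using IntermediateField.adjoin_induction with
    | mem f hf =>
      obtain ⟨i | i, rfl⟩ := hf
      · exact hL1 (hyinv _)
      · have hζ3 := hζ.pow_eq_one
        fin_cases i
        · have hx3 : ∀ h : G, h • x (Fin.last (m + 1)) ^ 3 = x (Fin.last (m + 1)) ^ 3 := by
            rw [hxy]
            exact fun h ↦ by rw [smul_add, smul_pow', hyinv]
          -- To write `z` as a fraction of invariants, multiply numerator and denominator by `xₙ²`:
          -- the numerator has weight `ζ ^ (1 + 2) = 1` and the denominator is `xₙ³`.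
          have hx2 : ∀ h : G, h • ((∏ i : Fin (m + 1), x i.castSucc) * x (Fin.last (m + 1)) ^ 2) =
              (∏ i : Fin (m + 1), x i.castSucc) * x (Fin.last (m + 1)) ^ 2 := by
            refine hg _ fun j ↦ ?_
            have h1 := prod_genWeight_pow ζ j (Fin.snoc (α := fun _ ↦ ℕ) (fun _ ↦ 1) 2)
            have h2 : (∏ i : Fin (m + 1), x i.castSucc) * x (Fin.last (m + 1)) ^ 2 =
                ∏ i, x i ^ (Fin.snoc (α := fun _ ↦ ℕ) (fun _ ↦ 1) 2 : Fin (m + 2) → ℕ) i := by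
              conv_rhs => rw [Fin.prod_univ_castSucc]
              simp
            rw [h2, Finset.smul_prod']
            simp only [smul_pow', hgx, Algebra.smul_def, mul_pow, Finset.prod_mul_distrib,
              ← map_pow, ← map_prod, h1]
            simp [hζ3]
          have hne : ι (x (Fin.last (m + 1)) ^ 3) ≠ 0 := by
            rw [map_pow]
            exact pow_ne_zero 3 (hx0 _)
          have h3 := hfrac hx2 hx3 hne
          have h4 : generators (ι ∘ x) (ι ∘ y) (.inr 0) =
              ι ((∏ i : Fin (m + 1), x i.castSucc) * x (Fin.last (m + 1)) ^ 2) /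
                ι (x (Fin.last (m + 1)) ^ 3) := by
            rw [eq_div_iff hne, map_mul, map_prod, map_pow, map_pow]
            change (∏ i : Fin (m + 1), (ι ∘ x) i.castSucc) / (ι ∘ x) (Fin.last (m + 1)) * _ = _
            rw [div_mul_eq_mul_div, div_eq_iff (hx0 _)]
            simp only [Function.comp_apply]
            ring
          exact h4.symm.subst (motive := (· ∈ L)) h3
        · exact hfrac (hyinv _) (hyinv _) (hy.ne_zero _)
    | algebraMap c => exact (ι.commutes c).subst (motive := (· ∈ L)) (hL1 (hsc c))
    | add f g _ _ hf hg => exact L.add_mem hf hg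
    | inv f _ hf =>
      obtain ⟨a, b, ha, hb, hb0, h⟩ := (hL f).mp hf
      rcases eq_or_ne f 0 with rfl | hf0
      · rw [inv_zero]
        exact L.zero_mem
      · have ha0 : ι a ≠ 0 := h ▸ mul_ne_zero hf0 hb0
        rw [eq_div_of_mul_eq hb0 h, inv_div]
        exact hfrac hb ha ha0
    | mul f g _ _ hf hg => exact L.mul_mem hf hg

end InvariantField

end CubicQuotient

end

noncomputable section

namespace CubicQuotient

/-! ### The function field of the quotient -/

section FunctionField

variable {k : Type u} [Field k]

theorem powCoord_cubic {n : ℕ} (S : Fin n → Fin 2) (i : Fin n) :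
    (powCoord S i 0 : Γ((powE k n).left, powChart S)) ^ 3 =
      powCoord S i (S i).rev.succ ^ 2 + powCoord S i (S i).rev.succ := by
  have h := congrArg ((projE k n i).left.appLE (chart k (S i)) (powChart S) (powChart_le S i))
    (isCubicExt_chart k (S i)).eq
  rw [map_pow, map_add, map_pow] at h
  exact h

theorem ratCoord_eq_germ {n : ℕ} [IrreducibleSpace (powE k n).left] (i : Fin n) (j : Fin 3) (h) :
    ratCoord i j h = (powE k n).left.presheaf.germ (powChart fun _ ↦ 1) _
      (genericPoint_mem_powChart _) (powCoord (fun _ ↦ 1) i j) :=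
  ((powE k n).left.presheaf.germ_res_apply (homOfLE (powChart_le (fun _ ↦ 1) i)) _
    (genericPoint_mem_powChart _) _).symm

/-- The stabilizer is a subgroup, so generators suffice. Their inverses appear because `g⁻¹` acts as
pullback along `g`. -/
theorem smul_eq_of_forall_genG {ζ : k} {hζ : ζ ^ 3 = 1} {n : ℕ} {A : Type*} [CommRing A]
    [MulSemiringAction (groupG ζ hζ n 1) A] {a : A} (h : ∀ j : Fin n, (genG ζ hζ j)⁻¹ • a = a)
    (g : groupG ζ hζ n 1) : g • a = a := by
  have h1 : groupG ζ hζ n 1 ≤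
      (MulAction.stabilizer (groupG ζ hζ n 1) a).map (groupG ζ hζ n 1).subtype := by
    refine (Subgroup.closure_le _).mpr ?_
    rintro _ ⟨j, rfl⟩
    exact ⟨genG ζ hζ j, inv_mem_iff.mp (MulAction.mem_stabilizer_iff.mpr (h j)), rfl⟩
  obtain ⟨g', hg', he⟩ := h1 g.2
  exact (Subtype.ext he : g' = g) ▸ hg'

theorem algebraicIndependent_of_eval₂Hom_injective {R A ι : Type*} [CommRing R] [CommRing A]
    (φ : R →+* A) (v : ι → A) (h : Function.Injective (MvPolynomial.eval₂Hom φ v)) :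
    letI := φ.toAlgebra
    AlgebraicIndependent R v :=
  h

/-- Everything is read off on the one stable chart where all `Zᵢ ≠ 0`: the coordinates generate its
ring, the ring embeds in the function field, and fractions of its invariants form the function field
of the quotient. -/
theorem isPurelyTranscendentalOn_range_stalkMap {ζ : k} (hζ : IsPrimitiveRoot ζ 3) {m : ℕ}
    [IsIntegral (powE k (m + 2)).left]
    (hη : ∀ i, genericPoint (powE k (m + 2)).left ∈ (projE k (m + 2) i).left ⁻¹ᵁ chartE k)
    {Y : Over (Spec (.of k))} {π : powE k (m + 2) ⟶ Y}
    (hπ : IsQuotient (groupG ζ hζ.pow_eq_one (m + 1) 1) π) :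
    IsPurelyTranscendentalOn (constants (powE k (m + 2)) (genericPoint _))
      (π.left.stalkMap (genericPoint (powE k (m + 2)).left)).hom.range
      (generators (fun i => ratCoord i 0 (hη i)) (fun i => ratCoord i 1 (hη i))) := by
  have := finite_groupG hζ (m + 1)
  let S : Fin (m + 2) → Fin 2 := fun _ ↦ 1
  let U := stablePowChart ζ hζ.pow_eq_one S
  have hS : genericPoint (powE k (m + 2)).left ∈ powChart S := genericPoint_mem_powChart S
  let A := Γ((powE k (m + 2)).left, powChart S)
  have : Nonempty (powChart (k := k) S) := ⟨⟨_, hS⟩⟩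
  have : IsDomain A := isDomain_powChart S
  let : Algebra k (powE k (m + 2)).left.functionField :=
    (constants (powE k (m + 2)) (genericPoint _)).toAlgebra
  let : Algebra k A := (scalars (powE k (m + 2)).hom (powChart S)).hom.toAlgebra
  let : MulSemiringAction (groupG ζ hζ.pow_eq_one (m + 1) 1) A :=
    (isStable_powChart ζ hζ.pow_eq_one S).action
  let ι : A →ₐ[k] (powE k (m + 2)).left.functionField :=
    { ((powE k (m + 2)).left.presheaf.germ (powChart S) _ hS).hom with
      commutes' := germ_scalars (powE k (m + 2)) (powChart S) _ hS }
  have hι : Function.Injective ι := Scheme.germToFunctionField_injective _ (powChart S)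
  have hsc (c : k) (g : groupG ζ hζ.pow_eq_one (m + 1) 1) :
      g • algebraMap k A c = algebraMap k A c :=
    (isStable_powChart ζ hζ.pow_eq_one S).mem_invSections_iff.mp
      (scalars_mem_invSections (powChart S) c) g
  have : SMulCommClass (groupG ζ hζ.pow_eq_one (m + 1) 1) k A := ⟨fun g c a ↦ by
    rw [Algebra.smul_def, Algebra.smul_def, smul_mul', hsc]⟩
  let x : Fin (m + 2) → A := fun i ↦ powCoord S i 0
  let y : Fin (m + 2) → A := fun i ↦ powCoord S i 1
  have hxy (i) : x i ^ 3 = y i ^ 2 + y i := powCoord_cubic S i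
  have hy' : AlgebraicIndependent k y :=
    algebraicIndependent_of_eval₂Hom_injective _ _ (powCoord_algebraicIndependent S)
  have hy : AlgebraicIndependent k (ι ∘ y) := hy'.map' hι
  have htop : Algebra.adjoin k (Set.range (Sum.elim x y)) = ⊤ := by
    have h1 := powChart_eq_top S (Algebra.adjoin k (Set.range (Sum.elim x y))).toSubring
      (fun c ↦ (Algebra.adjoin k (Set.range (Sum.elim x y))).algebraMap_mem c)
      (fun i ↦ Algebra.subset_adjoin ⟨.inl i, rfl⟩) (fun i ↦ Algebra.subset_adjoin ⟨.inr i, rfl⟩)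
    rw [eq_top_iff]
    intro x _
    exact h1.ge (Subring.mem_top x)
  have hK (f : (powE k (m + 2)).left.functionField) :
      ∃ a ∈ Algebra.adjoin k (Set.range (Sum.elim (ι ∘ x) (ι ∘ y))),
      ∃ b ∈ Algebra.adjoin k (Set.range (Sum.elim (ι ∘ x) (ι ∘ y))), f = a / b := by
    have h1 := functionField_isFractionRing_of_isAffineOpen _ (powChart (k := k) S)
      (isAffineOpen_powChart S)
    have h2 (a : A) : ι a ∈ Algebra.adjoin k (Set.range (Sum.elim (ι ∘ x) (ι ∘ y))) := by
      rw [← Sum.comp_elim, Set.range_comp, ← AlgHom.map_adjoin, htop]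
      exact ⟨a, trivial, rfl⟩
    obtain ⟨a, b, -, h⟩ := IsFractionRing.div_surjective (A := A) f
    exact ⟨ι a, h2 a, ι b, h2 b, h.symm⟩
  have hgen : generators (fun i => ratCoord i 0 (hη i)) (fun i => ratCoord i 1 (hη i)) =
      generators (ι ∘ x) (ι ∘ y) := by
    congr 1 <;> exact funext fun i ↦ ratCoord_eq_germ i _ _
  rw [hgen]
  refine ⟨generators_algebraicIndependent (fun i ↦ ?_) hy hK,
    fractions_invariants_eq_adjoin hζ ι x y hxy hy htop (fun j ↦ (genG ζ hζ.pow_eq_one j)⁻¹)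
      (fun a ↦ smul_eq_of_forall_genG) (fun j i ↦ ?_) (fun j i ↦ ?_) (card_groupG hζ (m + 1)) _
      fun f ↦ ?_⟩
  · simp only [Function.comp_apply, ← map_pow, ← map_add, hxy]
  · rw [Algebra.smul_def]
    refine ((isStable_powChart ζ hζ.pow_eq_one S).smul_def _ _).trans ?_
    exact genG_appLE_zero ζ hζ.pow_eq_one S j i _
  · refine ((isStable_powChart ζ hζ.pow_eq_one S).smul_def _ _).trans ?_
    exact genG_appLE_succ ζ hζ.pow_eq_one S j i 0 _
  · refine (hπ.mem_range_stalkMap_iff U hS f).trans ⟨?_, ?_⟩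
    · rintro ⟨a, ha, b, hb, h0, h⟩
      exact ⟨a, b, (isStable_powChart ζ hζ.pow_eq_one S).mem_invSections_iff.mp ha,
        (isStable_powChart ζ hζ.pow_eq_one S).mem_invSections_iff.mp hb, h0, h⟩
    · rintro ⟨a, b, ha, hb, h0, h⟩
      exact ⟨a, (isStable_powChart ζ hζ.pow_eq_one S).mem_invSections_iff.mpr ha, b,
        (isStable_powChart ζ hζ.pow_eq_one S).mem_invSections_iff.mpr hb, h0, h⟩

theorem IsPurelyTranscendentalOn.comp_equiv {K : Type*} [Field K] {φ : k →+* K} {L : Subring K}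
    {ι κ : Type*} {g : ι → K} (h : IsPurelyTranscendentalOn φ L g) (e : κ ≃ ι) :
    IsPurelyTranscendentalOn φ L (g ∘ e) := by
  let := φ.toAlgebra
  refine ⟨h.1.comp e e.injective, h.2.trans ?_⟩
  rw [e.surjective.range_comp]

end FunctionField

end CubicQuotient

end

theorem mainTheorem10 {k : Type u} [Field k] (ζ : k) (hζ : IsPrimitiveRoot ζ 3) (m : ℕ) :
    Nonempty (groupG ζ hζ.pow_eq_one (m + 1) 1 ≃* (Fin (m + 1) → Multiplicative (ZMod 3))) ∧
    (∃ (Y : Over (Spec (.of k))) (π : powE k (m + 2) ⟶ Y),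
      IsQuotient (groupG ζ hζ.pow_eq_one (m + 1) 1) π) ∧
    ∃ (_ : IsIntegral (powE k (m + 2)).left)
      (hη : ∀ i, genericPoint (powE k (m + 2)).left ∈ (projE k (m + 2) i).left ⁻¹ᵁ chartE k),
      ∀ (Y : Over (Spec (.of k))) (π : powE k (m + 2) ⟶ Y),
        IsQuotient (groupG ζ hζ.pow_eq_one (m + 1) 1) π →
          Scheme.BirationalOver (S := Spec (.of k)) Y.hom
            (𝔸(ULift.{u} (Fin (m + 2)); Spec (.of k)) ↘ Spec (.of k)) ∧
          ∃ _ : IsIntegral Y.left,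
            π.left (genericPoint (powE k (m + 2)).left) = genericPoint Y.left ∧
            IsPurelyTranscendentalOn (constants (powE k (m + 2)) (genericPoint _))
              (π.left.stalkMap (genericPoint (powE k (m + 2)).left)).hom.range
              (generators (fun i => ratCoord i 0 (hη i)) (fun i => ratCoord i 1 (hη i))) := by
  have hX := isIntegral_powE (k := k) (m + 2)
  have := finite_groupG hζ (m + 1)
  have hη (i) : genericPoint (powE k (m + 2)).left ∈ (projE k (m + 2) i).left ⁻¹ᵁ chartE k :=
    powChart_le (fun _ ↦ 1) i (genericPoint_mem_powChart _)
  refine ⟨nonempty_groupG_mulEquiv hζ (m + 1), exists_isQuotient_powE hζ (m + 1), hX, hη,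
    fun Y π hπ ↦ ?_⟩
  have hY := hπ.isIntegral
  have hg := isPurelyTranscendentalOn_range_stalkMap hζ hη hπ
  -- The index type `Fin m ⊕ Fin 2` is transported to `ULift (Fin (m + 2))`, the index type of the
  -- affine space.
  exact ⟨hπ.birationalOver (stablePowChart ζ hζ.pow_eq_one fun _ ↦ 1)
    (genericPoint_mem_powChart _) (finiteType_powChart _) _
    (hg.comp_equiv (Equiv.ulift.trans finSumFinEquiv.symm)), hY, hπ.apply_genericPoint, hg⟩
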